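/- **Proposition.** Let $0<q<1$, $\zeta>0$, and let $L\ge R$ be integers; put $K:=L-R\ge 0$. Let $(s_0,s_1,s_2,s_3)\in\mathbb C^4$ be *admissible*: $s_2=-\zeta q^R$, $s_3=\zeta^{-1}q^{-L}$, and the pair $(s_0,s_1)$ satisfies one of the conditions: (a) $s_0=\overline{s_1}\in\mathbb C\setminus\mathbb R$; (b) $s_0,s_1$ are real and both lie in $(\zeta^{-1}q^{m+1},\zeta^{-1}q^m)$ for some $m\in\mathbb Z$; (c) $s_0,s_1$ are real and both lie in $(-\zeta q^m,-\zeta q^{m+1})$ for some $m\in\mathbb Z$. *Notation.* $\mathbb Y$ is the set of partitions (Young diagrams), $\ell(\lambda)$ is the length and $|\lambda|$ the size of $\lambda$; $\mathrm{Sym}$ is the algebra of symmetric functions over $\mathbb C$; $(x;q)_n=\prod_{k=0}^{n-1}(1-xq^k)$ and $(x_1,\dots,x_r;q)_n=\prod_i (x_i;q)_n$. For $\mu\in\mathbb Y$ and $N\ge \ell(\mu)$ let $$I_{\mu|N}(x_1,\dots,x_N)=\frac{\det\Big[\prod_{k=0}^{\mu_i+N-i-1}(x_j-c^{(N)}_k)\Big]_{i,j=1}^N}{\prod_{1\le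 i<j\le N}(x_i-x_j)},\qquad c^{(N)}_k=s_0^{-1}q^{N-1-k}-s_0q^k ,$$ and let $I_\mu\in\mathrm{Sym}$ be the coefficientwise limit of $I_{\mu|N}$ as $N\to\infty$. For $\mu\subseteq\lambda$ let $$\sigma(\lambda,\mu)=s_0^{|\mu|-|\lambda|}\det\left[\frac{(-s_0s_1q^{\mu_k+1-k},-s_0s_2q^{\mu_k+1-k},-s_0s_3q^{\mu_k+1-k};q)_{d_{jk}}}{q^{(\mu_k+1-k)d_{jk}}\,(q,\;s_0s_1s_2s_3q^{\lambda_j+\mu_k+1-j-k};q)_{d_{jk}}}\right]_{j,k=1}^{\ell(\lambda)},\qquad d_{jk}=\lambda_j-j-\mu_k+k,$$ where entries with $d_{jk}<0$ are $0$ and the empty determinant is $1$. The *$q$-Racah symmetric functions* are $\Phi^{qR}_\lambda=\sum_{\mu\subseteq\lambda}\sigma(\lambda,\mu)\,I_\mu\in\mathrm{Sym}$, $\lambda\in\mathbb Y$. Let $\Delta=\{-\zeta^{-1}q^{-L+n}:n\ge0\}\cup\{\zeta q^{R+n}:n\ge 0\}\subset\mathbb R$, and let $\Omega^{qR}$ be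 the set of all subsets of $\Delta$, identified with $\{0,1\}^\Delta$ and given the product topology. A symmetric function $F$ defines a function $X\mapsto F(X)$ on $\Omega^{qR}$: evaluate $F$ at the points of $X$ (the points of $X$ are absolutely summable), padded by zeros. *Claim.* 1. For every $\lambda\in\mathbb Y$ the function $\Phi^{qR}_\lambda$ is real-valued on $\Omega^{qR}$. 2. There is a unique Borel probability measure $M^{qR}$ on $\Omega^{qR}$ such that, for all $\lambda\in\mathbb Y$, $\Phi^{qR}_\lambda$ is $M^{qR}$-integrable and $\int\Phi^{qR}_\lambda\,dM^{qR}=\delta_{\lambda,\varnothing}$. All the functions $\Phi^{qR}_\lambda$ belong to the real Hilbert space $L^2(\Omega^{qR},M^{qR})$. 3. The functions $\Phi^{qR}_\lambda$ with $\lambda_1\le K$ form an orthogonal basis of $L^2(\Omega^{qR},M^{qR})$: they are nonzero, pairwise orthogonal, and their linear span is dense. 4. If $\lambda_1>K$, then $\Phi^{qR}_\lambda$ has zero norm in $L^2(\Omega^{qR},M^{qR})$. -/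

import Mathlib

open Filter Topology MeasureTheory

noncomputable section

namespace QRacah

/-! ### The algebra of symmetric functions -/

/-- The algebra `Sym` of symmetric functions over `ℂ` in the variables `x₀, x₁, x₂, …`: formal
power series of bounded degree that are invariant under finitary permutations of the variables
(equivalently, under all transpositions). -/
def Sym : Subalgebra ℂ (MvPowerSeries ℕ ℂ) where
  carrier := {F | (∀ i j : ℕ, MvPowerSeries.renameEquiv ℂ (Equiv.swap i j) F = F) ∧
    ∃ d : ℕ, ∀ m : ℕ →₀ ℕ, d < m.degree → MvPowerSeries.coeff m F = 0}
  mul_mem' := by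
    rintro F G ⟨hF, d, hd⟩ ⟨hG, e, he⟩
    refine ⟨fun i j => by rw [map_mul, hF, hG], d + e, fun m hm => ?_⟩
    rw [MvPowerSeries.coeff_mul]
    refine Finset.sum_eq_zero fun p hp => ?_
    have hdeg : p.1.degree + p.2.degree = m.degree := by
      rw [← Finset.HasAntidiagonal.mem_antidiagonal.mp hp]; simp
    rcases lt_or_ge d p.1.degree with h | h
    · rw [hd _ h, zero_mul]
    · rw [he _ (by omega), mul_zero]
  add_mem' := by
    rintro F G ⟨hF, d, hd⟩ ⟨hG, e, he⟩
    refine ⟨fun i j => by rw [map_add, hF, hG], max d e, fun m hm => ?_⟩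
    rw [map_add, hd m (lt_of_le_of_lt (le_max_left _ _) hm),
      he m (lt_of_le_of_lt (le_max_right _ _) hm), add_zero]
  algebraMap_mem' := by
    intro r
    refine ⟨fun i j => AlgEquiv.commutes _ r, 0, fun m hm => ?_⟩
    have hm0 : m ≠ 0 := by rintro rfl; simp at hm
    classical
    rw [MvPowerSeries.algebraMap_apply, Algebra.algebraMap_self, RingHom.id_apply,
      MvPowerSeries.coeff_C, if_neg hm0]

/-- The value of a symmetric function at a sequence of real numbers: the sum over all monomials.
For an absolutely summable sequence this series converges absolutely. -/
def evalAt (F : Sym) (x : ℕ → ℝ) : ℂ :=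
  ∑' m : ℕ →₀ ℕ, MvPowerSeries.coeff m (F : MvPowerSeries ℕ ℂ) *
    m.prod fun i k => (x i : ℂ) ^ k

/-! ### Multiparameter Schur polynomials -/

/-- The Vandermonde product `V(x₀, …, x_{N-1}) = ∏_{i<j} (x_i - x_j)`. -/
def vand (N : ℕ) : MvPolynomial ℕ ℂ :=
  ∏ i : Fin N, ∏ j ∈ Finset.Ioi i, (MvPolynomial.X (i : ℕ) - MvPolynomial.X (j : ℕ))

/-- The Newton polynomial `(x_j ∣ c₀, c₁, …)^m = (x_j - c₀) ⋯ (x_j - c_{m-1})`. -/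
def newton (c : ℕ → ℂ) (m j : ℕ) : MvPolynomial ℕ ℂ :=
  ∏ k ∈ Finset.range m, (MvPolynomial.X j - MvPolynomial.C (c k))

/-- The alternant `det [(x_j ∣ c₀, c₁, …)^{μ_i + N - i}]`, where `i, j` run from `1` to `N`
(with indices starting at `0`, the exponent is `μ_i + N - 1 - i`). -/
def alternant (μ : YoungDiagram) (N : ℕ) (c : ℕ → ℂ) : MvPolynomial ℕ ℂ :=
  Matrix.det (Matrix.of fun i j : Fin N => newton c (μ.rowLen i + (N - 1 - i)) j)

lemma alternant_dvd {A : Type*} [CommRing A] (N : ℕ) (v : Fin N → A)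
    (p : Fin N → Polynomial A) :
    (∏ i : Fin N, ∏ j ∈ Finset.Ioi i, (v j - v i)) ∣
      Matrix.det (Matrix.of fun j i : Fin N => (p i).eval (v j)) := by
  induction N with
  | zero => simp
  | succ n ih =>
    have hq : ∀ i, ∃ r : Polynomial A, p i - Polynomial.C ((p i).eval (v 0)) =
        (Polynomial.X - Polynomial.C (v 0)) * r := fun i => Polynomial.X_sub_C_dvd_sub_C_eval
    choose r hr using hq
    have hr' : ∀ i j, (p i).eval (v j) = (v j - v 0) * (r i).eval (v j) + (p i).eval (v 0) := by
      intro i j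
      have := congrArg (Polynomial.eval (v j)) (hr i)
      simp only [Polynomial.eval_sub, Polynomial.eval_C, Polynomial.eval_mul,
        Polynomial.eval_X] at this
      linear_combination this
    set B : Matrix (Fin (n + 1)) (Fin (n + 1)) A := Matrix.of (Fin.cons (fun i => (p i).eval (v 0))
      (fun j i => (v j.succ - v 0) * (r i).eval (v j.succ))) with hB
    have hdet : Matrix.det (Matrix.of fun j i : Fin (n + 1) => (p i).eval (v j)) = B.det := by
      refine Matrix.det_eq_of_forall_row_eq_smul_add_const (fun j => if j = 0 then 0 else 1) 0
        (by simp) ?_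
      intro j i
      refine Fin.cases ?_ (fun j => ?_) j
      · simp [hB]
      · simp [hB, hr' i j.succ]
    rw [hdet, Matrix.det_succ_row_zero, Fin.prod_univ_succ]
    refine Finset.dvd_sum fun i _ => Dvd.dvd.mul_left ?_ _
    have hsub : B.submatrix Fin.succ i.succAbove = Matrix.of fun j k : Fin n =>
        (v j.succ - v 0) * (Matrix.of fun j k : Fin n =>
          (r (i.succAbove k)).eval (v j.succ)) j k := by
      ext j k; simp [hB]
    rw [hsub, Matrix.det_mul_column]
    refine mul_dvd_mul ?_ ?_
    · rw [Fin.Ioi_zero_eq_map, Finset.prod_map]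
      simp
    · have := ih (fun j => v j.succ) (fun k => r (i.succAbove k))
      refine dvd_trans (dvd_of_eq ?_) this
      refine Finset.prod_congr rfl fun i _ => ?_
      rw [← Fin.map_succEmb_Ioi, Finset.prod_map]
      simp

lemma vand_eq (N : ℕ) : ∃ u : ℤˣ, vand N = ((u : ℤ) : MvPolynomial ℕ ℂ) *
    ∏ i : Fin N, ∏ j ∈ Finset.Ioi i,
      ((MvPolynomial.X (j : ℕ) : MvPolynomial ℕ ℂ) - MvPolynomial.X (i : ℕ)) := by
  refine ⟨∏ i : Fin N, ∏ j ∈ Finset.Ioi i, (-1), ?_⟩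
  simp only [vand, Units.coe_prod, Int.cast_prod, ← Finset.prod_mul_distrib]
  refine Finset.prod_congr rfl fun i _ => Finset.prod_congr rfl fun j _ => ?_
  simp

lemma vand_dvd_alternant (μ : YoungDiagram) (N : ℕ) (c : ℕ → ℂ) :
    vand N ∣ alternant μ N c := by
  obtain ⟨u, hu⟩ := vand_eq N
  have hunit : IsUnit (((u : ℤ) : MvPolynomial ℕ ℂ)) :=
    (u.isUnit).map (Int.castRingHom (MvPolynomial ℕ ℂ))
  rw [hu, hunit.mul_left_dvd]
  have := alternant_dvd N (fun j : Fin N => (MvPolynomial.X (j : ℕ) : MvPolynomial ℕ ℂ))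
    (fun i => ∏ k ∈ Finset.range (μ.rowLen i + (N - 1 - i)),
      (Polynomial.X - Polynomial.C (MvPolynomial.C (c k))))
  refine dvd_trans this (dvd_of_eq ?_)
  rw [alternant, ← Matrix.det_transpose]
  congr 1
  ext i j : 2
  simp [newton, Polynomial.eval_prod]

/-- The multiparameter Schur polynomial `s_{μ∣N}(x₀, …, x_{N-1} ∣ c₀, c₁, …)`: the alternant
divided by the Vandermonde product (and `0` if `μ` has more than `N` rows). -/
def multiSchur (μ : YoungDiagram) (N : ℕ) (c : ℕ → ℂ) : MvPolynomial ℕ ℂ :=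
  if μ.colLen 0 ≤ N then (vand_dvd_alternant μ N c).choose else 0

lemma multiSchur_spec (μ : YoungDiagram) (N : ℕ) (c : ℕ → ℂ) (h : μ.colLen 0 ≤ N) :
    alternant μ N c = vand N * multiSchur μ N c := by
  rw [multiSchur, if_pos h]
  exact (vand_dvd_alternant μ N c).choose_spec

lemma vand_ne_zero (N : ℕ) : vand N ≠ 0 := by
  refine Finset.prod_ne_zero_iff.mpr fun i _ => Finset.prod_ne_zero_iff.mpr fun j hj => ?_
  rw [sub_ne_zero]
  intro h
  have := MvPolynomial.X_injective h
  have hij := Finset.mem_Ioi.mp hj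
  exact absurd (Fin.ext this) (ne_of_lt hij)

lemma swap_val {N i j : ℕ} (hi : i < N) (hj : j < N) (k : Fin N) :
    Equiv.swap i j (k : ℕ) = ((Equiv.swap (⟨i, hi⟩ : Fin N) ⟨j, hj⟩ k : Fin N) : ℕ) := by
  simp only [Equiv.swap_apply_def, Fin.ext_iff]
  split_ifs <;> rfl

lemma rename_alternant (μ : YoungDiagram) (N : ℕ) (c : ℕ → ℂ) {i j : ℕ} (hi : i < N) (hj : j < N)
    (hij : i ≠ j) :
    MvPolynomial.rename (Equiv.swap i j) (alternant μ N c) = -alternant μ N c := by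
  have : MvPolynomial.rename (Equiv.swap i j) (alternant μ N c) = Matrix.det
      ((Matrix.of fun i j : Fin N => newton c (μ.rowLen i + (N - 1 - i)) j).submatrix id
        (Equiv.swap (⟨i, hi⟩ : Fin N) ⟨j, hj⟩)) := by
    rw [alternant, AlgHom.map_det]
    congr 1
    ext a b : 2
    simp [newton, map_prod, swap_val hi hj]
  rw [this, Matrix.det_permute', Equiv.Perm.sign_swap (by simpa using hij), alternant]
  simp

lemma rename_vand (N : ℕ) {i j : ℕ} (hi : i < N) (hj : j < N) (hij : i ≠ j) :
    MvPolynomial.rename (Equiv.swap i j) (vand N) = -vand N := by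
  obtain ⟨u, hu⟩ := vand_eq N
  have h1 := Matrix.det_vandermonde
    (fun k : Fin N => (MvPolynomial.X (k : ℕ) : MvPolynomial ℕ ℂ))
  rw [hu, ← h1, map_mul, map_intCast, AlgHom.map_det]
  have : (MvPolynomial.rename (Equiv.swap i j)).mapMatrix (Matrix.vandermonde
      (fun k : Fin N => (MvPolynomial.X (k : ℕ) : MvPolynomial ℕ ℂ))) =
      (Matrix.vandermonde (fun k : Fin N => (MvPolynomial.X (k : ℕ) : MvPolynomial ℕ ℂ))).submatrix
        (Equiv.swap (⟨i, hi⟩ : Fin N) ⟨j, hj⟩) id := by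
    ext a b : 2
    simp [Matrix.vandermonde_apply, swap_val hi hj]
  rw [this, Matrix.det_permute, Equiv.Perm.sign_swap (by simpa using hij)]
  simp

lemma rename_multiSchur (μ : YoungDiagram) (N : ℕ) (c : ℕ → ℂ) {i j : ℕ} (hi : i < N)
    (hj : j < N) :
    MvPolynomial.rename (Equiv.swap i j) (multiSchur μ N c) = multiSchur μ N c := by
  rcases eq_or_ne i j with rfl | hij
  · simp
  by_cases h : μ.colLen 0 ≤ N
  · have h1 := multiSchur_spec μ N c h
    have h2 := congrArg (MvPolynomial.rename (Equiv.swap i j)) h1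
    rw [map_mul, rename_alternant μ N c hi hj hij, rename_vand N hi hj hij, h1] at h2
    have h3 : vand N * multiSchur μ N c =
        vand N * MvPolynomial.rename (Equiv.swap i j) (multiSchur μ N c) := by
      linear_combination -h2
    exact (mul_left_cancel₀ (vand_ne_zero N) h3).symm
  · simp [multiSchur, h]

lemma totalDegree_vand (N : ℕ) : (vand N).totalDegree = ∑ i : Fin N, (N - 1 - i) := by
  have hX : ∀ i : Fin N, ∀ j ∈ Finset.Ioi i,
      ((MvPolynomial.X (i : ℕ) : MvPolynomial ℕ ℂ) - MvPolynomial.X (j : ℕ)).IsHomogeneous 1 :=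
    fun i j _ => (MvPolynomial.isHomogeneous_X _ _).sub (MvPolynomial.isHomogeneous_X _ _)
  have : (vand N).IsHomogeneous (∑ i : Fin N, ∑ j ∈ Finset.Ioi i, 1) :=
    MvPolynomial.IsHomogeneous.prod _ _ _ fun i _ =>
      MvPolynomial.IsHomogeneous.prod _ _ _ fun j hj => hX i j hj
  rw [this.totalDegree (vand_ne_zero N)]
  simp

lemma totalDegree_newton_le (c : ℕ → ℂ) (m j : ℕ) : (newton c m j).totalDegree ≤ m := by
  refine (MvPolynomial.totalDegree_finsetProd _ _).trans ?_
  refine (Finset.sum_le_card_nsmul _ _ 1 fun k _ => ?_).trans (by simp)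
  exact (MvPolynomial.totalDegree_sub_C_le _ _).trans (by simp)

lemma sum_rowLen_le (μ : YoungDiagram) (N : ℕ) : ∑ i : Fin N, μ.rowLen i ≤ μ.card := by
  rw [Fin.sum_univ_eq_sum_range (fun i => μ.rowLen i)]
  calc ∑ i ∈ Finset.range N, μ.rowLen i = ∑ i ∈ Finset.range N, (μ.row i).card := by
        simp [YoungDiagram.rowLen_eq_card]
    _ = ((Finset.range N).biUnion μ.row).card := by
        rw [Finset.card_biUnion]
        intro i _ j _ hij
        rw [Function.onFun, Finset.disjoint_left]
        intro a ha hb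
        rw [YoungDiagram.mem_row_iff] at ha hb
        exact hij (ha.2.symm.trans hb.2)
    _ ≤ μ.card := Finset.card_le_card fun a ha => by
        obtain ⟨i, _, hi⟩ := Finset.mem_biUnion.mp ha
        exact (YoungDiagram.mem_cells a).mpr (YoungDiagram.mem_row_iff.mp hi).1

lemma totalDegree_alternant_le (μ : YoungDiagram) (N : ℕ) (c : ℕ → ℂ) :
    (alternant μ N c).totalDegree ≤ μ.card + ∑ i : Fin N, (N - 1 - (i : ℕ)) := by
  rw [alternant, Matrix.det_apply]
  refine MvPolynomial.totalDegree_finsetSum_le fun σ _ => ?_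
  have h1 : (∏ i, (Matrix.of fun i j : Fin N =>
      newton c (μ.rowLen i + (N - 1 - i)) j) (σ i) i).totalDegree ≤
      μ.card + ∑ i : Fin N, (N - 1 - (i : ℕ)) := by
    refine (MvPolynomial.totalDegree_finsetProd _ _).trans ?_
    calc _ ≤ ∑ i : Fin N, (μ.rowLen (σ i) + (N - 1 - (σ i : ℕ))) :=
          Finset.sum_le_sum fun i _ => totalDegree_newton_le _ _ _
      _ = ∑ i : Fin N, (μ.rowLen i + (N - 1 - (i : ℕ))) :=
          Equiv.sum_comp σ (fun i : Fin N => μ.rowLen i + (N - 1 - (i : ℕ)))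
      _ ≤ _ := by
          rw [Finset.sum_add_distrib]
          exact Nat.add_le_add_right (sum_rowLen_le μ N) _
  rcases Int.units_eq_one_or (Equiv.Perm.sign σ) with h | h
  · rw [h, one_smul]; exact h1
  · rw [h, Units.neg_smul, one_smul, MvPolynomial.totalDegree_neg]; exact h1

lemma totalDegree_multiSchur_le (μ : YoungDiagram) (N : ℕ) (c : ℕ → ℂ) :
    (multiSchur μ N c).totalDegree ≤ μ.card := by
  by_cases h0 : multiSchur μ N c = 0
  · simp [h0]
  by_cases h : μ.colLen 0 ≤ N
  · have h1 := totalDegree_alternant_le μ N c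
    rw [multiSchur_spec μ N c h,
      MvPolynomial.totalDegree_mul_of_isDomain (vand_ne_zero N) h0, totalDegree_vand] at h1
    omega
  · simp [multiSchur, h]

/-! ### Interpolation symmetric functions -/

/-- The symmetric function `lim_{N → ∞} s_{μ∣N}(· ∣ c^{(N)}₀, c^{(N)}₁, …)`, the limit being taken
coefficientwise. As the degrees are bounded by `|μ|`, this is the limit in the finite-dimensional
space of symmetric functions of degree at most `|μ|`. -/
def limitSchur (c : ℕ → ℕ → ℂ) (μ : YoungDiagram) : Sym where
  val := fun m => limUnder atTop fun N => MvPolynomial.coeff m (multiSchur μ N (c N))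
  property := by
    refine ⟨fun i j => ?_, μ.card, fun m hm => ?_⟩
    · have key : ∀ m : ℕ →₀ ℕ,
          (limUnder atTop fun N => MvPolynomial.coeff
            (m.embDomain (Equiv.swap i j).toEmbedding) (multiSchur μ N (c N))) =
          limUnder atTop fun N => MvPolynomial.coeff m (multiSchur μ N (c N)) := by
        intro m
        unfold limUnder
        congr 1
        refine Filter.map_congr ?_
        filter_upwards [eventually_gt_atTop (max i j)] with N hN
        rw [max_lt_iff] at hN
        conv_lhs => rw [← rename_multiSchur μ N (c N) hN.1 hN.2]
        rw [Finsupp.embDomain_eq_mapDomain]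
        exact MvPolynomial.coeff_rename_mapDomain _ (Equiv.swap i j).injective _ _
      refine MvPowerSeries.ext fun m => ?_
      obtain ⟨m', rfl⟩ : ∃ m' : ℕ →₀ ℕ, m = m'.embDomain (Equiv.swap i j).toEmbedding := by
        refine ⟨m.embDomain (Equiv.swap i j).toEmbedding, ?_⟩
        ext k
        conv_rhs => rw [← Equiv.swap_apply_right i j]
        obtain ⟨l, rfl⟩ := (Equiv.swap i j).surjective k
        have e1 := Finsupp.embDomain_apply_self (Equiv.swap i j).toEmbedding
          (m.embDomain (Equiv.swap i j).toEmbedding) l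
        have e2 := Finsupp.embDomain_apply_self (Equiv.swap i j).toEmbedding m
          (Equiv.swap i j l)
        simp only [Equiv.coe_toEmbedding, Equiv.swap_apply_self] at e1 e2
        simp only [Equiv.swap_apply_right]
        rw [e1, e2]
      exact (MvPowerSeries.coeff_embDomain_rename (R := ℂ) (Equiv.swap i j).toEmbedding _ m').trans
        (key m').symm
    · have : ∀ N, MvPolynomial.coeff m (multiSchur μ N (c N)) = 0 := fun N =>
        MvPolynomial.coeff_eq_zero_of_totalDegree_lt
          (lt_of_le_of_lt (totalDegree_multiSchur_le μ N (c N)) hm)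
      change (limUnder atTop fun N => MvPolynomial.coeff m (multiSchur μ N (c N))) = 0
      simp only [this]
      exact tendsto_const_nhds.limUnder_eq

/-- The nodes `s⁻¹ q^{N-1-i} - s q^i`, `i = 0, 1, 2, …`. -/
def bcNode (q : ℝ) (s : ℂ) (N i : ℕ) : ℂ :=
  s⁻¹ * (q : ℂ) ^ ((N : ℤ) - 1 - i) - s * (q : ℂ) ^ i

/-- The interpolation symmetric functions of type `BC` for functions of the variable
`x = v - v⁻¹`: the large-`N` limits of the multiparameter Schur polynomials with the nodes
`s⁻¹ q^{N-1-i} - s q^i`. -/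
def interpBC (q : ℝ) (s : ℂ) (μ : YoungDiagram) : Sym :=
  limitSchur (bcNode q s) μ

/-! ### The `q`-Racah symmetric functions -/

/-- The `q`-Pochhammer symbol `(x; q)_n = ∏_{k=0}^{n-1} (1 - x q^k)`. -/
def qPoch (q : ℝ) (x : ℂ) (n : ℕ) : ℂ :=
  ∏ k ∈ Finset.range n, (1 - x * (q : ℂ) ^ k)

/-- The `(j, k)` entry of the determinant in the coefficient `σ(lam, μ)`. The indices start at `0`,
so that `d = lam_j - j - μ_k + k` and `e = μ_k - k`. Because of the factor `1 / (q; q)_d`, the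
entry is `0` for `d < 0`. -/
def sigmaEntry (q : ℝ) (s₀ s₁ s₂ s₃ : ℂ) (lam μ : YoungDiagram) (j k : ℕ) : ℂ :=
  let d : ℤ := (lam.rowLen j : ℤ) - j - μ.rowLen k + k
  let e : ℤ := (μ.rowLen k : ℤ) - k
  if d < 0 then 0
  else
    (qPoch q (-(s₀ * s₁ * (q : ℂ) ^ e)) d.toNat * qPoch q (-(s₀ * s₂ * (q : ℂ) ^ e)) d.toNat *
        qPoch q (-(s₀ * s₃ * (q : ℂ) ^ e)) d.toNat) /
      ((q : ℂ) ^ (e * d) * (qPoch q (q : ℂ) d.toNat *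
        qPoch q (s₀ * s₁ * s₂ * s₃ *
          (q : ℂ) ^ ((lam.rowLen j : ℤ) + μ.rowLen k - 1 - j - k)) d.toNat))

/-- The coefficient `σ(lam, μ; q; s₀, s₁, s₂, s₃)`. -/
def sigma (q : ℝ) (s₀ s₁ s₂ s₃ : ℂ) (lam μ : YoungDiagram) : ℂ :=
  s₀ ^ ((μ.card : ℤ) - lam.card) *
    Matrix.det (Matrix.of fun j k : Fin (lam.colLen 0) => sigmaEntry q s₀ s₁ s₂ s₃ lam μ j k)

lemma finite_Iic (lam : YoungDiagram) : (Set.Iic lam).Finite := by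
  refine Set.Finite.of_finite_image (f := YoungDiagram.cells) ?_ ?_
  · refine (lam.cells.powerset.finite_toSet).subset ?_
    rintro _ ⟨μ, hμ, rfl⟩
    simpa using (YoungDiagram.cells_subset_iff.mpr hμ)
  · intro a _ b _ h
    exact YoungDiagram.ext h

/-- The `q`-Racah symmetric function
`Φ_lam = ∑_{μ ⊆ lam} σ(lam, μ; q; s₀, s₁, s₂, s₃) I_μ(·; q; s₀)`. -/
def Phi (q : ℝ) (s₀ s₁ s₂ s₃ : ℂ) (lam : YoungDiagram) : Sym :=
  ∑ μ ∈ (finite_Iic lam).toFinset, sigma q s₀ s₁ s₂ s₃ lam μ • interpBC q s₀ μ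

/-! ### Admissible parameters and point configurations -/

/-- Admissible quadruples of parameters. -/
def Admissible (q ζ : ℝ) (L R : ℤ) (s₀ s₁ s₂ s₃ : ℂ) : Prop :=
  R ≤ L ∧ s₂ = -((ζ * q ^ R : ℝ) : ℂ) ∧ s₃ = ((ζ⁻¹ * q ^ (-L) : ℝ) : ℂ) ∧
    ((s₀ = starRingEnd ℂ s₁ ∧ s₀.im ≠ 0) ∨
      (∃ a b : ℝ, s₀ = a ∧ s₁ = b ∧ ∃ m : ℤ,
        a ∈ Set.Ioo (ζ⁻¹ * q ^ (m + 1)) (ζ⁻¹ * q ^ m) ∧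
        b ∈ Set.Ioo (ζ⁻¹ * q ^ (m + 1)) (ζ⁻¹ * q ^ m)) ∨
      (∃ a b : ℝ, s₀ = a ∧ s₁ = b ∧ ∃ m : ℤ,
        a ∈ Set.Ioo (-(ζ * q ^ m)) (-(ζ * q ^ (m + 1))) ∧
        b ∈ Set.Ioo (-(ζ * q ^ m)) (-(ζ * q ^ (m + 1)))))

/-- The infinite grid
`{-ζ⁻¹ q^{-L}, -ζ⁻¹ q^{1-L}, …} ∪ {…, ζ q^{R+1}, ζ q^R}` on the real line. -/
def grid (q ζ : ℝ) (L R : ℤ) : Set ℝ :=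
  {x | ∃ n : ℕ, x = -(ζ⁻¹ * q ^ (-L + n))} ∪ {x | ∃ n : ℕ, x = ζ * q ^ (R + n)}

/-- The space of point configurations (subsets of the grid), identified with `{0, 1}^grid`, with
the product topology and the product σ-algebra (which is the Borel one, as the grid is
countable). -/
abbrev Config (q ζ : ℝ) (L R : ℤ) : Type := grid q ζ L R → Bool

/-- An enumeration of the grid: `ζ q^R, -ζ⁻¹ q^{-L}, ζ q^{R+1}, -ζ⁻¹ q^{1-L}, …`. -/
def gridPoint (q ζ : ℝ) (L R : ℤ) (n : ℕ) : grid q ζ L R :=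
  if n % 2 = 0 then ⟨ζ * q ^ (R + ((n / 2 : ℕ) : ℤ)), Or.inr ⟨n / 2, rfl⟩⟩
  else ⟨-(ζ⁻¹ * q ^ (-L + ((n / 2 : ℕ) : ℤ))), Or.inl ⟨n / 2, rfl⟩⟩

/-- The sequence that lists the points of a configuration, each of them once, and zeros. -/
def configSeq {q ζ : ℝ} {L R : ℤ} (X : Config q ζ L R) (n : ℕ) : ℝ :=
  if X (gridPoint q ζ L R n) = true then (gridPoint q ζ L R n : ℝ) else 0

/-- The value `Φ_lam(X)` of the `q`-Racah symmetric function at a configuration `X`. -/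
def PhiFun (q ζ : ℝ) (L R : ℤ) (s₀ s₁ s₂ s₃ : ℂ) (lam : YoungDiagram)
    (X : Config q ζ L R) : ℂ :=
  evalAt (Phi q s₀ s₁ s₂ s₃ lam) (configSeq X)

/-- `M` satisfies `⟨M, Φ_lam⟩ = δ_{lam, ∅}` for all partitions `lam`. -/
def IsOrthMeasure (q ζ : ℝ) (L R : ℤ) (s₀ s₁ s₂ s₃ : ℂ) (M : Measure (Config q ζ L R)) : Prop :=
  ∀ lam : YoungDiagram, Integrable (PhiFun q ζ L R s₀ s₁ s₂ s₃ lam) M ∧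
    ((lam = ⊥ → ∫ X, PhiFun q ζ L R s₀ s₁ s₂ s₃ lam X ∂M = 1) ∧
      (lam ≠ ⊥ → ∫ X, PhiFun q ζ L R s₀ s₁ s₂ s₃ lam X ∂M = 0))

/-- An orthogonal basis of a real Hilbert space: nonzero pairwise orthogonal vectors whose linear
span is dense. -/
def IsOrthogonalBasis {ι E : Type*} [NormedAddCommGroup E] [InnerProductSpace ℝ E]
    (v : ι → E) : Prop :=
  (∀ i, v i ≠ 0) ∧ (∀ i j, i ≠ j → inner ℝ (v i) (v j) = 0) ∧
    (Submodule.span ℝ (Set.range v)).topologicalClosure = ⊤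

end QRacah

end

/-! Notation: G_b(w) = (-s₀w;q)_∞ (s₀⁻¹q^{-b}w;q)_∞ is `nodeSeries`, F_a(w) = Σ_d A(a,d) w^d
G_{a-d}(w) is `racahSeries`, where A is the univariate coefficient behind σ, and H_X(w) = ∏ 1/(1-xw)
over the points x of X generates the complete symmetric functions. Indices start at 0.

The Jacobi-Trudi formula for multiparameter Schur polynomials survives the limit N → ∞, and
Cauchy-Binet performs the sum over μ. Hence Φ_λ(X) = det [w^{λ_i-i+k}] F_{λ_i-i-1}(w) H_X(w)
(`evalAt_Phi`).

The series satisfy F_a = F_{a+1} + β_a w F_a + γ_a w² F_{a-1}, with β and γ symmetric in the four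
parameters, and F_a → 1 as a → -∞. These two facts determine F (`eq_of_recurrence`), so F is
symmetric in the parameters, which its definition hides. Exchanging s₀ and s₁ gives real values.
Exchanging s₀ and s₂ adapts the nodes to the grid: with s₂ in place of s₀, G_K is the reciprocal of
the series H of the full grid, so F_a H is a polynomial of degree at most a-K when a ≥ K.

The functionals ℓ_m(u^p) = [w^{p-m}] F_{K-1-m}(w) H(w) therefore vanish for m < 0, and the
recurrence for F says that multiplication by u acts on them as a Jacobi matrix. This yields monic
polynomials P_m with ℓ_0(P_m f) = h_m ℓ_m(f) and h_m ≠ 0: they are orthogonal for ℓ_0, and the ℓ_m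
are dual to them. Comparison on a basis of Newton type shows that ℓ_0 is the normalized sum over the
grid with positive weights solving a Pearson equation (`weightSum_eq`).

Remove K points y_j from the grid. Then H acquires the factor ∏(1-y_j w), and Φ_λ becomes det
ℓ_{K+i-λ_i}(u^k ∏(u-y_j)). For λ₁ > K its first row is zero. For λ₁ ≤ K, bordering by the K
evaluations at the y_j gives V(y) Φ_λ = ± det P_{s_j}(y_k), where s enumerates the complement of the
numbers K+i-λ_i (`exists_vandAt_mul_evalAt_Phi`). So let y follow the K-point orthogonal polynomial
ensemble, with density proportional to V². Andréief's identity makes the Φ_λ with λ₁ ≤ K orthogonal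
with nonzero norms, and the others are null. The measure sought is the law of the complement of y;
its moments are the orthogonality relations with Φ_∅ = 1.

Finally, the Φ_λ span all products of the h_n, and the h_n separate configurations. By
Stone-Weierstrass the span is dense in the continuous functions on the compact space Ω, which gives
both uniqueness of the measure and completeness in L². -/

open Filter Topology MeasureTheory

noncomputable section

namespace QRacah

/-! ### Determinants of power series coefficients -/

section JacobiTrudi

variable {A : Type*} [CommRing A]

/-- The coefficient of a power series at an integer index, zero for negative indices. -/
def coeffZ (n : ℤ) (f : PowerSeries A) : A := if n < 0 then 0 else PowerSeries.coeff n.toNat f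

lemma coeffZ_natCast (n : ℕ) (f : PowerSeries A) : coeffZ (n : ℤ) f = PowerSeries.coeff n f := by
  simp [coeffZ]

lemma coeffZ_of_neg {n : ℤ} (h : n < 0) (f : PowerSeries A) : coeffZ n f = 0 := by
  simp [coeffZ, h]

lemma coeffZ_of_nonneg {n : ℤ} (h : 0 ≤ n) (f : PowerSeries A) :
    coeffZ n f = PowerSeries.coeff n.toNat f := by
  simp [coeffZ, not_lt.mpr h]

lemma coeffZ_add (n : ℤ) (f g : PowerSeries A) : coeffZ n (f + g) = coeffZ n f + coeffZ n g := by
  unfold coeffZ; split_ifs <;> simp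

lemma coeffZ_C_mul (n : ℤ) (a : A) (f : PowerSeries A) :
    coeffZ n (PowerSeries.C a * f) = a * coeffZ n f := by
  unfold coeffZ; split_ifs <;> simp

lemma coeffZ_X_mul (n : ℤ) (f : PowerSeries A) :
    coeffZ n (PowerSeries.X * f) = coeffZ (n - 1) f := by
  rcases lt_trichotomy n 0 with h | rfl | h
  · rw [coeffZ_of_neg h, coeffZ_of_neg (by omega)]
  · rw [coeffZ_of_neg (n := 0 - 1) (by omega)]
    simp [coeffZ]
  · obtain ⟨m, rfl⟩ : ∃ m : ℕ, n = (m + 1 : ℕ) := ⟨n.toNat - 1, by omega⟩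
    rw [coeffZ_natCast, PowerSeries.coeff_succ_X_mul, ← coeffZ_natCast]
    congr 1; push_cast; ring

/-- The power series `1 - c w`. -/
def lin (c : A) : PowerSeries A := 1 - PowerSeries.C c * PowerSeries.X

lemma coeff_zero_lin_mul (c : A) (f : PowerSeries A) :
    PowerSeries.coeff 0 (lin c * f) = PowerSeries.coeff 0 f := by
  simp [lin, sub_mul, mul_assoc]

lemma coeff_succ_lin_mul (c : A) (n : ℕ) (f : PowerSeries A) :
    PowerSeries.coeff (n + 1) (lin c * f) =
      PowerSeries.coeff (n + 1) f - c * PowerSeries.coeff n f := by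
  simp [lin, sub_mul, mul_assoc, PowerSeries.coeff_succ_X_mul]

@[simp] lemma constantCoeff_lin (c : A) : PowerSeries.constantCoeff (lin c) = 1 := by
  simp [lin]

lemma coeff_prod_lin_eq_zero {ι : Type*} (s : Finset ι) (c : ι → A) :
    ∀ r, s.card < r → PowerSeries.coeff r (∏ i ∈ s, lin (c i)) = 0 := by
  classical
  induction s using Finset.induction_on with
  | empty => intro r hr; simp at hr; simp [PowerSeries.coeff_one]; omega
  | insert a s ha ih =>
    intro r hr
    rw [Finset.card_insert_of_notMem ha] at hr
    obtain ⟨r, rfl⟩ : ∃ k, r = k + 1 := ⟨r - 1, by omega⟩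
    rw [Finset.prod_insert ha, coeff_succ_lin_mul, ih _ (by omega), ih _ (by omega)]
    simp

/-- The geometric series `1 / (1 - x w)`. -/
def geom (x : A) : PowerSeries A := PowerSeries.mk fun n => x ^ n

lemma lin_mul_geom (x : A) : lin x * geom x = 1 := by
  ext n
  cases n with
  | zero => rw [coeff_zero_lin_mul]; simp [geom]
  | succ n =>
    rw [coeff_succ_lin_mul]
    simp [geom, PowerSeries.coeff_one, pow_succ']

/-- At r = 0 a Newton polynomial becomes a power series coefficient. The extra r is carried for the
induction: each new factor 1 - cw combines two neighbouring coefficients of the tail, which is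
geometric. -/
lemma coeff_prod_lin_mul_geom (c : ℕ → A) (x : A) (m : ℕ) : ∀ r,
    PowerSeries.coeff (m + r) ((∏ t ∈ Finset.range m, lin (c t)) * geom x) =
      x ^ r * ∏ t ∈ Finset.range m, (x - c t) := by
  induction m with
  | zero => intro r; simp [geom]
  | succ m ih =>
    intro r
    rw [Finset.prod_range_succ, mul_comm _ (lin (c m)), mul_assoc,
      show m + 1 + r = m + r + 1 by ring, coeff_succ_lin_mul, add_assoc, ih, ih,
      Finset.prod_range_succ]
    ring

/-- The range of summation does not depend on m: beyond m the factor `coeffZ` vanishes, beyond N the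
coefficient of Q does. This uniformity is what allows a matrix factorization. -/
lemma coeff_mul_eq_sum_coeffZ (f Q : PowerSeries A) (N m : ℕ)
    (hQ : ∀ r, N ≤ r → PowerSeries.coeff r Q = 0) :
    PowerSeries.coeff m (f * Q) =
      ∑ r ∈ Finset.range N, coeffZ ((m : ℤ) - r) f * PowerSeries.coeff r Q := by
  have h1 : PowerSeries.coeff m (f * Q) =
      ∑ r ∈ Finset.range (m + 1), coeffZ ((m : ℤ) - r) f * PowerSeries.coeff r Q := by
    rw [mul_comm, PowerSeries.coeff_mul, Finset.Nat.sum_antidiagonal_eq_sum_range_succ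
      (fun i j => PowerSeries.coeff i Q * PowerSeries.coeff j f)]
    refine Finset.sum_congr rfl fun r hr => ?_
    have hr' : r ≤ m := by simpa [Nat.lt_succ_iff] using hr
    rw [← Nat.cast_sub hr', coeffZ_natCast, mul_comm]
  have h2 : ∀ a b : ℕ, (∀ r, a ≤ r → r < b → coeffZ ((m : ℤ) - r) f * PowerSeries.coeff r Q = 0) →
      a ≤ b → ∑ r ∈ Finset.range a, coeffZ ((m : ℤ) - r) f * PowerSeries.coeff r Q =
        ∑ r ∈ Finset.range b, coeffZ ((m : ℤ) - r) f * PowerSeries.coeff r Q := by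
    intro a b h hab
    refine Finset.sum_subset (by simpa using hab) fun r hr hr' => h r ?_ ?_
    · simpa using hr'
    · simpa using hr
  rw [h1, h2 (m + 1) (max (m + 1) N), h2 N (max (m + 1) N)]
  · intro r hr _; rw [hQ r hr, mul_zero]
  · exact le_max_right _ _
  · intro r hr _; rw [coeffZ_of_neg (by omega), zero_mul]
  · exact le_max_left _ _

/-- Expansion along the last row, whose only nonzero entry is the diagonal 1. -/
lemma det_eq_det_of_unitriangular (f : ℕ → ℕ → A) (n N : ℕ) (hn : n ≤ N)
    (h1 : ∀ i, n ≤ i → f i i = 1) (h0 : ∀ i k, n ≤ i → k < i → f i k = 0) :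
    Matrix.det (Matrix.of fun i k : Fin N => f i k) =
      Matrix.det (Matrix.of fun i k : Fin n => f i k) := by
  induction N, hn using Nat.le_induction with
  | base => rfl
  | succ N hN ih =>
    rw [← ih, Matrix.det_succ_row _ (Fin.last N), Fin.sum_univ_castSucc]
    have : ∀ k : Fin N, f N k = 0 := fun k => h0 N k hN k.2
    simp only [Matrix.of_apply, Fin.val_last, Fin.val_castSucc, this, h1 N hN]
    simp only [mul_zero, zero_mul, Finset.sum_const_zero, zero_add, mul_one]
    rw [Even.neg_one_pow (by simp), one_mul]
    congr 1
    ext i k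
    simp

/-- Since 1/(1-x_j w) = H(w) ∏_{l≠j} (1-x_l w) and the last product has degree below N, the matrix
factors: the first factor does not involve j, the second involves neither P nor m. The second is
later recognized as the Vandermonde determinant. -/
lemma det_coeff_mul_geom {N : ℕ} (x : Fin N → A) (H : PowerSeries A)
    (hH : H * ∏ i, lin (x i) = 1) (P : Fin N → PowerSeries A) (m : Fin N → ℕ) :
    Matrix.det (Matrix.of fun i j => PowerSeries.coeff (m i) (P i * geom (x j))) =
      Matrix.det (Matrix.of fun i k : Fin N =>
        coeffZ ((m i : ℤ) - ((N - 1 - k : ℕ) : ℤ)) (P i * H)) *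
      Matrix.det (Matrix.of fun k j : Fin N =>
        PowerSeries.coeff (N - 1 - k : ℕ) (∏ l ∈ Finset.univ.erase j, lin (x l))) := by
  rw [← Matrix.det_mul]
  congr 1
  ext i j
  simp only [Matrix.of_apply, Matrix.mul_apply]
  have hg : geom (x j) = H * ∏ l ∈ Finset.univ.erase j, lin (x l) := by
    have h := Finset.mul_prod_erase Finset.univ (fun l => lin (x l)) (Finset.mem_univ j)
    calc geom (x j) = (H * ∏ i, lin (x i)) * geom (x j) := by rw [hH, one_mul]
      _ = (H * ∏ l ∈ Finset.univ.erase j, lin (x l)) * (lin (x j) * geom (x j)) := by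
          rw [← h]; ring
      _ = _ := by rw [lin_mul_geom, mul_one]
  rw [hg, ← mul_assoc, coeff_mul_eq_sum_coeffZ _ _ N, ← Finset.sum_range_reflect,
    ← Fin.sum_univ_eq_sum_range (fun k => coeffZ ((m i : ℤ) - ((N - 1 - k : ℕ) : ℤ)) (P i * H) *
      PowerSeries.coeff (N - 1 - k : ℕ) (∏ l ∈ Finset.univ.erase j, lin (x l)))]
  intro r hr
  refine coeff_prod_lin_eq_zero _ _ r ?_
  rw [Finset.card_erase_of_mem (Finset.mem_univ j), Finset.card_univ, Fintype.card_fin]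
  have := j.2
  omega

end JacobiTrudi

/-! ### Jacobi-Trudi formula for multiparameter Schur polynomials -/

/-- The generating series of the complete homogeneous polynomials in `N` variables. -/
def completeSeries (N : ℕ) : PowerSeries (MvPolynomial ℕ ℂ) :=
  ∏ i ∈ Finset.range N, geom (MvPolynomial.X i)

lemma completeSeries_mul (N : ℕ) :
    completeSeries N * ∏ i : Fin N, lin (MvPolynomial.X (i : ℕ)) = 1 := by
  rw [Fin.prod_univ_eq_prod_range (fun i => lin (MvPolynomial.X i : MvPolynomial ℕ ℂ)),
    completeSeries, ← Finset.prod_mul_distrib]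
  exact Finset.prod_eq_one fun i _ => by rw [mul_comm, lin_mul_geom]

lemma constantCoeff_completeSeries (N : ℕ) :
    PowerSeries.constantCoeff (completeSeries N) = 1 := by
  rw [completeSeries, map_prod]
  exact Finset.prod_eq_one fun i _ => by
    rw [← PowerSeries.coeff_zero_eq_constantCoeff_apply]; simp [geom]

lemma vand_eq_det (N : ℕ) : vand N = Matrix.det (Matrix.of fun i j : Fin N =>
    (MvPolynomial.X (j : ℕ) : MvPolynomial ℕ ℂ) ^ (N - 1 - i : ℕ)) := by
  have h := Matrix.det_projVandermonde (fun _ : Fin N => (1 : MvPolynomial ℕ ℂ))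
    (fun i : Fin N => MvPolynomial.X (i : ℕ))
  simp only [one_mul] at h
  rw [vand, ← Matrix.det_transpose]
  rw [← h]
  congr 1
  ext i j : 2
  rw [Matrix.projVandermonde_apply, one_pow, one_mul, Fin.val_rev]
  simp only [Matrix.transpose_apply, Matrix.of_apply]
  rw [show N - (j + 1 : ℕ) = N - 1 - j by omega]

/-- The Jacobi-Trudi formula for the multiparameter Schur polynomials. -/
lemma multiSchur_eq_det (μ : YoungDiagram) (N : ℕ) (c : ℕ → ℂ) (h : μ.colLen 0 ≤ N) :
    multiSchur μ N c = Matrix.det (Matrix.of fun i k : Fin N =>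
      coeffZ ((μ.rowLen i : ℤ) - i + k)
        ((∏ t ∈ Finset.range (μ.rowLen i + (N - 1 - i)), lin (MvPolynomial.C (c t))) *
          completeSeries N)) := by
  have h1 := det_coeff_mul_geom (fun i : Fin N => (MvPolynomial.X (i : ℕ) : MvPolynomial ℕ ℂ))
    (completeSeries N) (completeSeries_mul N)
    (fun i => ∏ t ∈ Finset.range (μ.rowLen i + (N - 1 - i)), lin (MvPolynomial.C (c t)))
    (fun i => μ.rowLen i + (N - 1 - i))
  have h2 := det_coeff_mul_geom (fun i : Fin N => (MvPolynomial.X (i : ℕ) : MvPolynomial ℕ ℂ))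
    (completeSeries N) (completeSeries_mul N) (fun i => 1) (fun i => N - 1 - i)
  have e1 : ∀ i k : Fin N, (((μ.rowLen i + (N - 1 - i) : ℕ) : ℤ) - ((N - 1 - k : ℕ) : ℤ)) =
      (μ.rowLen i : ℤ) - i + k := by
    intro i k; have := i.2; have := k.2; omega
  have e2 : ∀ i k : Fin N, (((N - 1 - i : ℕ) : ℤ) - ((N - 1 - k : ℕ) : ℤ)) = ((k : ℤ) - i) := by
    intro i k; have := i.2; have := k.2; omega
  -- In the case of trivial P and exponents N-1-i the first factor is unitriangular, so the second
  -- factor equals the Vandermonde determinant and can be cancelled.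
  have h3 : Matrix.det (Matrix.of fun i k : Fin N =>
      coeffZ (((N - 1 - i : ℕ) : ℤ) - ((N - 1 - k : ℕ) : ℤ)) (1 * completeSeries N)) = 1 := by
    simp only [e2, one_mul]
    rw [det_eq_det_of_unitriangular (fun i k => coeffZ ((k : ℤ) - i) (completeSeries N)) 0 N
      (Nat.zero_le _)]
    · simp
    · intro i _
      rw [sub_self, ← Nat.cast_zero, coeffZ_natCast,
        PowerSeries.coeff_zero_eq_constantCoeff_apply, constantCoeff_completeSeries]
    · intro i k _ hk
      exact coeffZ_of_neg (by omega) _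
  rw [h3, one_mul] at h2
  have h4 : vand N = Matrix.det (Matrix.of fun k j : Fin N =>
        PowerSeries.coeff (N - 1 - k : ℕ) (∏ l ∈ Finset.univ.erase j,
          lin (MvPolynomial.X (l : ℕ) : MvPolynomial ℕ ℂ))) := by
    rw [← h2, vand_eq_det]
    congr 1
    ext i j : 2
    simp [geom]
  have h5 : alternant μ N c = Matrix.det (Matrix.of fun i j : Fin N =>
      PowerSeries.coeff (μ.rowLen i + (N - 1 - i))
      ((∏ t ∈ Finset.range (μ.rowLen i + (N - 1 - i)), lin (MvPolynomial.C (c t))) *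
        geom (MvPolynomial.X (j : ℕ) : MvPolynomial ℕ ℂ))) := by
    rw [alternant]
    congr 1
    ext i j : 2
    have := coeff_prod_lin_mul_geom (fun t => MvPolynomial.C (c t) : ℕ → MvPolynomial ℕ ℂ)
      (MvPolynomial.X (j : ℕ)) (μ.rowLen i + (N - 1 - i)) 0
    simp only [add_zero, pow_zero, one_mul] at this
    rw [Matrix.of_apply, Matrix.of_apply, this, newton]
  rw [h1] at h5
  simp only [e1] at h5
  rw [← h4, multiSchur_spec μ N c h, mul_comm] at h5
  exact mul_right_cancel₀ (vand_ne_zero N) h5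

/-! ### Infinite `q`-products and the limits of the node polynomials -/

/-- Along each parity class the map is a contraction of ratio r with asymptotic fixed point Y/(1-r).
-/
lemma tendsto_of_two_step {x y : ℕ → ℂ} {r : ℝ} (hr0 : 0 ≤ r) (hr1 : r < 1) {Y : ℂ}
    (hy : Tendsto y atTop (𝓝 Y)) (hx : ∀ᶠ N in atTop, x (N + 2) = r * x N + y N) :
    Tendsto x atTop (𝓝 (Y / (1 - r))) := by
  have hne : (1 - r : ℂ) ≠ 0 := by
    rw [sub_ne_zero]; intro h; have : (1 : ℝ) = r := by exact_mod_cast h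
    linarith
  obtain ⟨N0, hN0⟩ := eventually_atTop.mp hx
  rw [Metric.tendsto_atTop]
  intro ε hε
  -- The tolerance ε/2·(1-r) makes the error ε/2 reproduce itself: r·ε/2 + (1-r)·ε/2 = ε/2.
  obtain ⟨N1, hN1⟩ := Metric.tendsto_atTop.mp hy (ε / 2 * (1 - r))
    (mul_pos (by linarith) (by linarith))
  set N2 := max N0 N1
  set B := max (dist (x N2) (Y / (1 - r))) (dist (x (N2 + 1)) (Y / (1 - r)))
  have key : ∀ k j, j < 2 → dist (x (N2 + j + 2 * k)) (Y / (1 - r)) ≤ r ^ k * B + ε / 2 := by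
    intro k
    induction k with
    | zero =>
      intro j hj
      have : dist (x (N2 + j)) (Y / (1 - r)) ≤ B := by
        interval_cases j
        · exact le_max_left _ _
        · exact le_max_right _ _
      simp only [mul_zero, add_zero, pow_zero, one_mul]
      linarith
    | succ k ih =>
      intro j hj
      have e : x (N2 + j + 2 * (k + 1)) - Y / (1 - r) =
          r * (x (N2 + j + 2 * k) - Y / (1 - r)) + (y (N2 + j + 2 * k) - Y) := by
        rw [show N2 + j + 2 * (k + 1) = N2 + j + 2 * k + 2 by ring,
          hN0 _ ((le_max_left N0 N1).trans (by omega))]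
        field_simp
        ring
      have h1 := ih j hj
      have h2 := hN1 (N2 + j + 2 * k) ((le_max_right N0 N1).trans (by omega))
      rw [dist_eq_norm] at h1 h2 ⊢
      rw [e]
      refine (norm_add_le _ _).trans ?_
      rw [norm_mul, Complex.norm_real, Real.norm_of_nonneg hr0, pow_succ]
      have := mul_le_mul_of_nonneg_left h1 hr0
      nlinarith
  have hB : Tendsto (fun k : ℕ => r ^ k * B) atTop (𝓝 0) := by
    simpa using (tendsto_pow_atTop_nhds_zero_of_lt_one hr0 hr1).mul_const B
  obtain ⟨k0, hk0⟩ := (hB.eventually (gt_mem_nhds (half_pos hε))).exists_forall_of_atTop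
  refine ⟨N2 + 2 * k0, fun n hn => ?_⟩
  have h := key ((n - N2) / 2) ((n - N2) % 2) (Nat.mod_lt _ (by norm_num))
  rw [show N2 + (n - N2) % 2 + 2 * ((n - N2) / 2) = n by omega] at h
  have := hk0 ((n - N2) / 2) (by omega)
  linarith

/-- The power series `(c w; q)_∞` in `w`. -/
def pochInf (q : ℝ) (c : ℂ) : PowerSeries ℂ :=
  PowerSeries.mk fun n => ∏ k ∈ Finset.range n, -(c * (q : ℂ) ^ k) / (1 - (q : ℂ) ^ (k + 1))

section

variable {q : ℝ}

lemma one_sub_q_pow_ne_zero (hq₀ : 0 < q) (hq₁ : q < 1) (k : ℕ) : (1 - (q : ℂ) ^ (k + 1)) ≠ 0 := by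
  rw [sub_ne_zero]
  intro h
  have h1 : (1 : ℝ) = q ^ (k + 1) := by exact_mod_cast h
  exact (pow_lt_one₀ hq₀.le hq₁ (Nat.succ_ne_zero k)).ne' h1

lemma q_ne_zero (hq₀ : 0 < q) : (q : ℂ) ≠ 0 := by exact_mod_cast hq₀.ne'

lemma constantCoeff_pochInf (c : ℂ) : PowerSeries.constantCoeff (pochInf q c) = 1 := by
  rw [← PowerSeries.coeff_zero_eq_constantCoeff_apply]; simp [pochInf]

lemma rescale_pochInf (c : ℂ) :
    PowerSeries.rescale (q : ℂ) (pochInf q c) = pochInf q (c * q) := by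
  ext n
  simp only [PowerSeries.coeff_rescale, pochInf, PowerSeries.coeff_mk]
  rw [← Finset.card_range n, ← Finset.prod_const, Finset.card_range, ← Finset.prod_mul_distrib]
  refine Finset.prod_congr rfl fun k _ => ?_
  ring

/-- The coefficients of `pochInf` are those of Euler's expansion. This functional equation is all
that is used of the infinite product. -/
lemma pochInf_eq (hq₀ : 0 < q) (hq₁ : q < 1) (c : ℂ) :
    pochInf q c = lin c * pochInf q (c * q) := by
  ext n
  rw [← rescale_pochInf]
  cases n with
  | zero => rw [coeff_zero_lin_mul]; simp
  | succ n =>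
    rw [coeff_succ_lin_mul]
    simp only [PowerSeries.coeff_rescale, pochInf, PowerSeries.coeff_mk, Finset.prod_range_succ]
    have := one_sub_q_pow_ne_zero hq₀ hq₁ n
    field_simp
    ring

lemma rescale_lin (r c : ℂ) : PowerSeries.rescale r (lin c) = lin (c * r) := by
  have : PowerSeries.rescale r (PowerSeries.C c) = PowerSeries.C c := by
    ext n
    rcases n with _ | n <;> simp [PowerSeries.coeff_rescale, PowerSeries.coeff_C]
  simp [lin, PowerSeries.rescale_X, mul_assoc, this]

/-- The limit `(-s w; q)_∞ (s⁻¹ q^{-b} w; q)_∞` of the node polynomials. -/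
def nodeSeries (q : ℝ) (s : ℂ) (b : ℤ) : PowerSeries ℂ :=
  pochInf q (-s) * pochInf q (s⁻¹ * (q : ℂ) ^ (-b))

lemma constantCoeff_nodeSeries (s : ℂ) (b : ℤ) :
    PowerSeries.constantCoeff (nodeSeries q s b) = 1 := by
  simp [nodeSeries, constantCoeff_pochInf]

lemma nodeSeries_add_one (hq₀ : 0 < q) (hq₁ : q < 1) (s : ℂ) (b : ℤ) :
    nodeSeries q s (b + 1) = lin (s⁻¹ * (q : ℂ) ^ (-b - 1)) * nodeSeries q s b := by
  have h0 := q_ne_zero hq₀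
  rw [nodeSeries, pochInf_eq hq₀ hq₁ (s⁻¹ * (q : ℂ) ^ (-(b + 1))), nodeSeries,
    show -(b + 1) = -b - 1 by ring, mul_assoc s⁻¹, ← zpow_add_one₀ h0,
    show -b - 1 + 1 = -b by ring]
  ring

/-- Degree d of the right side contains the unknown coefficient with the factor q^d and otherwise
only lower ones, so this fixed-point equation determines the series. It is the limit of
`nodePoly_step`. -/
lemma nodeSeries_eq (hq₀ : 0 < q) (hq₁ : q < 1) (s : ℂ) (b : ℤ) :
    nodeSeries q s b = lin (-s) * (lin (s⁻¹ * (q : ℂ) ^ (-b)) *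
      PowerSeries.rescale (q : ℂ) (nodeSeries q s b)) := by
  conv_lhs => rw [nodeSeries, pochInf_eq hq₀ hq₁, pochInf_eq hq₀ hq₁ (s⁻¹ * (q : ℂ) ^ (-b))]
  rw [nodeSeries, map_mul, rescale_pochInf, rescale_pochInf]
  ring

/-- The generating polynomial of the first `N + b` nodes. -/
def nodePoly (q : ℝ) (s : ℂ) (b : ℤ) (N : ℕ) : PowerSeries ℂ :=
  ∏ t ∈ Finset.range ((N : ℤ) + b).toNat, lin (bcNode q s N t)

lemma bcNode_step (hq₀ : 0 < q) (s : ℂ) (N t : ℕ) :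
    bcNode q s (N + 2) (t + 1) = bcNode q s N t * q := by
  have h0 := q_ne_zero hq₀
  unfold bcNode
  rw [show ((N + 2 : ℕ) : ℤ) - 1 - (t + 1 : ℕ) = ((N : ℤ) - 1 - t) + 1 by push_cast; ring,
    zpow_add_one₀ h0, pow_succ]
  ring

/-- The nodes for N+2, apart from the first and the last, are q times the nodes for N. This
self-similarity replaces any direct estimate of the products. -/
lemma nodePoly_step (hq₀ : 0 < q) (s : ℂ) (b : ℤ) (N : ℕ) (hN : 0 ≤ (N : ℤ) + b) :
    nodePoly q s b (N + 2) = lin (bcNode q s (N + 2) 0) *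
      (lin (bcNode q s (N + 2) (((N : ℤ) + b).toNat + 1)) *
        PowerSeries.rescale (q : ℂ) (nodePoly q s b N)) := by
  unfold nodePoly
  rw [show (((N + 2 : ℕ) : ℤ) + b).toNat = ((N : ℤ) + b).toNat + 1 + 1 by push_cast; omega,
    Finset.prod_range_succ, Finset.prod_range_succ', map_prod]
  simp only [rescale_lin, bcNode_step hq₀]
  ring

lemma constantCoeff_nodePoly (s : ℂ) (b : ℤ) (N : ℕ) :
    PowerSeries.constantCoeff (nodePoly q s b N) = 1 := by
  rw [nodePoly, map_prod]
  exact Finset.prod_eq_one fun i _ => by simp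

lemma tendsto_q_pow (hq₀ : 0 < q) (hq₁ : q < 1) :
    Tendsto (fun n : ℕ => (q : ℂ) ^ n) atTop (𝓝 0) := by
  refine tendsto_pow_atTop_nhds_zero_of_norm_lt_one ?_
  rw [Complex.norm_real, Real.norm_of_nonneg hq₀.le]
  exact hq₁

lemma tendsto_bcNode_zero (hq₀ : 0 < q) (hq₁ : q < 1) (s : ℂ) :
    Tendsto (fun N : ℕ => bcNode q s (N + 2) 0) atTop (𝓝 (-s)) := by
  have h : ∀ N : ℕ, bcNode q s (N + 2) 0 = s⁻¹ * ((q : ℂ) ^ N * q) - s := by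
    intro N
    unfold bcNode
    rw [show ((N + 2 : ℕ) : ℤ) - 1 - (0 : ℕ) = ((N + 1 : ℕ) : ℤ) by push_cast; ring,
      zpow_natCast, pow_succ]
    simp
  simp only [h]
  have := (((tendsto_q_pow hq₀ hq₁).mul_const (q : ℂ)).const_mul s⁻¹).sub_const s
  simpa using this

lemma tendsto_bcNode_last (hq₀ : 0 < q) (hq₁ : q < 1) (s : ℂ) (b : ℤ) :
    Tendsto (fun N : ℕ => bcNode q s (N + 2) (((N : ℤ) + b).toNat + 1)) atTop
      (𝓝 (s⁻¹ * (q : ℂ) ^ (-b))) := by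
  have h0 := q_ne_zero hq₀
  have h : ∀ᶠ N : ℕ in atTop, bcNode q s (N + 2) (((N : ℤ) + b).toNat + 1) =
      s⁻¹ * (q : ℂ) ^ (-b) - s * ((q : ℂ) ^ N * (q : ℂ) ^ (b + 1)) := by
    filter_upwards [eventually_ge_atTop (-b).toNat] with N hN
    unfold bcNode
    have e : ((((N : ℤ) + b).toNat : ℕ) : ℤ) = N + b := Int.toNat_of_nonneg (by omega)
    rw [show ((N + 2 : ℕ) : ℤ) - 1 - ((((N : ℤ) + b).toNat + 1 : ℕ) : ℤ) = -b by
      push_cast [e]; ring, ← zpow_natCast (q : ℂ) (((N : ℤ) + b).toNat + 1),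
      ← zpow_natCast (q : ℂ) N, ← zpow_add₀ h0]
    congr 3
    push_cast [e]; ring
  refine Tendsto.congr' (EventuallyEq.symm h) ?_
  have := (((tendsto_q_pow hq₀ hq₁).mul_const ((q : ℂ) ^ (b + 1))).const_mul s).const_sub
    (s⁻¹ * (q : ℂ) ^ (-b))
  simpa using this

/-- Induction on the degree. By `nodePoly_step` the coefficient at N+2 is q^d times the coefficient
at N plus terms of degrees d-1 and d-2, which converge; the limit equation is the one in
`nodeSeries_eq`. -/
lemma tendsto_nodePoly (hq₀ : 0 < q) (hq₁ : q < 1) (s : ℂ) (b : ℤ) (d : ℕ) :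
    Tendsto (fun N => PowerSeries.coeff d (nodePoly q s b N)) atTop
      (𝓝 (PowerSeries.coeff d (nodeSeries q s b))) := by
  have hr0 : ∀ d : ℕ, 0 ≤ q ^ (d + 1) := fun d => by positivity
  have hr1 : ∀ d : ℕ, q ^ (d + 1) < 1 := fun d => pow_lt_one₀ hq₀.le hq₁ (Nat.succ_ne_zero d)
  -- For small N the number N + b of nodes would be negative and `toNat` truncates it.
  have hstep : ∀ᶠ N : ℕ in atTop, 0 ≤ (N : ℤ) + b := by
    filter_upwards [eventually_ge_atTop (-b).toNat] with N hN
    omega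
  have hα := tendsto_bcNode_zero hq₀ hq₁ s
  have hβ := tendsto_bcNode_last hq₀ hq₁ s b
  induction d using Nat.strong_induction_on with
  | _ d ih =>
  rcases d with _ | _ | d
  · simp [constantCoeff_nodePoly, constantCoeff_nodeSeries]
  · have h0 := ih 0 (by norm_num)
    have key := tendsto_of_two_step (x := fun N => PowerSeries.coeff 1 (nodePoly q s b N))
      (y := fun N => -(bcNode q s (N + 2) (((N : ℤ) + b).toNat + 1)) *
          PowerSeries.coeff 0 (nodePoly q s b N) -
        bcNode q s (N + 2) 0 * PowerSeries.coeff 0 (nodePoly q s b N)) (hr0 0) (hr1 0)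
      ((hβ.neg.mul h0).sub (hα.mul h0)) (by
        filter_upwards [hstep] with N hN
        rw [nodePoly_step hq₀ s b N hN, show (1 : ℕ) = 0 + 1 by rfl, coeff_succ_lin_mul,
          coeff_succ_lin_mul, coeff_zero_lin_mul]
        simp only [PowerSeries.coeff_rescale]
        push_cast
        ring)
    convert key using 2
    have hne := one_sub_q_pow_ne_zero hq₀ hq₁ 0
    rw [eq_div_iff (by push_cast; exact hne)]
    have := congrArg (PowerSeries.coeff (0 + 1)) (nodeSeries_eq hq₀ hq₁ s b)
    rw [coeff_succ_lin_mul, coeff_succ_lin_mul, coeff_zero_lin_mul] at this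
    simp only [PowerSeries.coeff_rescale] at this
    simp only [zero_add] at this ⊢
    push_cast
    linear_combination this
  · have h0 := ih d (by omega)
    have h1 := ih (d + 1) (by omega)
    have key := tendsto_of_two_step (x := fun N => PowerSeries.coeff (d + 2) (nodePoly q s b N))
      (y := fun N => -(bcNode q s (N + 2) (((N : ℤ) + b).toNat + 1)) *
          ((q : ℂ) ^ (d + 1) * PowerSeries.coeff (d + 1) (nodePoly q s b N)) -
        bcNode q s (N + 2) 0 * ((q : ℂ) ^ (d + 1) * PowerSeries.coeff (d + 1) (nodePoly q s b N) -
          bcNode q s (N + 2) (((N : ℤ) + b).toNat + 1) *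
            ((q : ℂ) ^ d * PowerSeries.coeff d (nodePoly q s b N)))) (hr0 (d + 1)) (hr1 (d + 1))
      ((hβ.neg.mul (h1.const_mul _)).sub (hα.mul ((h1.const_mul _).sub
        (hβ.mul (h0.const_mul _))))) (by
        filter_upwards [hstep] with N hN
        rw [nodePoly_step hq₀ s b N hN, show d + 2 = (d + 1) + 1 by rfl, coeff_succ_lin_mul,
          coeff_succ_lin_mul, coeff_succ_lin_mul]
        simp only [PowerSeries.coeff_rescale]
        push_cast
        ring)
    convert key using 2
    have hne := one_sub_q_pow_ne_zero hq₀ hq₁ (d + 1)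
    rw [eq_div_iff (by push_cast; exact hne)]
    have := congrArg (PowerSeries.coeff (d + 1 + 1)) (nodeSeries_eq hq₀ hq₁ s b)
    rw [coeff_succ_lin_mul, coeff_succ_lin_mul, coeff_succ_lin_mul] at this
    simp only [PowerSeries.coeff_rescale] at this
    push_cast
    linear_combination this

end

/-! ### Complete symmetric functions and the limit N → ∞ -/

/-- The complete homogeneous symmetric function of degree `n`. -/
def hsymm (n : ℕ) : MvPowerSeries ℕ ℂ := fun m => if m.degree = n then 1 else 0

lemma coeff_hsymm (n : ℕ) (m : ℕ →₀ ℕ) :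
    MvPowerSeries.coeff m (hsymm n) = if m.degree = n then 1 else 0 := rfl

/-- The generating series of the complete homogeneous symmetric functions. -/
def hsymmSeries : PowerSeries (MvPowerSeries ℕ ℂ) := PowerSeries.mk hsymm

lemma hsymm_zero : hsymm 0 = 1 := by
  ext m
  rw [coeff_hsymm, MvPowerSeries.coeff_one]
  simp [Finsupp.degree_eq_zero_iff]

lemma coeff_coeff_completeSeries (N n : ℕ) (m : ℕ →₀ ℕ) (hm : m.support ⊆ Finset.range N) :
    MvPolynomial.coeff m (PowerSeries.coeff n (completeSeries N)) =
      if m.degree = n then 1 else 0 := by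
  classical
  have h : ∀ l ∈ Finset.finsuppAntidiag (Finset.range N) n,
      ∏ i ∈ Finset.range N, PowerSeries.coeff (l i) (geom (MvPolynomial.X i)) =
        MvPolynomial.monomial l (1 : ℂ) := by
    intro l hl
    rw [MvPolynomial.monomial_eq, map_one, one_mul, Finsupp.prod_of_support_subset l
      (Finset.mem_finsuppAntidiag.mp hl).2 _ (by simp)]
    simp [geom]
  rw [completeSeries, PowerSeries.coeff_prod, Finset.sum_congr rfl h, MvPolynomial.coeff_sum]
  simp only [MvPolynomial.coeff_monomial, Finset.sum_ite_eq']
  congr 1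
  rw [Finset.mem_finsuppAntidiag, Finsupp.degree_apply, eq_iff_iff]
  constructor
  · rintro ⟨h1, -⟩
    rw [← h1]
    exact Finset.sum_subset hm (fun i _ hi => by simpa using hi)
  · intro h1
    refine ⟨?_, hm⟩
    rw [← h1]
    exact (Finset.sum_subset hm (fun i _ hi => by simpa using hi)).symm

open scoped MvPowerSeries.WithPiTopology in
lemma tendsto_completeSeries (n : ℕ) :
    Tendsto (fun N => ((PowerSeries.coeff n (completeSeries N) : MvPolynomial ℕ ℂ) :
      MvPowerSeries ℕ ℂ)) atTop (𝓝 (hsymm n)) := by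
  rw [MvPowerSeries.WithPiTopology.tendsto_iff_coeff_tendsto]
  intro m
  refine tendsto_const_nhds.congr' ?_
  obtain ⟨N0, hN0⟩ := m.support.exists_nat_subset_range
  filter_upwards [eventually_ge_atTop N0] with N hN
  rw [MvPolynomial.coeff_coe, coeff_coeff_completeSeries N n m, coeff_hsymm]
  exact hN0.trans (by simpa using hN)

/-- The power series with coefficients in `ℂ`, considered over the ring of formal power series. -/
def constSeries (f : PowerSeries ℂ) : PowerSeries (MvPowerSeries ℕ ℂ) :=
  PowerSeries.map MvPowerSeries.C f

lemma prod_lin_C (c : ℕ → ℂ) (s : Finset ℕ) :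
    ∏ t ∈ s, lin (MvPolynomial.C (c t) : MvPolynomial ℕ ℂ) =
      PowerSeries.map MvPolynomial.C (∏ t ∈ s, lin (c t)) := by
  rw [map_prod]
  simp [lin]

open scoped MvPowerSeries.WithPiTopology in
lemma tendsto_entry {q : ℝ} (hq₀ : 0 < q) (hq₁ : q < 1) (s : ℂ) (b n : ℤ) :
    Tendsto (fun N => ((coeffZ n (PowerSeries.map MvPolynomial.C (nodePoly q s b N) *
      completeSeries N) : MvPolynomial ℕ ℂ) : MvPowerSeries ℕ ℂ)) atTop
      (𝓝 (coeffZ n (constSeries (nodeSeries q s b) * hsymmSeries))) := by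
  rcases lt_or_ge n 0 with h | h
  · simp only [coeffZ_of_neg h, MvPolynomial.coe_zero]
    exact tendsto_const_nhds
  · simp only [coeffZ_of_nonneg h, PowerSeries.coeff_mul, ← MvPolynomial.coeToMvPowerSeries.ringHom_apply,
      map_sum, map_mul]
    refine tendsto_finsetSum _ fun p _ => ?_
    refine Tendsto.mul ?_ ?_
    · simp only [MvPolynomial.coeToMvPowerSeries.ringHom_apply, PowerSeries.coeff_map,
        MvPolynomial.coe_C, constSeries]
      exact ((MvPowerSeries.WithPiTopology.continuous_C (σ := ℕ) (R := ℂ)).tendsto _).comp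
        (tendsto_nodePoly hq₀ hq₁ s b p.1)
    · simp only [MvPolynomial.coeToMvPowerSeries.ringHom_apply, hsymmSeries, PowerSeries.coeff_mk]
      exact tendsto_completeSeries p.2

lemma rowLen_eq_zero_of_colLen_le (μ : YoungDiagram) {i : ℕ} (h : μ.colLen 0 ≤ i) :
    μ.rowLen i = 0 := by
  by_contra hne
  have : (i, 0) ∈ μ := YoungDiagram.mem_iff_lt_rowLen.mpr (Nat.pos_of_ne_zero hne)
  rw [YoungDiagram.mem_iff_lt_colLen] at this
  omega

lemma coeffZ_zero (A : Type*) [CommRing A] (f : PowerSeries A) :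
    coeffZ 0 f = PowerSeries.constantCoeff f := by
  simp [coeffZ]

/-- Rows below the length of μ are unitriangular because the series have constant term 1. The limit
N → ∞ can thus be taken in a determinant of fixed size, and one size can serve several diagrams. -/
lemma det_coeffZ_stable {A : Type*} [CommRing A] (μ : YoungDiagram) (P : ℕ → PowerSeries A)
    {n N : ℕ} (hμ : μ.colLen 0 ≤ n) (hn : n ≤ N)
    (hP : ∀ i, PowerSeries.constantCoeff (P i) = 1) :
    Matrix.det (Matrix.of fun i k : Fin N => coeffZ ((μ.rowLen i : ℤ) - i + k) (P i)) =
      Matrix.det (Matrix.of fun i k : Fin n => coeffZ ((μ.rowLen i : ℤ) - i + k) (P i)) := by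
  refine det_eq_det_of_unitriangular (fun i k => coeffZ ((μ.rowLen i : ℤ) - i + k) (P i)) n N hn
    ?_ ?_
  · intro i hi
    rw [rowLen_eq_zero_of_colLen_le μ (hμ.trans hi),
      show ((0 : ℕ) : ℤ) - i + i = 0 by push_cast; ring, coeffZ_zero, hP]
  · intro i k hi hk
    rw [rowLen_eq_zero_of_colLen_le μ (hμ.trans hi)]
    exact coeffZ_of_neg (by omega) _

open scoped MvPowerSeries.WithPiTopology in
/-- The Jacobi-Trudi formula for the interpolation symmetric functions. -/
lemma interpBC_eq_det {q : ℝ} (hq₀ : 0 < q) (hq₁ : q < 1) (s : ℂ) (μ : YoungDiagram) (n : ℕ)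
    (hn : μ.colLen 0 ≤ n) :
    (interpBC q s μ : MvPowerSeries ℕ ℂ) = Matrix.det (Matrix.of fun i k : Fin n =>
      coeffZ ((μ.rowLen i : ℤ) - i + k)
        (constSeries (nodeSeries q s ((μ.rowLen i : ℤ) - i - 1)) * hsymmSeries)) := by
  have hfin : ∀ᶠ N in atTop, ((multiSchur μ N (bcNode q s N) : MvPolynomial ℕ ℂ) :
      MvPowerSeries ℕ ℂ) = Matrix.det (Matrix.of fun i k : Fin n =>
        ((coeffZ ((μ.rowLen i : ℤ) - i + k) (PowerSeries.map MvPolynomial.C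
          (nodePoly q s ((μ.rowLen i : ℤ) - i - 1) N) * completeSeries N) : MvPolynomial ℕ ℂ) :
            MvPowerSeries ℕ ℂ)) := by
    filter_upwards [eventually_ge_atTop n] with N hN
    rw [multiSchur_eq_det μ N _ (hn.trans hN)]
    -- Row i uses μ_i + N - 1 - i = N + b nodes with b = μ_i - i - 1, the parameter of `nodePoly`.
    have e : ∀ i : Fin N, ∏ t ∈ Finset.range (μ.rowLen i + (N - 1 - i)),
        lin (MvPolynomial.C (bcNode q s N t) : MvPolynomial ℕ ℂ) =
        PowerSeries.map MvPolynomial.C (nodePoly q s ((μ.rowLen i : ℤ) - i - 1) N) := by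
      intro i
      rw [prod_lin_C, nodePoly]
      congr 4
      have := i.2
      omega
    simp only [e]
    rw [det_coeffZ_stable μ (fun i => PowerSeries.map MvPolynomial.C
      (nodePoly q s ((μ.rowLen i : ℤ) - i - 1) N) * completeSeries N) hn hN,
      ← MvPolynomial.coeToMvPowerSeries.ringHom_apply, RingHom.map_det]
    · rfl
    · intro i
      rw [map_mul, constantCoeff_completeSeries, mul_one,
        ← PowerSeries.coeff_zero_eq_constantCoeff_apply, PowerSeries.coeff_map,
        PowerSeries.coeff_zero_eq_constantCoeff_apply, constantCoeff_nodePoly, map_one]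
  have hlim : Tendsto (fun N => ((multiSchur μ N (bcNode q s N) : MvPolynomial ℕ ℂ) :
      MvPowerSeries ℕ ℂ)) atTop (𝓝 (Matrix.det (Matrix.of fun i k : Fin n =>
      coeffZ ((μ.rowLen i : ℤ) - i + k)
        (constSeries (nodeSeries q s ((μ.rowLen i : ℤ) - i - 1)) * hsymmSeries)))) := by
    refine Tendsto.congr' (EventuallyEq.symm hfin) ?_
    simp only [Matrix.det_apply]
    refine tendsto_finsetSum _ fun σ _ => Tendsto.const_smul ?_ _
    exact tendsto_finsetProd _ fun i _ => tendsto_entry hq₀ hq₁ s _ _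
  ext m
  have := (MvPowerSeries.WithPiTopology.tendsto_iff_coeff_tendsto _ _ _).mp hlim m
  simp only [MvPolynomial.coeff_coe] at this
  exact this.limUnder_eq

/-! ### Evaluation of symmetric functions -/

/-- The value of a monomial at a sequence. -/
def monVal (x : ℕ → ℝ) (m : ℕ →₀ ℕ) : ℂ := m.prod fun i k => (x i : ℂ) ^ k

lemma monVal_zero (x : ℕ → ℝ) : monVal x 0 = 1 := by simp [monVal]

lemma monVal_add (x : ℕ → ℝ) (m n : ℕ →₀ ℕ) : monVal x (m + n) = monVal x m * monVal x n :=
  Finsupp.prod_add_index' (fun _ => pow_zero _) (fun _ _ _ => pow_add _ _ _)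

lemma monVal_single (x : ℕ → ℝ) (i k : ℕ) : monVal x (Finsupp.single i k) = (x i : ℂ) ^ k :=
  Finsupp.prod_single_index (pow_zero _)

lemma sum_antidiagonal_coeff_monVal (x : ℕ → ℝ) (F G : MvPowerSeries ℕ ℂ) (m : ℕ →₀ ℕ) :
    MvPowerSeries.coeff m (F * G) * monVal x m = ∑ p ∈ Finset.HasAntidiagonal.antidiagonal m,
      (MvPowerSeries.coeff p.1 F * monVal x p.1) * (MvPowerSeries.coeff p.2 G * monVal x p.2) := by
  classical
  rw [MvPowerSeries.coeff_mul, Finset.sum_mul]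
  refine Finset.sum_congr rfl fun p hp => ?_
  rw [← Finset.HasAntidiagonal.mem_antidiagonal.mp hp, monVal_add]
  ring

lemma summable_coeff_mul {x : ℕ → ℝ} {F G : MvPowerSeries ℕ ℂ}
    (hF : Summable fun m => MvPowerSeries.coeff m F * monVal x m)
    (hG : Summable fun m => MvPowerSeries.coeff m G * monVal x m) :
    Summable fun m => MvPowerSeries.coeff m (F * G) * monVal x m := by
  have h := summable_mul_of_summable_norm (f := fun m => MvPowerSeries.coeff m F * monVal x m)
    (g := fun m => MvPowerSeries.coeff m G * monVal x m) hF.norm hG.norm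
  have h2 := summable_sum_mul_antidiagonal_of_summable_mul
    (f := fun m => MvPowerSeries.coeff m F * monVal x m)
    (g := fun m => MvPowerSeries.coeff m G * monVal x m) h
  exact h2.congr fun m => (sum_antidiagonal_coeff_monVal x F G m).symm

lemma tsum_coeff_mul {x : ℕ → ℝ} {F G : MvPowerSeries ℕ ℂ}
    (hF : Summable fun m => MvPowerSeries.coeff m F * monVal x m)
    (hG : Summable fun m => MvPowerSeries.coeff m G * monVal x m) :
    ∑' m, MvPowerSeries.coeff m (F * G) * monVal x m =
      (∑' m, MvPowerSeries.coeff m F * monVal x m) *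
        ∑' m, MvPowerSeries.coeff m G * monVal x m := by
  have h := summable_mul_of_summable_norm (f := fun m => MvPowerSeries.coeff m F * monVal x m)
    (g := fun m => MvPowerSeries.coeff m G * monVal x m) hF.norm hG.norm
  rw [Summable.tsum_mul_tsum_eq_tsum_sum_antidiagonal hF hG h]
  exact tsum_congr fun m => sum_antidiagonal_coeff_monVal x F G m

/-- The algebra of the power series that converge absolutely at a given sequence. -/
def evalDom (x : ℕ → ℝ) : Subalgebra ℂ (MvPowerSeries ℕ ℂ) where
  carrier := {F | Summable fun m => MvPowerSeries.coeff m F * monVal x m}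
  mul_mem' := fun hF hG => summable_coeff_mul hF hG
  add_mem' := by
    intro F G hF hG
    have h := Summable.add hF hG
    simpa only [Set.mem_ofPred_eq, map_add, add_mul] using h
  algebraMap_mem' := by
    intro r
    refine summable_of_ne_finset_zero (s := {0}) fun m hm => ?_
    classical
    rw [MvPowerSeries.algebraMap_apply, Algebra.algebraMap_self, RingHom.id_apply,
      MvPowerSeries.coeff_C, if_neg (by simpa using hm), zero_mul]

lemma mem_evalDom {x : ℕ → ℝ} {F : MvPowerSeries ℕ ℂ} :
    F ∈ evalDom x ↔ Summable fun m => MvPowerSeries.coeff m F * monVal x m := Iff.rfl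

/-- Evaluation of a power series at a sequence. -/
def evalMv (x : ℕ → ℝ) (F : MvPowerSeries ℕ ℂ) : ℂ :=
  ∑' m, MvPowerSeries.coeff m F * monVal x m

lemma evalMv_algebraMap (x : ℕ → ℝ) (r : ℂ) :
    evalMv x (algebraMap ℂ (MvPowerSeries ℕ ℂ) r) = r := by
  classical
  rw [evalMv, tsum_eq_single 0]
  · simp [MvPowerSeries.algebraMap_apply, monVal_zero]
  · intro m hm
    rw [MvPowerSeries.algebraMap_apply, Algebra.algebraMap_self, RingHom.id_apply,
      MvPowerSeries.coeff_C, if_neg hm, zero_mul]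

/-- Evaluation as a homomorphism of algebras. -/
def evalHom (x : ℕ → ℝ) : evalDom x →ₐ[ℂ] ℂ where
  toFun F := evalMv x F
  map_one' := by
    have := evalMv_algebraMap x 1
    rwa [map_one] at this
  map_mul' F G := tsum_coeff_mul F.2 G.2
  map_zero' := by simp [evalMv]
  map_add' F G := by
    simp only [evalMv, AddMemClass.coe_add, map_add, add_mul]
    exact Summable.tsum_add F.2 G.2
  commutes' r := evalMv_algebraMap x r

lemma evalHom_apply (x : ℕ → ℝ) (F : evalDom x) : evalHom x F = evalMv x F := rfl

lemma degree_eq_one_iff_exists {m : ℕ →₀ ℕ} :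
    m.degree = 1 ↔ ∃ i, Finsupp.single i 1 = m := by
  constructor
  · intro h
    have hne : m ≠ 0 := by rintro rfl; simp at h
    obtain ⟨i, hi⟩ := Finsupp.support_nonempty_iff.mpr hne
    refine ⟨i, ?_⟩
    have hle : Finsupp.single i 1 ≤ m := by
      rw [Finsupp.single_le_iff]
      exact Nat.one_le_iff_ne_zero.mpr (Finsupp.mem_support_iff.mp hi)
    obtain ⟨r, rfl⟩ := exists_add_of_le hle
    rw [map_add, Finsupp.degree_single] at h
    have : r = 0 := (Finsupp.degree_eq_zero_iff r).mp (by omega)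
    rw [this, add_zero]
  · rintro ⟨i, rfl⟩; simp

lemma hsymm_one_mem_evalDom {x : ℕ → ℝ} (hx : Summable x) : hsymm 1 ∈ evalDom x := by
  rw [mem_evalDom]
  have hinj : Function.Injective fun i : ℕ => Finsupp.single i 1 :=
    Finsupp.single_left_injective one_ne_zero
  rw [← hinj.summable_iff]
  · have : ((fun m => MvPowerSeries.coeff m (hsymm 1) * monVal x m) ∘
        fun i : ℕ => Finsupp.single i 1) = fun i => ((x i : ℝ) : ℂ) := by
      ext i
      simp [coeff_hsymm, monVal_single]
    rw [this]
    exact Complex.summable_ofReal.mpr hx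
  · intro m hm
    rw [coeff_hsymm, if_neg, zero_mul]
    intro h
    exact hm (degree_eq_one_iff_exists.mp h)

/-- The coefficient counts factorizations and is a positive integer, since some variable occurs in
m. Hence h_{n+1} is dominated by h_1 h_n, and absolute convergence propagates from h_1 by induction.
-/
lemma one_le_norm_coeff_hsymm_mul {n : ℕ} {m : ℕ →₀ ℕ} (h : m.degree = n + 1) :
    1 ≤ ‖MvPowerSeries.coeff m (hsymm 1 * hsymm n)‖ := by
  classical
  have hne : m ≠ 0 := by rintro rfl; simp at h
  obtain ⟨i, hi⟩ := Finsupp.support_nonempty_iff.mpr hne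
  have hle : Finsupp.single i 1 ≤ m := by
    rw [Finsupp.single_le_iff]
    exact Nat.one_le_iff_ne_zero.mpr (Finsupp.mem_support_iff.mp hi)
  obtain ⟨r, rfl⟩ := exists_add_of_le hle
  rw [map_add, Finsupp.degree_single] at h
  have e : MvPowerSeries.coeff (Finsupp.single i 1 + r) (hsymm 1 * hsymm n) =
      (((Finset.HasAntidiagonal.antidiagonal (Finsupp.single i 1 + r)).filter
        fun p => p.1.degree = 1 ∧ p.2.degree = n).card : ℂ) := by
    rw [MvPowerSeries.coeff_mul, Finset.card_filter, Nat.cast_sum]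
    refine Finset.sum_congr rfl fun p _ => ?_
    simp only [coeff_hsymm]
    split_ifs <;> simp_all
  rw [e, Complex.norm_natCast]
  have : 0 < ((Finset.HasAntidiagonal.antidiagonal (Finsupp.single i 1 + r)).filter
        fun p => p.1.degree = 1 ∧ p.2.degree = n).card := by
    refine Finset.card_pos.mpr ⟨(Finsupp.single i 1, r), ?_⟩
    simp
    omega
  exact_mod_cast this

lemma hsymm_mem_evalDom {x : ℕ → ℝ} (hx : Summable x) (n : ℕ) : hsymm n ∈ evalDom x := by
  induction n with
  | zero => rw [hsymm_zero]; exact one_mem _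
  | succ n ih =>
    have h := mul_mem (hsymm_one_mem_evalDom hx) ih
    rw [mem_evalDom, ← summable_norm_iff] at h ⊢
    refine Summable.of_nonneg_of_le (fun _ => norm_nonneg _) (fun m => ?_) h
    rw [norm_mul, norm_mul]
    refine mul_le_mul_of_nonneg_right ?_ (norm_nonneg _)
    rw [coeff_hsymm]
    split_ifs with hm
    · simpa using one_le_norm_coeff_hsymm_mul hm
    · simp

/-- The values of the complete homogeneous symmetric functions. -/
def hVal (x : ℕ → ℝ) (n : ℕ) : ℂ := evalMv x (hsymm n)

lemma hVal_zero (x : ℕ → ℝ) : hVal x 0 = 1 := by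
  rw [hVal, hsymm_zero]; exact (evalHom x).map_one

/-- The generating series of the values of the complete homogeneous symmetric functions. -/
def hSeries (x : ℕ → ℝ) : PowerSeries ℂ := PowerSeries.mk (hVal x)

lemma constantCoeff_hSeries (x : ℕ → ℝ) : PowerSeries.constantCoeff (hSeries x) = 1 := by
  rw [← PowerSeries.coeff_zero_eq_constantCoeff_apply, hSeries, PowerSeries.coeff_mk, hVal_zero]

/-- Monomials of degree n+1 divisible by x_i are x_i times monomials of degree n. What remains is
h_{n+1} without x_i, so multiplying the generating series by 1 - x_i w erases the i-th entry of a
sequence. -/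
lemma hsymm_succ (i n : ℕ) (m : ℕ →₀ ℕ) :
    MvPowerSeries.coeff m (hsymm (n + 1) - MvPowerSeries.X i * hsymm n) =
      if m i = 0 then MvPowerSeries.coeff m (hsymm (n + 1)) else 0 := by
  classical
  rw [map_sub, MvPowerSeries.X_def, MvPowerSeries.coeff_monomial_mul, one_mul]
  by_cases hi : m i = 0
  · rw [if_pos hi, if_neg, sub_zero]
    rw [Finsupp.single_le_iff]
    omega
  · have hle : Finsupp.single i 1 ≤ m := by
      rw [Finsupp.single_le_iff]; omega
    rw [if_neg hi, if_pos hle, coeff_hsymm, coeff_hsymm]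
    obtain ⟨r, rfl⟩ := exists_add_of_le hle
    rw [add_tsub_cancel_left, map_add, Finsupp.degree_single]
    simp [add_comm 1]

lemma monVal_update (x : ℕ → ℝ) (i : ℕ) (m : ℕ →₀ ℕ) :
    monVal (Function.update x i 0) m = if m i = 0 then monVal x m else 0 := by
  unfold monVal
  split_ifs with h
  · refine Finset.prod_congr rfl fun j hj => ?_
    have hji : j ≠ i := by
      rintro rfl
      exact (Finsupp.mem_support_iff.mp hj) h
    simp [Function.update_of_ne hji]
  · refine Finset.prod_eq_zero (Finsupp.mem_support_iff.mpr h) ?_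
    simp [h]

lemma X_mem_evalDom (x : ℕ → ℝ) (i : ℕ) : (MvPowerSeries.X i : MvPowerSeries ℕ ℂ) ∈ evalDom x := by
  classical
  refine summable_of_ne_finset_zero (s := {Finsupp.single i 1}) fun m hm => ?_
  rw [MvPowerSeries.coeff_X, if_neg (by simpa using hm), zero_mul]

lemma evalMv_X (x : ℕ → ℝ) (i : ℕ) : evalMv x (MvPowerSeries.X i) = x i := by
  classical
  rw [evalMv, tsum_eq_single (Finsupp.single i 1)]
  · simp [monVal_single, MvPowerSeries.coeff_X]
  · intro m hm
    rw [MvPowerSeries.coeff_X, if_neg hm, zero_mul]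

lemma hVal_update {x : ℕ → ℝ} (hx : Summable x) (i n : ℕ) :
    hVal (Function.update x i 0) (n + 1) = hVal x (n + 1) - x i * hVal x n := by
  have h : hVal (Function.update x i 0) (n + 1) =
      evalMv x (hsymm (n + 1) - MvPowerSeries.X i * hsymm n) := by
    refine tsum_congr fun m => ?_
    rw [hsymm_succ, monVal_update]
    split_ifs <;> simp
  rw [h]
  have := map_sub (evalHom x) ⟨_, hsymm_mem_evalDom hx (n + 1)⟩
    (⟨_, X_mem_evalDom x i⟩ * ⟨_, hsymm_mem_evalDom hx n⟩)
  rw [map_mul] at this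
  simp only [evalHom_apply] at this
  rw [evalMv_X] at this
  exact this

lemma lin_mul_hSeries {x : ℕ → ℝ} (hx : Summable x) (i : ℕ) :
    lin (x i : ℂ) * hSeries x = hSeries (Function.update x i 0) := by
  ext n
  cases n with
  | zero => rw [coeff_zero_lin_mul]; simp [hSeries, hVal_zero]
  | succ n =>
    rw [coeff_succ_lin_mul]
    simp only [hSeries, PowerSeries.coeff_mk]
    rw [hVal_update hx]

lemma norm_monVal_le {x g : ℕ → ℝ} (h : ∀ i, |x i| ≤ g i) (m : ℕ →₀ ℕ) :
    ‖monVal x m‖ ≤ ‖monVal g m‖ := by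
  unfold monVal Finsupp.prod
  rw [norm_prod, norm_prod]
  refine Finset.prod_le_prod (fun _ _ => norm_nonneg _) fun i _ => ?_
  rw [norm_pow, norm_pow, Complex.norm_real, Complex.norm_real]
  refine pow_le_pow_left₀ (norm_nonneg _) ?_ _
  exact (h i).trans (le_abs_self _)

/-- Dominated convergence over monomials, dominated by the monomials in g. -/
lemma tendsto_hVal {T : Type*} {l : Filter T} {ξ : T → ℕ → ℝ} {x g : ℕ → ℝ} (hg : Summable g)
    (hξg : ∀ t i, |ξ t i| ≤ g i) (hξ : ∀ i, Tendsto (fun t => ξ t i) l (𝓝 (x i))) (n : ℕ) :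
    Tendsto (fun t => hVal (ξ t) n) l (𝓝 (hVal x n)) := by
  have hs := summable_norm_iff.mpr (mem_evalDom.mp (hsymm_mem_evalDom hg n))
  refine tendsto_tsum_of_dominated_convergence hs (fun m => ?_) (Eventually.of_forall fun t m => ?_)
  · refine Tendsto.const_mul _ ?_
    exact tendsto_finsetProd _ fun i _ =>
      (((Complex.continuous_ofReal.tendsto _).comp (hξ i)).pow _)
  · rw [norm_mul, norm_mul]
    exact mul_le_mul_of_nonneg_left (norm_monVal_le (hξg t) m) (norm_nonneg _)

lemma continuous_hVal {T : Type*} [TopologicalSpace T] {ξ : T → ℕ → ℝ} {g : ℕ → ℝ}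
    (hg : Summable g) (hξg : ∀ t i, |ξ t i| ≤ g i) (hξ : ∀ i, Continuous fun t => ξ t i) (n : ℕ) :
    Continuous fun t => hVal (ξ t) n :=
  continuous_iff_continuousAt.mpr fun t =>
    tendsto_hVal hg hξg (fun i => (hξ i).tendsto t) n

/-- The values of the complete homogeneous symmetric functions at real sequences are real. -/
lemma conj_hVal (x : ℕ → ℝ) (n : ℕ) : starRingEnd ℂ (hVal x n) = hVal x n := by
  rw [hVal, evalMv, Complex.conj_tsum]
  refine tsum_congr fun m => ?_
  rw [map_mul, coeff_hsymm, monVal, Finsupp.prod, map_prod]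
  congr 1
  · split_ifs <;> simp
  · simp

/-! ### Truncation -/

/-- The truncation of a sequence. -/
def truncSeq (x : ℕ → ℝ) (N : ℕ) (i : ℕ) : ℝ := if i < N then x i else 0

lemma summable_truncSeq (x : ℕ → ℝ) (N : ℕ) : Summable (truncSeq x N) :=
  summable_of_ne_finset_zero (s := Finset.range N) fun i hi => by
    simp only [Finset.mem_range] at hi
    simp [truncSeq, hi]

lemma hSeries_zero : hSeries (fun _ => 0) = 1 := by
  ext n
  cases n with
  | zero => simp [hSeries, hVal_zero]
  | succ n =>
    simp only [hSeries, PowerSeries.coeff_mk, PowerSeries.coeff_one, Nat.succ_ne_zero, if_false]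
    rw [hVal, evalMv]
    convert tsum_zero with m
    rw [coeff_hsymm]
    split_ifs with h
    · have hne : m ≠ 0 := by rintro rfl; simp at h
      obtain ⟨i, hi⟩ := Finsupp.support_nonempty_iff.mpr hne
      rw [one_mul]
      refine Finset.prod_eq_zero hi ?_
      simp [Finsupp.mem_support_iff.mp hi]
    · simp

lemma lin_mul_hSeries_truncSeq (x : ℕ → ℝ) (N : ℕ) :
    lin (x N : ℂ) * hSeries (truncSeq x (N + 1)) = hSeries (truncSeq x N) := by
  have := lin_mul_hSeries (summable_truncSeq x (N + 1)) N
  rw [show truncSeq x (N + 1) N = x N by simp [truncSeq]] at this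
  rw [this]
  congr 1
  ext i
  by_cases h : i = N
  · subst h; simp [truncSeq]
  · rw [Function.update_of_ne h]
    simp only [truncSeq]
    congr 1
    exact propext ⟨fun h' => by omega, fun h' => by omega⟩

lemma hSeries_truncSeq_mul (x : ℕ → ℝ) (N : ℕ) :
    hSeries (truncSeq x N) * ∏ i ∈ Finset.range N, lin (x i : ℂ) = 1 := by
  induction N with
  | zero =>
    rw [Finset.prod_range_zero, mul_one, ← hSeries_zero]
    congr 1
  | succ N ih =>
    have h := lin_mul_hSeries_truncSeq x N
    rw [Finset.prod_range_succ, ← ih, ← h]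
    ring

lemma tendsto_hVal_truncSeq {x : ℕ → ℝ} (hx : Summable fun i => |x i|) (n : ℕ) :
    Tendsto (fun N => hVal (truncSeq x N) n) atTop (𝓝 (hVal x n)) := by
  refine tendsto_hVal hx (fun N i => ?_) (fun i => ?_) n
  · unfold truncSeq; split_ifs <;> simp
  · refine tendsto_const_nhds.congr' ?_
    filter_upwards [eventually_gt_atTop i] with N hN
    simp [truncSeq, hN]

/-! ### Power sums -/

/-- The generating series of the power sums. -/
def pSeries (x : ℕ → ℝ) : PowerSeries ℂ :=
  PowerSeries.mk fun k => if k = 0 then 0 else ∑' i, (x i : ℂ) ^ k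

lemma pSeries_truncSeq_succ (x : ℕ → ℝ) (N : ℕ) :
    pSeries (truncSeq x (N + 1)) = pSeries (truncSeq x N) +
      PowerSeries.C (x N : ℂ) * PowerSeries.X * geom (x N : ℂ) := by
  have h : ∀ M k, k ≠ 0 → ∑' i, (truncSeq x M i : ℂ) ^ k = ∑ i ∈ Finset.range M, (x i : ℂ) ^ k := by
    intro M k hk
    rw [tsum_eq_sum (s := Finset.range M)]
    · refine Finset.sum_congr rfl fun i hi => ?_
      simp [truncSeq, Finset.mem_range.mp hi]
    · intro i hi
      simp only [Finset.mem_range] at hi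
      simp [truncSeq, hi, hk]
  ext k
  cases k with
  | zero => simp [pSeries]
  | succ k =>
    rw [map_add, mul_assoc, PowerSeries.coeff_C_mul, PowerSeries.coeff_succ_X_mul]
    simp only [pSeries, PowerSeries.coeff_mk, Nat.succ_ne_zero, if_false, geom]
    rw [h _ _ (Nat.succ_ne_zero k), h _ _ (Nat.succ_ne_zero k), Finset.sum_range_succ,
      pow_succ' (x N : ℂ) k]

lemma isUnit_lin (c : ℂ) : IsUnit (lin c) := by
  refine isUnit_iff_exists_inv.mpr ⟨geom c, lin_mul_geom c⟩

/-- Logarithmic derivative of a finite product of geometric series, one factor at a time. The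
infinite case follows by letting N grow in each coefficient. -/
lemma newton_truncSeq (x : ℕ → ℝ) (N : ℕ) :
    PowerSeries.X * PowerSeries.derivative ℂ (hSeries (truncSeq x N)) =
      pSeries (truncSeq x N) * hSeries (truncSeq x N) := by
  induction N with
  | zero =>
    have h1 : hSeries (truncSeq x 0) = 1 := by
      rw [← hSeries_zero]; congr 1
    have h2 : pSeries (truncSeq x 0) = 0 := by
      ext k
      by_cases hk : k = 0
      · simp [pSeries, hk]
      · simp [pSeries, truncSeq]
    rw [h1, h2]
    simp
  | succ N ih =>
    have hl := lin_mul_hSeries_truncSeq x N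
    have hd := congrArg (PowerSeries.derivative ℂ) hl
    rw [Derivation.leibniz] at hd
    have hlin : PowerSeries.derivative ℂ (lin (x N : ℂ)) = -PowerSeries.C (x N : ℂ) := by
      rw [lin, map_sub, Derivation.leibniz]
      simp
    rw [hlin] at hd
    simp only [smul_eq_mul] at hd
    refine (isUnit_lin (x N : ℂ)).mul_left_cancel ?_
    rw [pSeries_truncSeq_succ]
    have hg := lin_mul_geom (x N : ℂ)
    rw [← hd, ← hl] at ih
    have hlin' : lin (x N : ℂ) = 1 - PowerSeries.C (x N : ℂ) * PowerSeries.X := rfl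
    linear_combination ih - PowerSeries.C (x N : ℂ) * PowerSeries.X *
      hSeries (truncSeq x (N + 1)) * hg

lemma summable_pow_of_summable_abs {x : ℕ → ℝ} (hx : Summable fun i => |x i|) (k : ℕ) :
    Summable fun i => |x i| ^ (k + 1) := by
  have hB : ∃ B, ∀ i, |x i| ≤ B := by
    obtain ⟨B, hB⟩ := hx.tendsto_atTop_zero.bddAbove_range
    exact ⟨B, fun i => hB ⟨i, rfl⟩⟩
  obtain ⟨B, hB⟩ := hB
  refine Summable.of_nonneg_of_le (fun i => by positivity) (fun i => ?_) (hx.mul_left (B ^ k))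
  rw [pow_succ]
  exact mul_le_mul_of_nonneg_right (pow_le_pow_left₀ (abs_nonneg _) (hB i) k) (abs_nonneg _)

lemma tendsto_pSeries_truncSeq {x : ℕ → ℝ} (hx : Summable fun i => |x i|) (k : ℕ) :
    Tendsto (fun N => PowerSeries.coeff k (pSeries (truncSeq x N))) atTop
      (𝓝 (PowerSeries.coeff k (pSeries x))) := by
  rcases k with _ | k
  · simp [pSeries]
  simp only [pSeries, PowerSeries.coeff_mk, Nat.succ_ne_zero, if_false]
  refine tendsto_tsum_of_dominated_convergence (summable_pow_of_summable_abs hx k)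
    (fun i => ?_) (Eventually.of_forall fun N i => ?_)
  · refine tendsto_const_nhds.congr' ?_
    filter_upwards [eventually_gt_atTop i] with N hN
    simp [truncSeq, hN]
  · rw [norm_pow, Complex.norm_real]
    refine pow_le_pow_left₀ (norm_nonneg _) ?_ _
    unfold truncSeq; split_ifs <;> simp

/-- Newton's identities. -/
lemma newton_identity {x : ℕ → ℝ} (hx : Summable fun i => |x i|) :
    PowerSeries.X * PowerSeries.derivative ℂ (hSeries x) = pSeries x * hSeries x := by
  ext n
  have h : ∀ N, PowerSeries.coeff n (PowerSeries.X * PowerSeries.derivative ℂ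
      (hSeries (truncSeq x N))) = PowerSeries.coeff n (pSeries (truncSeq x N) *
        hSeries (truncSeq x N)) := fun N => by rw [newton_truncSeq]
  have h1 : Tendsto (fun N => PowerSeries.coeff n (pSeries (truncSeq x N) *
      hSeries (truncSeq x N))) atTop (𝓝 (PowerSeries.coeff n (pSeries x * hSeries x))) := by
    simp only [PowerSeries.coeff_mul]
    refine tendsto_finsetSum _ fun p _ => (tendsto_pSeries_truncSeq hx p.1).mul ?_
    simpa only [hSeries, PowerSeries.coeff_mk] using tendsto_hVal_truncSeq hx p.2
  have h2 : Tendsto (fun N => PowerSeries.coeff n (PowerSeries.X * PowerSeries.derivative ℂ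
      (hSeries (truncSeq x N)))) atTop (𝓝 (PowerSeries.coeff n (PowerSeries.X *
        PowerSeries.derivative ℂ (hSeries x)))) := by
    rcases n with _ | n
    · simp
    · simp only [PowerSeries.coeff_succ_X_mul, PowerSeries.coeff_derivative, hSeries,
        PowerSeries.coeff_mk]
      exact (tendsto_hVal_truncSeq hx (n + 1)).mul_const _
  simp only [h] at h2
  exact tendsto_nhds_unique h2 h1

/-- The power sums are determined by the complete homogeneous symmetric functions. -/
lemma pSeries_eq_of_hSeries_eq {x y : ℕ → ℝ} (hx : Summable fun i => |x i|)
    (hy : Summable fun i => |y i|) (h : hSeries x = hSeries y) : pSeries x = pSeries y := by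
  have h1 := newton_identity hx
  rw [h, newton_identity hy] at h1
  refine (mul_right_cancel₀ ?_ h1).symm
  intro h0
  have := constantCoeff_hSeries y
  rw [h0] at this
  simp at this

/-! ### Partitions and the Cauchy-Binet formula -/

/-- The Young diagram with given row lengths. -/
def ydOf (f : ℕ → ℕ) (hf : Antitone f) (n : ℕ) : YoungDiagram where
  cells := (Finset.range n ×ˢ Finset.range (f 0)).filter fun p => p.2 < f p.1
  isLowerSet := by
    rintro ⟨i, j⟩ ⟨i', j'⟩ ⟨hi, hj⟩ h
    simp only [Finset.coe_filter, Finset.mem_product, Finset.mem_range, Set.mem_ofPred_eq] at h ⊢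
    simp only at hi hj
    have := hf hi
    omega

lemma rowLen_ydOf (f : ℕ → ℕ) (hf : Antitone f) (n : ℕ) (h0 : ∀ i, n ≤ i → f i = 0) (i : ℕ) :
    (ydOf f hf n).rowLen i = f i := by
  have h : ∀ j, j < (ydOf f hf n).rowLen i ↔ j < f i := by
    intro j
    rw [← YoungDiagram.mem_iff_lt_rowLen, ← YoungDiagram.mem_cells]
    simp only [ydOf, Finset.mem_filter, Finset.mem_product, Finset.mem_range]
    have := hf (Nat.zero_le i)
    have h1 := h0 i
    constructor
    · exact fun h => h.2
    · intro h
      refine ⟨⟨?_, by omega⟩, h⟩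
      by_contra hn
      rw [h1 (by omega)] at h
      omega
  have h1 := h (f i)
  have h2 := h ((ydOf f hf n).rowLen i)
  omega

lemma yd_ext {μ ν : YoungDiagram} (h : ∀ i, μ.rowLen i = ν.rowLen i) : μ = ν := by
  refine YoungDiagram.ext (Finset.ext fun p => ?_)
  rw [YoungDiagram.mem_cells, YoungDiagram.mem_cells, ← Prod.mk.eta (p := p),
    YoungDiagram.mem_iff_lt_rowLen, YoungDiagram.mem_iff_lt_rowLen, h]

lemma yd_le_iff {μ ν : YoungDiagram} : μ ≤ ν ↔ ∀ i, μ.rowLen i ≤ ν.rowLen i := by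
  constructor
  · intro h i
    by_contra hlt
    have : (i, ν.rowLen i) ∈ μ := YoungDiagram.mem_iff_lt_rowLen.mpr (by omega)
    have := YoungDiagram.mem_iff_lt_rowLen.mp (h this)
    omega
  · intro h p hp
    have := YoungDiagram.mem_iff_lt_rowLen.mp (show (p.1, p.2) ∈ μ from hp)
    exact YoungDiagram.mem_iff_lt_rowLen.mpr (this.trans_le (h _))

lemma colLen_le_iff {μ : YoungDiagram} {n : ℕ} : μ.colLen 0 ≤ n ↔ μ.rowLen n = 0 := by
  constructor
  · exact fun h => rowLen_eq_zero_of_colLen_le μ h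
  · intro h
    by_contra hlt
    have : (n, 0) ∈ μ := YoungDiagram.mem_iff_lt_colLen.mpr (by omega)
    rw [YoungDiagram.mem_iff_lt_rowLen] at this
    omega

lemma colLen_mono {μ ν : YoungDiagram} (h : μ ≤ ν) : μ.colLen 0 ≤ ν.colLen 0 := by
  rw [colLen_le_iff]
  have := yd_le_iff.mp h (ν.colLen 0)
  rw [rowLen_eq_zero_of_colLen_le ν le_rfl] at this
  omega

lemma card_eq_sum_rowLen (μ : YoungDiagram) {n : ℕ} (hn : μ.colLen 0 ≤ n) :
    μ.card = ∑ i : Fin n, μ.rowLen i := by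
  rw [Fin.sum_univ_eq_sum_range (fun i => μ.rowLen i)]
  have h : μ.cells = (Finset.range n).biUnion μ.row := by
    ext p
    rw [Finset.mem_biUnion]
    constructor
    · intro hp
      refine ⟨p.1, ?_, YoungDiagram.mem_row_iff.mpr ⟨hp, rfl⟩⟩
      rw [Finset.mem_range]
      by_contra hlt
      have h1 : (p.1, p.2) ∈ μ := hp
      rw [YoungDiagram.mem_iff_lt_rowLen, rowLen_eq_zero_of_colLen_le μ (by omega)] at h1
      omega
    · rintro ⟨i, _, hi⟩
      exact (YoungDiagram.mem_row_iff.mp hi).1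
  rw [YoungDiagram.card, h, Finset.card_biUnion]
  · simp [YoungDiagram.rowLen_eq_card]
  · intro i _ j _ hij
    rw [Function.onFun, Finset.disjoint_left]
    intro a ha hb
    rw [YoungDiagram.mem_row_iff] at ha hb
    exact hij (ha.2.symm.trans hb.2)

/-- The strictly decreasing sequence `μ_i + n - 1 - i`. -/
def shiftSeq (μ : YoungDiagram) (n i : ℕ) : ℕ := μ.rowLen i + (n - 1 - i)

lemma shiftSeq_strictAnti (μ : YoungDiagram) (n : ℕ) :
    StrictAnti fun i : Fin n => shiftSeq μ n i := by
  intro i j hij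
  have h1 := μ.rowLen_anti i j hij.le
  have h2 : (i : ℕ) < j := hij
  have := j.2
  simp only [shiftSeq]
  omega

lemma exists_perm_strictAnti {n : ℕ} (f : Fin n → ℕ) (hf : Function.Injective f) :
    ∃ π : Equiv.Perm (Fin n), StrictAnti (f ∘ π) := by
  refine ⟨Fin.revPerm.trans (Tuple.sort f), ?_⟩
  have h1 : StrictMono (f ∘ Tuple.sort f) :=
    (Tuple.monotone_sort f).strictMono_of_injective (hf.comp (Tuple.sort f).injective)
  intro i j hij
  exact h1 (Fin.rev_lt_rev.mpr hij)

lemma strictAnti_eq_of_range_eq {n : ℕ} {f g : Fin n → ℕ} (hf : StrictAnti f) (hg : StrictAnti g)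
    (h : Set.range f = Set.range g) : f = g := by
  have hf' : StrictMono (f ∘ Fin.rev) := fun i j hij => hf (Fin.rev_lt_rev.mpr hij)
  have hg' : StrictMono (g ∘ Fin.rev) := fun i j hij => hg (Fin.rev_lt_rev.mpr hij)
  have h' : Set.range (f ∘ Fin.rev) = Set.range (g ∘ Fin.rev) := by
    rw [Fin.rev_surjective.range_comp, Fin.rev_surjective.range_comp, h]
  have := (StrictMono.range_inj hf' hg').mp h'
  funext i
  have := congrFun this i.rev
  simpa using this

/-- If f(π k) > c_k, then the k+1 largest values of f all exceed c_k, so each sits at a position i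
with c_i > c_k, that is i < k. There are only k such positions. -/
lemma sorted_le {n : ℕ} {f c : Fin n → ℕ} (hc : StrictAnti c) (hfc : ∀ i, f i ≤ c i)
    {π : Equiv.Perm (Fin n)} (hπ : StrictAnti (f ∘ π)) (k : Fin n) : f (π k) ≤ c k := by
  by_contra hlt
  have h : ∀ j ≤ k, π j < k := by
    intro j hj
    have h1 : f (π k) ≤ f (π j) := hπ.antitone hj
    have h2 := hfc (π j)
    rw [← hc.lt_iff_gt]
    omega
  have h2 : (Finset.Iic k).map π.toEmbedding ⊆ Finset.Iio k := by
    intro i hi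
    obtain ⟨j, hj, rfl⟩ := Finset.mem_map.mp hi
    exact Finset.mem_Iio.mpr (h j (Finset.mem_Iic.mp hj))
  have := Finset.card_le_card h2
  rw [Finset.card_map, Fin.card_Iic, Fin.card_Iio] at this
  omega

lemma exists_yd_shiftSeq {n : ℕ} {c : Fin n → ℕ} (hc : StrictAnti c) :
    ∃ μ : YoungDiagram, μ.colLen 0 ≤ n ∧ ∀ i : Fin n, shiftSeq μ n i = c i := by
  -- A strictly decreasing sequence of naturals dominates the staircase n-1-i; the difference is the
  -- sequence of rows.
  have hlow : ∀ i : Fin n, n - 1 - i ≤ c i := by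
    intro i
    have h : ∀ k : ℕ, ∀ hk : k < n, k ≤ c ⟨n - 1 - k, by omega⟩ := by
      intro k
      induction k with
      | zero => intro _; exact Nat.zero_le _
      | succ k ih =>
        intro hk
        have h1 := ih (by omega)
        have h2 : c ⟨n - 1 - k, by omega⟩ < c ⟨n - 1 - (k + 1), by omega⟩ :=
          hc (Fin.mk_lt_mk.mpr (by omega))
        omega
    have := h (n - 1 - i) (by have := i.2; omega)
    convert this using 2
    ext
    have := i.2
    simp only
    omega
  let f : ℕ → ℕ := fun i => if h : i < n then c ⟨i, h⟩ - (n - 1 - i) else 0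
  have hf : Antitone f := by
    refine antitone_nat_of_succ_le fun i => ?_
    simp only [f]
    split_ifs with h1 h2
    · have := hc (show (⟨i, h2⟩ : Fin n) < ⟨i + 1, h1⟩ from Fin.mk_lt_mk.mpr (by omega))
      omega
    · omega
    · omega
    · omega
  have hrow := rowLen_ydOf f hf n (fun i hi => by simp [f, not_lt.mpr hi])
  refine ⟨ydOf f hf n, ?_, fun i => ?_⟩
  · rw [colLen_le_iff, hrow]; simp [f]
  · rw [shiftSeq, hrow]
    have := hlow i
    simp only [f, i.2, dif_pos]
    simp only [Fin.eta]
    omega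

/-- The Cauchy-Binet formula, in terms of Young diagrams. -/
lemma det_sum_eq_sum_yd {A : Type*} [CommRing A] (lam : YoungDiagram) (n m : ℕ)
    (hn : lam.colLen 0 ≤ n) (hm : lam.rowLen 0 + n ≤ m) (a G : ℕ → ℕ → A)
    (ha : ∀ i c, i < n → shiftSeq lam n i < c → a i c = 0) :
    Matrix.det (Matrix.of fun i k : Fin n => ∑ c ∈ Finset.range m, a i c * G c k) =
      ∑ μ ∈ (finite_Iic lam).toFinset,
        Matrix.det (Matrix.of fun i k : Fin n => a i (shiftSeq μ n k)) *
          Matrix.det (Matrix.of fun i k : Fin n => G (shiftSeq μ n i) k) := by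
  classical
  -- Multilinearity in the rows: one term for each choice f of a column index in every row.
  have hL : Matrix.det (Matrix.of fun i k : Fin n => ∑ c ∈ Finset.range m, a i c * G c k) =
      ∑ f ∈ Fintype.piFinset fun _ : Fin n => Finset.range m, (∏ i : Fin n, a i (f i)) *
        Matrix.det (Matrix.of fun i k : Fin n => G (f i) k) := by
    have h := (Matrix.detRowAlternating (n := Fin n) (R := A)).toMultilinearMap.map_sum_finset
      (fun i c => a i c • fun k : Fin n => G c k) (fun _ => Finset.range m)
    have e : (Matrix.of fun i k : Fin n => ∑ c ∈ Finset.range m, a i c * G c k) =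
        Matrix.of fun i : Fin n => ∑ c ∈ Finset.range m, a i c • fun k : Fin n => G c k := by
      ext i k
      simp
    rw [e]
    refine h.trans (Finset.sum_congr rfl fun f _ => ?_)
    exact (Matrix.detRowAlternating (n := Fin n) (R := A)).toMultilinearMap.map_smul_univ _ _
  have hR : ∀ μ : YoungDiagram,
      Matrix.det (Matrix.of fun i k : Fin n => a i (shiftSeq μ n k)) *
          Matrix.det (Matrix.of fun i k : Fin n => G (shiftSeq μ n i) k) =
      ∑ π : Equiv.Perm (Fin n), (∏ i : Fin n, a i (shiftSeq μ n (π i))) *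
        Matrix.det (Matrix.of fun i k : Fin n => G (shiftSeq μ n (π i)) k) := by
    intro μ
    rw [← Matrix.det_transpose, Matrix.det_apply', Finset.sum_mul]
    refine Finset.sum_congr rfl fun π _ => ?_
    have h := Matrix.det_permute π (Matrix.of fun i k : Fin n => G (shiftSeq μ n i) k)
    rw [show (Matrix.of fun i k : Fin n => G (shiftSeq μ n (π i)) k) =
      (Matrix.of fun i k : Fin n => G (shiftSeq μ n i) k).submatrix π id from rfl, h]
    simp only [Matrix.transpose_apply, Matrix.of_apply]
    ring
  rw [hL, Finset.sum_congr rfl fun μ _ => hR μ, ← Finset.sum_product']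
  symm
  -- Pairs (μ, π) parametrize the injective f that stay below λ once sorted. All other f contribute
  -- zero: a repeated index gives equal rows, and an index above `shiftSeq lam n i` kills a factor
  -- a_i. By `sorted_le`, an f bounded entrywise by λ gives μ ⊆ λ.
  refine Finset.sum_of_injOn (fun p : YoungDiagram × Equiv.Perm (Fin n) =>
    fun i : Fin n => shiftSeq p.1 n (p.2 i)) ?_ ?_ ?_ ?_
  · rintro ⟨μ, π⟩ hμ ⟨ν, ρ⟩ hν h
    simp only [Finset.coe_product, Set.mem_prod, Finset.mem_coe, Set.Finite.mem_toFinset,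
      Set.mem_Iic] at hμ hν
    simp only at h
    have hr : (fun i : Fin n => shiftSeq μ n i) = fun i : Fin n => shiftSeq ν n i := by
      refine strictAnti_eq_of_range_eq (shiftSeq_strictAnti μ n) (shiftSeq_strictAnti ν n) ?_
      have := congrArg Set.range h
      rwa [show (fun i : Fin n => shiftSeq μ n (π i)) = (fun i : Fin n => shiftSeq μ n i) ∘ π from rfl,
        show (fun i : Fin n => shiftSeq ν n (ρ i)) = (fun i : Fin n => shiftSeq ν n i) ∘ ρ from rfl,
        π.surjective.range_comp, ρ.surjective.range_comp] at this
    have hμν : μ = ν := by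
      refine yd_ext fun i => ?_
      rcases lt_or_ge i n with hi | hi
      · have := congrFun hr ⟨i, hi⟩
        simp only [shiftSeq] at this
        omega
      · rw [rowLen_eq_zero_of_colLen_le μ ((colLen_mono hμ.1).trans (hn.trans hi)),
          rowLen_eq_zero_of_colLen_le ν ((colLen_mono hν.1).trans (hn.trans hi))]
    subst hμν
    refine Prod.ext rfl (Equiv.ext fun i => ?_)
    exact (shiftSeq_strictAnti μ n).injective (congrFun h i)
  · rintro ⟨μ, π⟩ hμ
    simp only [Finset.coe_product, Set.mem_prod, Finset.mem_coe, Set.Finite.mem_toFinset,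
      Set.mem_Iic] at hμ
    simp only [Finset.mem_coe, Fintype.mem_piFinset, Finset.mem_range]
    intro i
    have h1 := yd_le_iff.mp hμ.1 (π i)
    have h2 := lam.rowLen_anti 0 (π i) (Nat.zero_le _)
    have := (π i).2
    simp only [shiftSeq]
    omega
  · intro f _ hf
    by_contra hne
    apply hf
    have hinj : Function.Injective f := by
      intro i j hij
      by_contra hij'
      refine hne (mul_eq_zero_of_right _ (Matrix.det_zero_of_row_eq hij' ?_))
      ext k
      simp [hij]
    have hle : ∀ i, f i ≤ shiftSeq lam n i := by
      intro i
      by_contra hlt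
      exact hne (mul_eq_zero_of_left (Finset.prod_eq_zero (Finset.mem_univ i)
        (ha i _ i.2 (by omega))) _)
    obtain ⟨π, hπ⟩ := exists_perm_strictAnti f hinj
    obtain ⟨μ, hμn, hμ⟩ := exists_yd_shiftSeq hπ
    refine ⟨(μ, π.symm), ?_, ?_⟩
    · simp only [Finset.coe_product, Set.mem_prod, Finset.mem_coe, Set.Finite.mem_toFinset,
        Set.mem_Iic, Finset.mem_univ, and_true]
      rw [yd_le_iff]
      intro i
      rcases lt_or_ge i n with hi | hi
      · have h1 := sorted_le (shiftSeq_strictAnti lam n) hle hπ ⟨i, hi⟩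
        have h2 := hμ ⟨i, hi⟩
        simp only [Function.comp] at h2
        rw [← h2] at h1
        simp only [shiftSeq] at h1
        omega
      · rw [rowLen_eq_zero_of_colLen_le μ (hμn.trans hi)]
        exact Nat.zero_le _
    · funext i
      have := hμ (π.symm i)
      simpa using this
  · intro p _
    rfl

/-! ### Determinantal formula for the `q`-Racah symmetric functions -/

/-- The coefficient of the expansion of the `a`-th univariate function in the nodes. -/
def racahCoeff (q : ℝ) (s₀ s₁ s₂ s₃ : ℂ) (a : ℤ) (d : ℕ) : ℂ :=
  (qPoch q (-(s₀ * s₁ * (q : ℂ) ^ (a - d + 1))) d * qPoch q (-(s₀ * s₂ * (q : ℂ) ^ (a - d + 1))) d *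
      qPoch q (-(s₀ * s₃ * (q : ℂ) ^ (a - d + 1))) d) /
    (s₀ ^ d * ((q : ℂ) ^ ((a - d + 1) * d) * (qPoch q (q : ℂ) d *
      qPoch q (s₀ * s₁ * s₂ * s₃ * (q : ℂ) ^ (2 * a - d + 1)) d)))

lemma racahCoeff_zero (q : ℝ) (s₀ s₁ s₂ s₃ : ℂ) (a : ℤ) : racahCoeff q s₀ s₁ s₂ s₃ a 0 = 1 := by
  simp [racahCoeff, qPoch]

/-- The series `∑_d A(a, a - d) w^d G_{a - d}(w)`. -/
def racahSeries (q : ℝ) (s₀ s₁ s₂ s₃ : ℂ) (a : ℤ) : PowerSeries ℂ :=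
  PowerSeries.mk fun n => ∑ d ∈ Finset.range (n + 1),
    racahCoeff q s₀ s₁ s₂ s₃ a d * PowerSeries.coeff (n - d) (nodeSeries q s₀ (a - d))

lemma constantCoeff_racahSeries (q : ℝ) (s₀ s₁ s₂ s₃ : ℂ) (a : ℤ) :
    PowerSeries.constantCoeff (racahSeries q s₀ s₁ s₂ s₃ a) = 1 := by
  rw [← PowerSeries.coeff_zero_eq_constantCoeff_apply, racahSeries, PowerSeries.coeff_mk]
  simp [racahCoeff_zero, constantCoeff_nodeSeries]

lemma coeff_racahSeries (q : ℝ) (s₀ s₁ s₂ s₃ : ℂ) (a : ℤ) {r m : ℕ} (h : r < m) :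
    PowerSeries.coeff r (racahSeries q s₀ s₁ s₂ s₃ a) = PowerSeries.coeff r
      (∑ d ∈ Finset.range m, PowerSeries.C (racahCoeff q s₀ s₁ s₂ s₃ a d) *
        (PowerSeries.X ^ d * nodeSeries q s₀ (a - d))) := by
  rw [racahSeries, PowerSeries.coeff_mk, map_sum]
  simp only [PowerSeries.coeff_C_mul, PowerSeries.coeff_X_pow_mul']
  rw [← Finset.sum_subset (Finset.range_subset_range.mpr (show r + 1 ≤ m by omega))]
  · refine Finset.sum_congr rfl fun d hd => ?_
    rw [if_pos (by simp only [Finset.mem_range] at hd; omega)]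
  · intro d _ hd
    rw [if_neg (by simp only [Finset.mem_range] at hd; omega), mul_zero]

lemma coeffZ_sum {ι : Type*} {A : Type*} [CommRing A] (s : Finset ι) (f : ι → PowerSeries A)
    (n : ℤ) : coeffZ n (∑ i ∈ s, f i) = ∑ i ∈ s, coeffZ n (f i) := by
  unfold coeffZ; split_ifs <;> simp

lemma coeffZ_X_pow_mul {A : Type*} [CommRing A] (n : ℤ) (d : ℕ) (f : PowerSeries A) :
    coeffZ n (PowerSeries.X ^ d * f) = coeffZ (n - d) f := by
  induction d generalizing n with
  | zero => simp
  | succ d ih =>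
    rw [pow_succ', mul_assoc, coeffZ_X_mul, ih]
    congr 1; push_cast; ring

lemma coeffZ_mul_congr {A : Type*} [CommRing A] {n : ℤ} {m : ℕ} (hn : n < m) {f f' : PowerSeries A}
    (g : PowerSeries A) (h : ∀ r < m, PowerSeries.coeff r f = PowerSeries.coeff r f') :
    coeffZ n (f * g) = coeffZ n (f' * g) := by
  rcases lt_or_ge n 0 with h0 | h0
  · rw [coeffZ_of_neg h0, coeffZ_of_neg h0]
  · rw [coeffZ_of_nonneg h0, coeffZ_of_nonneg h0, PowerSeries.coeff_mul, PowerSeries.coeff_mul]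
    refine Finset.sum_congr rfl fun p hp => ?_
    rw [h]
    have := Finset.HasAntidiagonal.mem_antidiagonal.mp hp
    omega

lemma coeffZ_racahSeries_mul (q : ℝ) (s₀ s₁ s₂ s₃ : ℂ) (a n : ℤ) (m : ℕ) (hn : n < m)
    (H : PowerSeries ℂ) :
    coeffZ n (racahSeries q s₀ s₁ s₂ s₃ a * H) = ∑ d ∈ Finset.range m,
      racahCoeff q s₀ s₁ s₂ s₃ a d * coeffZ (n - d) (nodeSeries q s₀ (a - d) * H) := by
  rw [coeffZ_mul_congr hn H fun r hr => coeff_racahSeries q s₀ s₁ s₂ s₃ a hr, Finset.sum_mul,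
    coeffZ_sum]
  refine Finset.sum_congr rfl fun d _ => ?_
  rw [mul_assoc, mul_assoc, coeffZ_C_mul, coeffZ_X_pow_mul]

/-- The matrix of the coefficients in terms of the shifted index `c = b + n`. -/
def racahMatrix (q : ℝ) (s₀ s₁ s₂ s₃ : ℂ) (lam : YoungDiagram) (n i c : ℕ) : ℂ :=
  if c ≤ shiftSeq lam n i then
    racahCoeff q s₀ s₁ s₂ s₃ ((lam.rowLen i : ℤ) - i - 1) (shiftSeq lam n i - c) else 0

/-- The power s₀^{-d} splits into a row factor and a column factor because d is a difference of a
row quantity and a column quantity; in the determinant these factors make up s₀^{|μ|-|λ|}. -/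
lemma sigmaEntry_eq (q : ℝ) (s₀ s₁ s₂ s₃ : ℂ) (hs₀ : s₀ ≠ 0) (lam μ : YoungDiagram) (n : ℕ)
    (j k : Fin n) :
    racahMatrix q s₀ s₁ s₂ s₃ lam n j (shiftSeq μ n k) =
      s₀ ^ (-((lam.rowLen j : ℤ) - j)) * (s₀ ^ ((μ.rowLen k : ℤ) - k) *
        sigmaEntry q s₀ s₁ s₂ s₃ lam μ j k) := by
  have hj := j.2
  have hk := k.2
  by_cases h : (lam.rowLen j : ℤ) - j - μ.rowLen k + k < 0
  · rw [racahMatrix, if_neg (by simp only [shiftSeq]; omega), sigmaEntry]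
    simp [h]
  · obtain ⟨d, hd⟩ : ∃ d : ℕ, (lam.rowLen j : ℤ) - j - μ.rowLen k + k = d :=
      ⟨_, (Int.toNat_of_nonneg (not_lt.mp h)).symm⟩
    rw [racahMatrix, if_pos (by simp only [shiftSeq]; omega),
      show shiftSeq lam n j - shiftSeq μ n k = d by simp only [shiftSeq]; omega, sigmaEntry]
    simp only [hd, Int.toNat_natCast]
    rw [← mul_assoc, ← zpow_add₀ hs₀,
      show -((lam.rowLen j : ℤ) - j) + ((μ.rowLen k : ℤ) - k) = -(d : ℤ) by omega, racahCoeff,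
      show (lam.rowLen j : ℤ) - j - 1 - d + 1 = (μ.rowLen k : ℤ) - k by omega,
      show 2 * ((lam.rowLen j : ℤ) - j - 1) - d + 1 =
        (lam.rowLen j : ℤ) + μ.rowLen k - 1 - j - k by omega, zpow_neg, zpow_natCast,
      if_neg (by omega)]
    field_simp

lemma det_racahMatrix (q : ℝ) (s₀ s₁ s₂ s₃ : ℂ) (hs₀ : s₀ ≠ 0) (lam μ : YoungDiagram)
    (h : μ ≤ lam) :
    Matrix.det (Matrix.of fun i k : Fin (lam.colLen 0) =>
      racahMatrix q s₀ s₁ s₂ s₃ lam (lam.colLen 0) i (shiftSeq μ (lam.colLen 0) k)) =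
      sigma q s₀ s₁ s₂ s₃ lam μ := by
  set n := lam.colLen 0 with hn
  simp only [sigmaEntry_eq q s₀ s₁ s₂ s₃ hs₀]
  have h1 := Matrix.det_mul_column (fun i : Fin n => s₀ ^ (-((lam.rowLen i : ℤ) - i)))
    (Matrix.of fun i k : Fin n => s₀ ^ ((μ.rowLen k : ℤ) - k) *
      sigmaEntry q s₀ s₁ s₂ s₃ lam μ i k)
  have h2 := Matrix.det_mul_row (fun k : Fin n => s₀ ^ ((μ.rowLen k : ℤ) - k))
    (Matrix.of fun i k : Fin n => sigmaEntry q s₀ s₁ s₂ s₃ lam μ i k)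
  simp only [Matrix.of_apply] at h1 h2
  rw [h1, h2, sigma, ← mul_assoc, ← Finset.prod_mul_distrib]
  congr 1
  have hp : ∀ (s : Finset (Fin n)) (e : Fin n → ℤ), ∏ i ∈ s, s₀ ^ e i = s₀ ^ ∑ i ∈ s, e i := by
    intro s e
    induction s using Finset.cons_induction with
    | empty => simp
    | cons a s ha ih => rw [Finset.prod_cons, Finset.sum_cons, zpow_add₀ hs₀, ih]
  simp only [← zpow_add₀ hs₀]
  rw [hp, card_eq_sum_rowLen μ (colLen_mono h), card_eq_sum_rowLen lam le_rfl]
  congr 1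
  push_cast
  rw [← Finset.sum_sub_distrib]
  exact Finset.sum_congr rfl fun i _ => by ring

/-- A lift to the algebra of convergent series together with its value: determinants can then be
evaluated through the homomorphism `evalHom`. -/
lemma hsymm_mul_eval {x : ℕ → ℝ} (hx : Summable x) (f : PowerSeries ℂ) (n : ℤ) :
    ∃ F : evalDom x, (F : MvPowerSeries ℕ ℂ) = coeffZ n (constSeries f * hsymmSeries) ∧
      evalHom x F = coeffZ n (f * hSeries x) := by
  rcases lt_or_ge n 0 with h0 | h0
  · exact ⟨0, by simp [coeffZ_of_neg h0], by simp [coeffZ_of_neg h0]⟩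
  · refine ⟨∑ p ∈ Finset.HasAntidiagonal.antidiagonal n.toNat,
      algebraMap ℂ (evalDom x) (PowerSeries.coeff p.1 f) *
        ⟨_, hsymm_mem_evalDom hx p.2⟩, ?_, ?_⟩
    · rw [coeffZ_of_nonneg h0, PowerSeries.coeff_mul, AddSubmonoidClass.coe_finsetSum]
      refine Finset.sum_congr rfl fun p _ => ?_
      simp only [constSeries, PowerSeries.coeff_map, hsymmSeries, PowerSeries.coeff_mk]
      rfl
    · rw [coeffZ_of_nonneg h0, PowerSeries.coeff_mul, map_sum]
      refine Finset.sum_congr rfl fun p _ => ?_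
      rw [map_mul, AlgHom.commutes]
      simp only [hSeries, PowerSeries.coeff_mk]
      rfl

lemma interpBC_eval {q : ℝ} (hq₀ : 0 < q) (hq₁ : q < 1) (s : ℂ) {x : ℕ → ℝ} (hx : Summable x)
    (μ : YoungDiagram) (n : ℕ) (hn : μ.colLen 0 ≤ n) :
    ∃ F : evalDom x, (F : MvPowerSeries ℕ ℂ) = interpBC q s μ ∧
      evalHom x F = Matrix.det (Matrix.of fun i k : Fin n => coeffZ ((μ.rowLen i : ℤ) - i + k)
        (nodeSeries q s ((μ.rowLen i : ℤ) - i - 1) * hSeries x)) := by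
  choose F hF using fun i k : Fin n => hsymm_mul_eval hx
    (nodeSeries q s ((μ.rowLen i : ℤ) - i - 1)) ((μ.rowLen i : ℤ) - i + k)
  refine ⟨Matrix.det (Matrix.of F), ?_, ?_⟩
  · rw [interpBC_eq_det hq₀ hq₁ s μ n hn, ← Subalgebra.coe_val, AlgHom.map_det]
    congr 1
    refine Matrix.ext fun i k => ?_
    exact (hF i k).1
  · rw [AlgHom.map_det]
    congr 1
    ext i k
    exact (hF i k).2

lemma evalAt_Phi_eq_sum {q : ℝ} (hq₀ : 0 < q) (hq₁ : q < 1) (s₀ s₁ s₂ s₃ : ℂ)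
    {x : ℕ → ℝ} (hx : Summable x) (lam : YoungDiagram) :
    evalAt (Phi q s₀ s₁ s₂ s₃ lam) x = ∑ μ ∈ (finite_Iic lam).toFinset,
      sigma q s₀ s₁ s₂ s₃ lam μ * Matrix.det (Matrix.of fun i k : Fin (lam.colLen 0) =>
        coeffZ ((μ.rowLen i : ℤ) - i + k)
          (nodeSeries q s₀ ((μ.rowLen i : ℤ) - i - 1) * hSeries x)) := by
  have hF : ∀ μ : YoungDiagram, ∃ F : evalDom x, μ ≤ lam →
      (F : MvPowerSeries ℕ ℂ) = interpBC q s₀ μ ∧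
      evalHom x F = Matrix.det (Matrix.of fun i k : Fin (lam.colLen 0) =>
        coeffZ ((μ.rowLen i : ℤ) - i + k)
        (nodeSeries q s₀ ((μ.rowLen i : ℤ) - i - 1) * hSeries x)) := by
    intro μ
    by_cases h : μ ≤ lam
    · obtain ⟨F, hF⟩ := interpBC_eval hq₀ hq₁ s₀ hx μ _ (colLen_mono h)
      exact ⟨F, fun _ => hF⟩
    · exact ⟨0, fun h' => absurd h' h⟩
  choose F hF using hF
  have h2 : ((∑ μ ∈ (finite_Iic lam).toFinset, sigma q s₀ s₁ s₂ s₃ lam μ • F μ : evalDom x) :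
      MvPowerSeries ℕ ℂ) = (Phi q s₀ s₁ s₂ s₃ lam : MvPowerSeries ℕ ℂ) := by
    rw [Phi, AddSubmonoidClass.coe_finsetSum, AddSubmonoidClass.coe_finsetSum]
    refine Finset.sum_congr rfl fun μ hμ => ?_
    rw [Subalgebra.coe_smul, Subalgebra.coe_smul, (hF μ (by simpa using hμ)).1]
  have h3 : evalAt (Phi q s₀ s₁ s₂ s₃ lam) x =
      evalHom x (∑ μ ∈ (finite_Iic lam).toFinset, sigma q s₀ s₁ s₂ s₃ lam μ • F μ) := by
    rw [evalHom_apply, h2]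
    rfl
  rw [h3, map_sum]
  refine Finset.sum_congr rfl fun μ hμ => ?_
  rw [map_smul, (hF μ (by simpa using hμ)).2, smul_eq_mul]

/-- Both σ(λ,μ) and I_μ are determinants indexed by the shifted rows of μ, so the sum over μ ⊆ λ is
a Cauchy-Binet sum. The entries of the product matrix are sums over d, which is how `racahSeries`
arises. -/
lemma evalAt_Phi {q : ℝ} (hq₀ : 0 < q) (hq₁ : q < 1) {s₀ : ℂ} (hs₀ : s₀ ≠ 0) (s₁ s₂ s₃ : ℂ)
    {x : ℕ → ℝ} (hx : Summable x) (lam : YoungDiagram) (n : ℕ) (hn : lam.colLen 0 ≤ n) :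
    evalAt (Phi q s₀ s₁ s₂ s₃ lam) x =
      Matrix.det (Matrix.of fun i k : Fin n => coeffZ ((lam.rowLen i : ℤ) - i + k)
        (racahSeries q s₀ s₁ s₂ s₃ ((lam.rowLen i : ℤ) - i - 1) * hSeries x)) := by
  rw [det_coeffZ_stable lam (fun i => racahSeries q s₀ s₁ s₂ s₃ ((lam.rowLen i : ℤ) - i - 1) *
    hSeries x) le_rfl hn (fun i => by
      rw [map_mul, constantCoeff_racahSeries, constantCoeff_hSeries, mul_one])]
  clear hn n
  rw [evalAt_Phi_eq_sum hq₀ hq₁ s₀ s₁ s₂ s₃ hx]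
  set n := lam.colLen 0 with hn
  have hCB := det_sum_eq_sum_yd lam n (lam.rowLen 0 + n) le_rfl le_rfl
    (racahMatrix q s₀ s₁ s₂ s₃ lam n)
    (fun c k => coeffZ ((c : ℤ) - n + 1 + k) (nodeSeries q s₀ ((c : ℤ) - n) * hSeries x))
    (fun i c _ h => by rw [racahMatrix, if_neg (by omega)])
  -- The column index is c = b + n with b = a - d and a = λ_i - i - 1; reversing the order of
  -- summation turns the sum over c into the sum over d.
  have e : ∀ i k : Fin n, ∑ c ∈ Finset.range (lam.rowLen 0 + n), racahMatrix q s₀ s₁ s₂ s₃ lam n i c *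
      coeffZ ((c : ℤ) - n + 1 + k) (nodeSeries q s₀ ((c : ℤ) - n) * hSeries x) =
      coeffZ ((lam.rowLen i : ℤ) - i + k)
        (racahSeries q s₀ s₁ s₂ s₃ ((lam.rowLen i : ℤ) - i - 1) * hSeries x) := by
    intro i k
    have hi := i.2
    have hk := k.2
    have hle := lam.rowLen_anti 0 i (Nat.zero_le _)
    rw [coeffZ_racahSeries_mul q s₀ s₁ s₂ s₃ _ _ (shiftSeq lam n i + 1) (by
      simp only [shiftSeq]; omega), ← Finset.sum_subset (Finset.range_subset_range.mpr
        (show shiftSeq lam n i + 1 ≤ lam.rowLen 0 + n by simp only [shiftSeq]; omega)),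
      ← Finset.sum_range_reflect]
    · refine Finset.sum_congr rfl fun c hc => ?_
      have hc' : c ≤ shiftSeq lam n i := by simpa [Nat.lt_succ_iff] using hc
      rw [racahMatrix, if_pos (by omega),
        show shiftSeq lam n i - (shiftSeq lam n i + 1 - 1 - c) = c by omega]
      have e2 : ((shiftSeq lam n i + 1 - 1 - c : ℕ) : ℤ) = (lam.rowLen i : ℤ) - i - 1 + n - c := by
        simp only [shiftSeq] at hc' ⊢
        omega
      rw [e2, show (lam.rowLen i : ℤ) - i - 1 + n - c - n + 1 + k = lam.rowLen i - i + k - c by ring,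
        show (lam.rowLen i : ℤ) - i - 1 + n - c - n = lam.rowLen i - i - 1 - c by ring]
    · intro c _ hc
      rw [racahMatrix, if_neg (by simp only [Finset.mem_range] at hc; omega), zero_mul]
  simp only [e] at hCB
  rw [hCB]
  refine Finset.sum_congr rfl fun μ hμ => ?_
  rw [det_racahMatrix q s₀ s₁ s₂ s₃ hs₀ lam μ (by simpa using hμ)]
  congr 2
  ext i k
  have hi := i.2
  have e3 : ((shiftSeq μ n i : ℕ) : ℤ) = (μ.rowLen i : ℤ) - i - 1 + n := by
    simp only [shiftSeq]; omega
  simp only [Matrix.of_apply, e3]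
  rw [show (μ.rowLen i : ℤ) - i - 1 + n - n + 1 + k = μ.rowLen i - i + k by ring,
    show (μ.rowLen i : ℤ) - i - 1 + n - n = μ.rowLen i - i - 1 by ring]

/-! ### The three-term recurrence relation -/

lemma qPoch_succ (q : ℝ) (x : ℂ) (n : ℕ) :
    qPoch q x (n + 1) = qPoch q x n * (1 - x * (q : ℂ) ^ n) := Finset.prod_range_succ _ _

lemma qPoch_succ' (q : ℝ) (x : ℂ) (n : ℕ) :
    qPoch q x (n + 1) = (1 - x) * qPoch q (x * q) n := by
  rw [qPoch, Finset.prod_range_succ', mul_comm]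
  simp only [qPoch, pow_zero, mul_one, pow_succ', mul_assoc]

lemma qPoch_ne_zero {q : ℝ} {x : ℂ} {n : ℕ} (h : ∀ k < n, x * (q : ℂ) ^ k ≠ 1) :
    qPoch q x n ≠ 0 :=
  Finset.prod_ne_zero_iff.mpr fun k hk => sub_ne_zero.mpr (h k (Finset.mem_range.mp hk)).symm

/-- The diagonal coefficient of the three-term recurrence. -/
def recB (q : ℝ) (s₀ s₁ s₂ s₃ : ℂ) (a : ℤ) : ℂ :=
  let x := (q : ℂ) ^ a
  let e1 := s₀ + s₁ + s₂ + s₃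
  let e3 := s₀ * s₁ * s₂ + s₀ * s₁ * s₃ + s₀ * s₂ * s₃ + s₁ * s₂ * s₃
  ((e1 + e3 * x) / (1 - s₀ * s₁ * s₂ * s₃ * x ^ 2) -
    (e1 + e3 * (q * x)) / (1 - s₀ * s₁ * s₂ * s₃ * (q * x) ^ 2)) / (1 - q)

/-- The subdiagonal coefficient of the three-term recurrence. -/
def recC (q : ℝ) (s₀ s₁ s₂ s₃ : ℂ) (a : ℤ) : ℂ :=
  let x := (q : ℂ) ^ a
  let S := s₀ * s₁ * s₂ * s₃
  (S * x / q) * ((1 + s₀ * s₁ * x) * (1 + s₀ * s₂ * x) * (1 + s₀ * s₃ * x) * (1 + s₁ * s₂ * x) *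
    (1 + s₁ * s₃ * x) * (1 + s₂ * s₃ * x)) /
    ((1 - S * x ^ 2 / q) * (1 - S * x ^ 2) ^ 2 * (1 - S * q * x ^ 2))

/-- What remains of the recurrence for the coefficients after division by their common factor: s
stands for s₀, e1, e2, e3 for the elementary symmetric polynomials of s₁, s₂, s₃, and x = q^a, t =
q^i. -/
lemma recurrence_identity (s e1 e2 e3 x t q : ℂ) (ht : t ≠ 0)
    (hq : q ≠ 0) (hq1 : 1 - q ≠ 0) (h1 : 1 - s * e3 * x ^ 2 ≠ 0)
    (h2 : 1 - s * e3 * q * x ^ 2 ≠ 0) (h3 : 1 - s * e3 * (q * x) ^ 2 ≠ 0) :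
    (1 + s * e1 * (x / (q * t)) + s ^ 2 * e2 * (x / (q * t)) ^ 2 + s ^ 3 * e3 * (x / (q * t)) ^ 3) *
        (t * q ^ 2) + (1 - q ^ 2 * t) * (1 - s * e3 * x ^ 2 / (q * t)) =
      (1 + s * e1 * (q * x) + s ^ 2 * e2 * (q * x) ^ 2 + s ^ 3 * e3 * (q * x) ^ 3) *
        (1 - s * e3 * x ^ 2 / (q * t)) * (1 - s * e3 * x ^ 2 / t) /
          ((1 - s * e3 * q * x ^ 2) * (1 - s * e3 * (q * x) ^ 2)) +
      ((s + e1 + (s * e2 + e3) * x) / (1 - s * e3 * x ^ 2) -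
        (s + e1 + (s * e2 + e3) * (q * x)) / (1 - s * e3 * (q * x) ^ 2)) / (1 - q) *
          (s * (x / t)) * (1 - q ^ 2 * t) * (1 - s * e3 * x ^ 2 / (q * t)) +
      (s * e3 * x / q) * (1 + e2 * x + e1 * e3 * x ^ 2 + e3 ^ 2 * x ^ 3) * (s * (x / t)) ^ 2 *
        (1 - q * t) * (1 - q ^ 2 * t) / ((1 - s * e3 * x ^ 2) * (1 - s * e3 * q * x ^ 2)) := by
  -- The denominators become atoms while fractions are cleared and are expanded only for the final
  -- polynomial identity.
  obtain ⟨D1, hD1⟩ : ∃ D, D = 1 - s * e3 * x ^ 2 := ⟨_, rfl⟩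
  obtain ⟨D2, hD2⟩ : ∃ D, D = 1 - s * e3 * q * x ^ 2 := ⟨_, rfl⟩
  obtain ⟨D3, hD3⟩ : ∃ D, D = 1 - s * e3 * (q * x) ^ 2 := ⟨_, rfl⟩
  obtain ⟨Q, hQ⟩ : ∃ D, D = 1 - q := ⟨_, rfl⟩
  rw [← hD1] at h1 ⊢
  rw [← hD2] at h2 ⊢
  rw [← hD3] at h3 ⊢
  rw [← hQ] at hq1 ⊢
  field_simp
  rw [hD1, hD2, hD3, hQ]
  ring

/-- The `q`-Pochhammer symbol `(c q^e; q)_n`. -/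
def zPoch (q : ℝ) (c : ℂ) (e : ℤ) (n : ℕ) : ℂ := qPoch q (c * (q : ℂ) ^ e) n

lemma zPoch_succ {q : ℝ} (hq₀ : 0 < q) (c : ℂ) (e : ℤ) (n : ℕ) :
    zPoch q c e (n + 1) = zPoch q c e n * (1 - c * (q : ℂ) ^ (e + n)) := by
  rw [zPoch, qPoch_succ, zpow_add₀ (q_ne_zero hq₀), zpow_natCast, zPoch, mul_assoc c]

lemma zPoch_succ' {q : ℝ} (hq₀ : 0 < q) (c : ℂ) (e : ℤ) (n : ℕ) :
    zPoch q c e (n + 1) = (1 - c * (q : ℂ) ^ e) * zPoch q c (e + 1) n := by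
  rw [zPoch, qPoch_succ', zPoch, zpow_add_one₀ (q_ne_zero hq₀), mul_assoc c]

lemma zPoch_ne_zero {q : ℝ} (hq₀ : 0 < q) {c : ℂ} (h : ∀ k : ℤ, c * (q : ℂ) ^ k ≠ 1) (e : ℤ) (n : ℕ) :
    zPoch q c e n ≠ 0 := by
  refine qPoch_ne_zero fun k _ => ?_
  rw [mul_assoc, ← zpow_natCast, ← zpow_add₀ (q_ne_zero hq₀)]
  exact h _

lemma qPoch_self_ne_zero {q : ℝ} (hq₀ : 0 < q) (hq₁ : q < 1) (n : ℕ) : qPoch q (q : ℂ) n ≠ 0 := by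
  refine qPoch_ne_zero fun k _ h => ?_
  rw [← pow_succ'] at h
  exact one_sub_q_pow_ne_zero hq₀ hq₁ k (by rw [h, sub_self])

lemma racahCoeff_eq (q : ℝ) (s₀ s₁ s₂ s₃ : ℂ) (a : ℤ) (d : ℕ) :
    racahCoeff q s₀ s₁ s₂ s₃ a d =
      (zPoch q (-(s₀ * s₁)) (a - d + 1) d * zPoch q (-(s₀ * s₂)) (a - d + 1) d *
        zPoch q (-(s₀ * s₃)) (a - d + 1) d) /
      (s₀ ^ d * ((q : ℂ) ^ ((a - d + 1) * d) * (qPoch q (q : ℂ) d *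
        zPoch q (s₀ * s₁ * s₂ * s₃) (2 * a - d + 1) d))) := by
  simp only [racahCoeff, zPoch, neg_mul]

section Recurrence

variable {q : ℝ} {s₀ s₁ s₂ s₃ : ℂ}

/-- This is the coefficient of w^{i+2} G_{a-i-1} in the three-term recurrence for F_a. The node term
comes from rewriting G_{a-d} through G_{a+1-d}. -/
lemma racahCoeff_recurrence (hq₀ : 0 < q) (hq₁ : q < 1) (hs₀ : s₀ ≠ 0)
    (hσ : ∀ k : ℤ, s₀ * s₁ * s₂ * s₃ * (q : ℂ) ^ k ≠ 1) (a : ℤ) (i : ℕ) :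
    racahCoeff q s₀ s₁ s₂ s₃ a (i + 2) +
        s₀⁻¹ * (q : ℂ) ^ ((i : ℤ) - a) * racahCoeff q s₀ s₁ s₂ s₃ a (i + 1) =
      racahCoeff q s₀ s₁ s₂ s₃ (a + 1) (i + 2) +
        recB q s₀ s₁ s₂ s₃ a * racahCoeff q s₀ s₁ s₂ s₃ a (i + 1) +
        recC q s₀ s₁ s₂ s₃ a * racahCoeff q s₀ s₁ s₂ s₃ (a - 1) i := by
  have hq := q_ne_zero hq₀
  have hQ := qPoch_self_ne_zero hq₀ hq₁ i
  set σ := s₀ * s₁ * s₂ * s₃ with hσdef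
  have hS := zPoch_ne_zero hq₀ hσ (2 * a - 1 - i) i
  obtain ⟨x, hx⟩ : ∃ x, x = (q : ℂ) ^ a := ⟨_, rfl⟩
  obtain ⟨t, ht⟩ : ∃ t, t = (q : ℂ) ^ i := ⟨_, rfl⟩
  have hx0 : x ≠ 0 := hx ▸ zpow_ne_zero _ hq
  have ht0 : t ≠ 0 := ht ▸ pow_ne_zero _ hq
  have hti : (q : ℂ) ^ (i : ℤ) = t := by rw [ht, zpow_natCast]
  have z1 : (q : ℂ) ^ (a - i - 1) = x / (q * t) := by
    rw [zpow_sub₀ hq, zpow_sub₀ hq, hti, ← hx, zpow_one]; field_simp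
  have z2 : (q : ℂ) ^ (2 * a - 1 - i) = x ^ 2 / (q * t) := by
    rw [zpow_sub₀ hq, zpow_sub₀ hq, hti, zpow_one, two_mul, zpow_add₀ hq, ← hx]; field_simp
  have z3 : (q : ℂ) ^ (2 * a - i) = x ^ 2 / t := by
    rw [zpow_sub₀ hq, hti, two_mul, zpow_add₀ hq, ← hx]; field_simp
  have z4 : (q : ℂ) ^ (2 * a - 1) = x ^ 2 / q := by
    rw [zpow_sub₀ hq, zpow_one, two_mul, zpow_add₀ hq, ← hx]; field_simp
  have z5 : (q : ℂ) ^ (2 * a) = x ^ 2 := by rw [two_mul, zpow_add₀ hq, ← hx]; ring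
  have z6 : (q : ℂ) ^ (2 * a + 1) = q * x ^ 2 := by rw [zpow_add_one₀ hq, z5]; ring
  have z7 : (q : ℂ) ^ (2 * a + 2) = (q * x) ^ 2 := by
    rw [zpow_add₀ hq, z5, zpow_ofNat]; ring
  have z8 : (q : ℂ) ^ (a + 1) = q * x := by rw [zpow_add_one₀ hq, ← hx]; ring
  have hm2 : 1 - σ * (x ^ 2 / (q * t)) ≠ 0 := by rw [← z2, sub_ne_zero]; exact (hσ _).symm
  have hm3 : 1 - σ * (x ^ 2 / t) ≠ 0 := by rw [← z3, sub_ne_zero]; exact (hσ _).symm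
  have hm4 : 1 - σ * (x ^ 2 / q) ≠ 0 := by rw [← z4, sub_ne_zero]; exact (hσ _).symm
  have hm5 : 1 - σ * x ^ 2 ≠ 0 := by rw [← z5, sub_ne_zero]; exact (hσ _).symm
  have hm6 : 1 - σ * (q * x ^ 2) ≠ 0 := by rw [← z6, sub_ne_zero]; exact (hσ _).symm
  have hm7 : 1 - σ * (q * x) ^ 2 ≠ 0 := by rw [← z7, sub_ne_zero]; exact (hσ _).symm
  have hQ1 : 1 - (q : ℂ) * t ≠ 0 := by
    rw [ht, ← pow_succ']; exact one_sub_q_pow_ne_zero hq₀ hq₁ i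
  have hQ2 : 1 - (q : ℂ) ^ 2 * t ≠ 0 := by
    rw [ht, ← pow_add, add_comm]; exact one_sub_q_pow_ne_zero hq₀ hq₁ (i + 1)
  have hq1 : 1 - (q : ℂ) ≠ 0 := by simpa using one_sub_q_pow_ne_zero hq₀ hq₁ 0
  -- the Pochhammer symbols in terms of the shortest ones
  have p1 : ∀ c : ℂ, zPoch q c (a - i) (i + 1) = zPoch q c (a - i) i * (1 - c * x) := by
    intro c; rw [zPoch_succ hq₀, show a - i + i = a by ring, ← hx]
  have p2 : ∀ c : ℂ, zPoch q c (a - i) (i + 2) =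
      zPoch q c (a - i) i * (1 - c * x) * (1 - c * (q * x)) := by
    intro c
    rw [zPoch_succ hq₀, p1, show a - i + ((i + 1 : ℕ) : ℤ) = a + 1 by push_cast; ring, z8]
  have p3 : ∀ c : ℂ, zPoch q c (a - i - 1) (i + 2) =
      (1 - c * (x / (q * t))) * (zPoch q c (a - i) i * (1 - c * x)) := by
    intro c
    rw [zPoch_succ' hq₀, show a - i - 1 + 1 = a - (i : ℤ) by ring, p1, z1]
  obtain ⟨S, hSd⟩ : ∃ S, S = zPoch q σ (2 * a - 1 - i) i := ⟨_, rfl⟩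
  rw [← hSd] at hS
  obtain ⟨m2, em2⟩ : ∃ m, m = 1 - σ * (x ^ 2 / (q * t)) := ⟨_, rfl⟩
  obtain ⟨m3, em3⟩ : ∃ m, m = 1 - σ * (x ^ 2 / t) := ⟨_, rfl⟩
  obtain ⟨m4, em4⟩ : ∃ m, m = 1 - σ * (x ^ 2 / q) := ⟨_, rfl⟩
  obtain ⟨m5, em5⟩ : ∃ m, m = 1 - σ * x ^ 2 := ⟨_, rfl⟩
  obtain ⟨m6, em6⟩ : ∃ m, m = 1 - σ * (q * x ^ 2) := ⟨_, rfl⟩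
  obtain ⟨m7, em7⟩ : ∃ m, m = 1 - σ * (q * x) ^ 2 := ⟨_, rfl⟩
  obtain ⟨Q1, eQ1⟩ : ∃ m, m = 1 - (q : ℂ) * t := ⟨_, rfl⟩
  obtain ⟨Q2, eQ2⟩ : ∃ m, m = 1 - (q : ℂ) ^ 2 * t := ⟨_, rfl⟩
  rw [← em2] at hm2
  rw [← em3] at hm3
  rw [← em4] at hm4
  rw [← em5] at hm5
  rw [← em6] at hm6
  rw [← em7] at hm7
  rw [← eQ1] at hQ1
  rw [← eQ2] at hQ2
  have r0 : zPoch q σ (2 * a - 1 - i) (i + 2) = S * m4 * m5 := by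
    rw [zPoch_succ hq₀, zPoch_succ hq₀, show 2 * a - 1 - i + (i : ℤ) = 2 * a - 1 by ring,
      show 2 * a - 1 - i + ((i + 1 : ℕ) : ℤ) = 2 * a by push_cast; ring, z4, z5, hSd, em4, em5]
  have r1 : zPoch q σ (2 * a - i) (i + 1) = S * m4 * m5 / m2 := by
    rw [eq_div_iff hm2, ← r0, zPoch_succ' hq₀ σ (2 * a - 1 - i) (i + 1), z2,
      show 2 * a - 1 - i + 1 = 2 * a - (i : ℤ) by ring, em2]
    ring
  have r2 : zPoch q σ (2 * a + 1 - i) (i + 2) = S * m4 * m5 * m6 * m7 / (m2 * m3) := by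
    have h := zPoch_succ' hq₀ σ (2 * a - i) (i + 2)
    rw [zPoch_succ hq₀, zPoch_succ hq₀, r1, show 2 * a - i + ((i + 1 : ℕ) : ℤ) = 2 * a + 1 by
      push_cast; ring, show 2 * a - i + ((i + 1 + 1 : ℕ) : ℤ) = 2 * a + 2 by push_cast; ring,
      z3, z6, z7, show 2 * a - (i : ℤ) + 1 = 2 * a + 1 - i by ring, ← em6, ← em7, ← em3] at h
    rw [← mul_right_inj' hm3, ← h]
    field_simp
  obtain ⟨Z, hZ⟩ : ∃ Z, Z = (q : ℂ) ^ ((a - i) * (i : ℤ)) := ⟨_, rfl⟩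
  have hZ0 : Z ≠ 0 := hZ ▸ zpow_ne_zero _ hq
  have hy : (q : ℂ) ^ (a - i) = x / t := by rw [zpow_sub₀ hq, hti, ← hx]
  obtain ⟨v, ev⟩ : ∃ v, v = x / t := ⟨_, rfl⟩
  have hv : v ≠ 0 := ev ▸ div_ne_zero hx0 ht0
  obtain ⟨y, ey⟩ : ∃ y, y = x / (q * t) := ⟨_, rfl⟩
  have w1 : (q : ℂ) ^ ((a - i) * ((i + 1 : ℕ) : ℤ)) = Z * v := by
    rw [show (a - i) * ((i + 1 : ℕ) : ℤ) = (a - i) * i + (a - i) by push_cast; ring,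
      zpow_add₀ hq, ← hZ, hy, ev]
  have w2 : (q : ℂ) ^ ((a - i) * ((i + 2 : ℕ) : ℤ)) = Z * v ^ 2 := by
    rw [show (a - i) * ((i + 2 : ℕ) : ℤ) = (a - i) * i + (a - i) + (a - i) by push_cast; ring,
      zpow_add₀ hq, zpow_add₀ hq, ← hZ, hy, ev]; ring
  have w3 : (q : ℂ) ^ ((a - i - 1) * ((i + 2 : ℕ) : ℤ)) = Z * v ^ 2 / (t * q ^ 2) := by
    rw [show (a - i - 1) * ((i + 2 : ℕ) : ℤ) = (a - i) * ((i + 2 : ℕ) : ℤ) - i - (2 : ℕ) by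
      push_cast; ring, zpow_sub₀ hq, zpow_sub₀ hq, w2, hti, zpow_natCast]
    field_simp
  obtain ⟨P1, hP1⟩ : ∃ P, P = zPoch q (-(s₀ * s₁)) (a - i) i := ⟨_, rfl⟩
  obtain ⟨P2, hP2⟩ : ∃ P, P = zPoch q (-(s₀ * s₂)) (a - i) i := ⟨_, rfl⟩
  obtain ⟨P3, hP3⟩ : ∃ P, P = zPoch q (-(s₀ * s₃)) (a - i) i := ⟨_, rfl⟩
  obtain ⟨Qi, hQi⟩ : ∃ Qi, Qi = qPoch q (q : ℂ) i := ⟨_, rfl⟩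
  rw [← hQi] at hQ
  have u1 : qPoch q (q : ℂ) (i + 1) = Qi * Q1 := by rw [qPoch_succ, ← hQi, ← ht, eQ1]
  have u2 : qPoch q (q : ℂ) (i + 2) = Qi * Q1 * Q2 := by
    rw [qPoch_succ, u1, pow_succ, ← ht, eQ2]; ring
  -- A common factor of the four terms; everything left after dividing by it is rational in x, t, q
  -- and the parameters.
  obtain ⟨B, hB⟩ : ∃ B, B = P1 * P2 * P3 * ((1 + s₀ * s₁ * x) * (1 + s₀ * s₂ * x) *
      (1 + s₀ * s₃ * x)) / (s₀ ^ (i + 2) * (Z * v ^ 2 * (Qi * Q1 * Q2 * (S * m4 * m5)))) :=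
    ⟨_, rfl⟩
  have A1 : racahCoeff q s₀ s₁ s₂ s₃ a (i + 2) = B * ((1 + s₀ * s₁ * y) *
      (1 + s₀ * s₂ * y) * (1 + s₀ * s₃ * y) * (t * q ^ 2)) := by
    rw [racahCoeff_eq, show a - ((i + 2 : ℕ) : ℤ) + 1 = a - i - 1 by push_cast; ring,
      show 2 * a - ((i + 2 : ℕ) : ℤ) + 1 = 2 * a - 1 - i by push_cast; ring, p3, p3, p3, r0, w3, u2,
      hB, ← hP1, ← hP2, ← hP3, ← ey]
    field_simp
    ring
  have A2 : racahCoeff q s₀ s₁ s₂ s₃ a (i + 1) = B * (s₀ * v * Q2 * m2) := by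
    rw [racahCoeff_eq, show a - ((i + 1 : ℕ) : ℤ) + 1 = a - i by push_cast; ring,
      show 2 * a - ((i + 1 : ℕ) : ℤ) + 1 = 2 * a - i by push_cast; ring, p1, p1, p1, r1, w1, u1,
      hB, ← hP1, ← hP2, ← hP3]
    field_simp
    ring
  have A3 : racahCoeff q s₀ s₁ s₂ s₃ (a + 1) (i + 2) = B * ((1 + s₀ * s₁ * (q * x)) *
      (1 + s₀ * s₂ * (q * x)) * (1 + s₀ * s₃ * (q * x)) * m2 * m3 / (m6 * m7)) := by
    rw [racahCoeff_eq, show a + 1 - ((i + 2 : ℕ) : ℤ) + 1 = a - i by push_cast; ring,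
      show 2 * (a + 1) - ((i + 2 : ℕ) : ℤ) + 1 = 2 * a + 1 - i by push_cast; ring, p2, p2, p2, r2,
      w2, u2, hB, ← hP1, ← hP2, ← hP3]
    field_simp
    ring
  -- The three factors multiplied in here belong to B but not to this coefficient. They are supplied
  -- by `recC`, so no division by possibly vanishing factors is needed.
  have A4 : racahCoeff q s₀ s₁ s₂ s₃ (a - 1) i * ((1 + s₀ * s₁ * x) * (1 + s₀ * s₂ * x) *
      (1 + s₀ * s₃ * x)) = B * ((s₀ * v) ^ 2 * Q1 * Q2 * m4 * m5) := by
    rw [racahCoeff_eq, show a - 1 - (i : ℤ) + 1 = a - i by ring,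
      show 2 * (a - 1) - (i : ℤ) + 1 = 2 * a - 1 - i by ring, ← hZ, ← hQi, ← hSd,
      ← hP1, ← hP2, ← hP3, hB, pow_add s₀ i 2]
    field_simp
  have hC : recC q s₀ s₁ s₂ s₃ a * racahCoeff q s₀ s₁ s₂ s₃ (a - 1) i =
      B * ((σ * x / q) * ((1 + s₁ * s₂ * x) * (1 + s₁ * s₃ * x) * (1 + s₂ * s₃ * x)) *
        (s₀ * v) ^ 2 * Q1 * Q2 / (m5 * m6)) := by
    have e : recC q s₀ s₁ s₂ s₃ a * racahCoeff q s₀ s₁ s₂ s₃ (a - 1) i =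
        (σ * x / q) * ((1 + s₁ * s₂ * x) * (1 + s₁ * s₃ * x) * (1 + s₂ * s₃ * x)) /
          (m4 * m5 ^ 2 * m6) *
          (racahCoeff q s₀ s₁ s₂ s₃ (a - 1) i * ((1 + s₀ * s₁ * x) * (1 + s₀ * s₂ * x) *
            (1 + s₀ * s₃ * x))) := by
      simp only [recC, ← hx, ← hσdef]
      rw [show σ * x ^ 2 / q = σ * (x ^ 2 / q) by ring,
        show σ * q * x ^ 2 = σ * (q * x ^ 2) by ring, ← em4, ← em5, ← em6]
      ring
    rw [e, A4]
    field_simp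
  have hnode : s₀⁻¹ * (q : ℂ) ^ ((i : ℤ) - a) * racahCoeff q s₀ s₁ s₂ s₃ a (i + 1) =
      B * (Q2 * m2) := by
    rw [← neg_sub, zpow_neg, hy, ← ev, A2]
    field_simp
  have hBr : recB q s₀ s₁ s₂ s₃ a = ((s₀ + (s₁ + s₂ + s₃) + (s₀ * (s₁ * s₂ + s₁ * s₃ + s₂ * s₃) +
      s₁ * s₂ * s₃) * x) / m5 - (s₀ + (s₁ + s₂ + s₃) + (s₀ * (s₁ * s₂ + s₁ * s₃ +
        s₂ * s₃) + s₁ * s₂ * s₃) * (q * x)) / m7) / (1 - q) := by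
    simp only [recB, ← hx, ← hσdef]
    rw [em5, em7]
    congr 2
    · congr 1; ring
    · congr 1; ring
  have hid := recurrence_identity s₀ (s₁ + s₂ + s₃) (s₁ * s₂ + s₁ * s₃ + s₂ * s₃) (s₁ * s₂ * s₃)
    x t q ht0 hq hq1 (by rw [em5] at hm5; convert hm5 using 2; rw [hσdef]; ring)
    (by rw [em6] at hm6; convert hm6 using 2; rw [hσdef]; ring)
    (by rw [em7] at hm7; convert hm7 using 2; rw [hσdef]; ring)
  rw [show s₀ * (s₁ * s₂ * s₃) = σ by rw [hσdef]; ring,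
    show σ * x ^ 2 / (q * t) = σ * (x ^ 2 / (q * t)) by ring,
    show σ * x ^ 2 / t = σ * (x ^ 2 / t) by ring,
    show σ * q * x ^ 2 = σ * (q * x ^ 2) by ring, ← em2, ← em3, ← em5, ← em6, ← em7, ← eQ1, ← eQ2,
    ← ev, ← ey] at hid
  rw [A1, hnode, A3, hC, A2, hBr]
  linear_combination B * hid

lemma racahCoeff_one_sub (hq₀ : 0 < q) (hq₁ : q < 1) (hs₀ : s₀ ≠ 0)
    (hσ : ∀ k : ℤ, s₀ * s₁ * s₂ * s₃ * (q : ℂ) ^ k ≠ 1) (a : ℤ) :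
    racahCoeff q s₀ s₁ s₂ s₃ a 1 + s₀⁻¹ * (q : ℂ) ^ (-1 - a) =
      racahCoeff q s₀ s₁ s₂ s₃ (a + 1) 1 + recB q s₀ s₁ s₂ s₃ a := by
  have hq := q_ne_zero hq₀
  obtain ⟨x, hx⟩ : ∃ x, x = (q : ℂ) ^ a := ⟨_, rfl⟩
  have hx0 : x ≠ 0 := hx ▸ zpow_ne_zero _ hq
  have hq1 : 1 - (q : ℂ) ≠ 0 := by simpa using one_sub_q_pow_ne_zero hq₀ hq₁ 0
  have z5 : (q : ℂ) ^ (2 * a) = x ^ 2 := by rw [two_mul, zpow_add₀ hq, ← hx]; ring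
  have z7 : (q : ℂ) ^ (2 * a + 2) = (q * x) ^ 2 := by
    rw [zpow_add₀ hq, z5, zpow_ofNat]; ring
  have z8 : (q : ℂ) ^ (a + 1) = q * x := by rw [zpow_add_one₀ hq, ← hx]; ring
  have z9 : (q : ℂ) ^ (-1 - a) = (q * x)⁻¹ := by rw [← z8, ← zpow_neg]; congr 1; ring
  have hm5 : 1 - s₀ * s₁ * s₂ * s₃ * x ^ 2 ≠ 0 := by rw [← z5, sub_ne_zero]; exact (hσ _).symm
  have hm7 : 1 - s₀ * s₁ * s₂ * s₃ * (q * x) ^ 2 ≠ 0 := by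
    rw [← z7, sub_ne_zero]; exact (hσ _).symm
  have e : ∀ b : ℤ, racahCoeff q s₀ s₁ s₂ s₃ b 1 = (1 + s₀ * s₁ * (q : ℂ) ^ b) *
      (1 + s₀ * s₂ * (q : ℂ) ^ b) * (1 + s₀ * s₃ * (q : ℂ) ^ b) / (s₀ * ((q : ℂ) ^ b * ((1 - q) *
        (1 - s₀ * s₁ * s₂ * s₃ * (q : ℂ) ^ (2 * b))))) := by
    intro b
    simp only [racahCoeff, qPoch, Finset.prod_range_one, pow_zero, mul_one, Nat.cast_one, pow_one]
    rw [show b - 1 + 1 = b by ring, show 2 * b - 1 + 1 = 2 * b by ring]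
    ring
  rw [e, e, z8, show 2 * (a + 1) = 2 * a + 2 by ring, z5, z7, z9]
  simp only [recB, ← hx]
  obtain ⟨D1, hD1⟩ : ∃ D, D = 1 - s₀ * s₁ * s₂ * s₃ * x ^ 2 := ⟨_, rfl⟩
  obtain ⟨D3, hD3⟩ : ∃ D, D = 1 - s₀ * s₁ * s₂ * s₃ * (q * x) ^ 2 := ⟨_, rfl⟩
  obtain ⟨Q, hQ⟩ : ∃ D, D = 1 - (q : ℂ) := ⟨_, rfl⟩
  rw [← hD1] at hm5 ⊢
  rw [← hD3] at hm7 ⊢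
  rw [← hQ] at hq1 ⊢
  field_simp
  rw [hD1, hD3, hQ]
  ring

end Recurrence

/-! ### Symmetry in the parameters -/

section Symmetry

variable {q : ℝ} {s₀ s₁ s₂ s₃ : ℂ}

/-- Raising b by one multiplies G_b by a linear factor, so all terms of the recurrence can be
expanded in the single family w^d G_{a+1-d}. -/
lemma coeff_X_pow_mul_nodeSeries (hq₀ : 0 < q) (hq₁ : q < 1) (a : ℤ) (r d : ℕ) :
    PowerSeries.coeff r (PowerSeries.X ^ d * nodeSeries q s₀ (a - d)) =
      PowerSeries.coeff r (PowerSeries.X ^ d * nodeSeries q s₀ (a + 1 - d)) +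
      s₀⁻¹ * (q : ℂ) ^ ((d : ℤ) - 1 - a) * PowerSeries.coeff r
        (PowerSeries.X ^ (d + 1) * nodeSeries q s₀ (a + 1 - ((d + 1 : ℕ) : ℤ))) := by
  have h := nodeSeries_add_one hq₀ hq₁ s₀ (a - d)
  have e : nodeSeries q s₀ (a - d) = nodeSeries q s₀ (a + 1 - d) +
      PowerSeries.C (s₀⁻¹ * (q : ℂ) ^ ((d : ℤ) - 1 - a)) *
        (PowerSeries.X * nodeSeries q s₀ (a - d)) := by
    rw [show a + 1 - (d : ℤ) = a - d + 1 by ring, h, lin,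
      show -(a - (d : ℤ)) - 1 = (d : ℤ) - 1 - a by ring]
    ring
  conv_lhs => rw [e]
  rw [mul_add, map_add, mul_left_comm, PowerSeries.coeff_C_mul, ← mul_assoc _ PowerSeries.X,
    ← pow_succ, show a + 1 - ((d + 1 : ℕ) : ℤ) = a - d by push_cast; ring]

lemma coeff_X_pow_mul_racahSeries (a : ℤ) (r m j : ℕ) (h : r < m + j) :
    PowerSeries.coeff r (PowerSeries.X ^ j * racahSeries q s₀ s₁ s₂ s₃ a) =
      ∑ d ∈ Finset.range m, racahCoeff q s₀ s₁ s₂ s₃ a d *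
        PowerSeries.coeff r (PowerSeries.X ^ (d + j) * nodeSeries q s₀ (a - d)) := by
  rw [PowerSeries.coeff_X_pow_mul']
  split_ifs with hj
  · rw [coeff_racahSeries q s₀ s₁ s₂ s₃ a (show r - j < m by omega), map_sum]
    refine Finset.sum_congr rfl fun d _ => ?_
    rw [PowerSeries.coeff_C_mul, add_comm d j, pow_add, mul_assoc, PowerSeries.coeff_X_pow_mul' _ j,
      if_pos hj]
  · refine (Finset.sum_eq_zero fun d _ => ?_).symm
    rw [PowerSeries.coeff_X_pow_mul', if_neg (by omega), mul_zero]

theorem racahSeries_recurrence (hq₀ : 0 < q) (hq₁ : q < 1) (hs₀ : s₀ ≠ 0)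
    (hσ : ∀ k : ℤ, s₀ * s₁ * s₂ * s₃ * (q : ℂ) ^ k ≠ 1) (a : ℤ) :
    racahSeries q s₀ s₁ s₂ s₃ a = racahSeries q s₀ s₁ s₂ s₃ (a + 1) +
      PowerSeries.C (recB q s₀ s₁ s₂ s₃ a) * (PowerSeries.X * racahSeries q s₀ s₁ s₂ s₃ a) +
      PowerSeries.C (recC q s₀ s₁ s₂ s₃ a) *
        (PowerSeries.X ^ 2 * racahSeries q s₀ s₁ s₂ s₃ (a - 1)) := by
  ext r
  have h0 := coeff_X_pow_mul_racahSeries (q := q) (s₀ := s₀) (s₁ := s₁) (s₂ := s₂) (s₃ := s₃)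
    a r (r + 2) 0 (by omega)
  have h1 := coeff_X_pow_mul_racahSeries (q := q) (s₀ := s₀) (s₁ := s₁) (s₂ := s₂) (s₃ := s₃)
    (a + 1) r (r + 2) 0 (by omega)
  have h2 := coeff_X_pow_mul_racahSeries (q := q) (s₀ := s₀) (s₁ := s₁) (s₂ := s₂) (s₃ := s₃)
    a r (r + 1) 1 (by omega)
  have h3 := coeff_X_pow_mul_racahSeries (q := q) (s₀ := s₀) (s₁ := s₁) (s₂ := s₂) (s₃ := s₃)
    (a - 1) r r 2 (by omega)
  obtain ⟨τ, hτ⟩ : ∃ τ : ℕ → ℂ, τ = fun d : ℕ => PowerSeries.coeff r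
    (PowerSeries.X ^ d * nodeSeries q s₀ (a + 1 - d)) := ⟨_, rfl⟩
  have t0 : ∀ d : ℕ, PowerSeries.coeff r (PowerSeries.X ^ d * nodeSeries q s₀ (a - d)) =
      τ d + s₀⁻¹ * (q : ℂ) ^ ((d : ℤ) - 1 - a) * τ (d + 1) := by
    intro d
    rw [coeff_X_pow_mul_nodeSeries hq₀ hq₁, hτ]
  have t1 : ∀ d : ℕ, PowerSeries.coeff r (PowerSeries.X ^ d * nodeSeries q s₀ (a + 1 - d)) =
      τ d := fun d => by rw [hτ]
  have t2 : ∀ d : ℕ, PowerSeries.coeff r (PowerSeries.X ^ (d + 1) * nodeSeries q s₀ (a - d)) =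
      τ (d + 1) := fun d => by
    rw [hτ]; simp only; rw [show a + 1 - ((d + 1 : ℕ) : ℤ) = a - d by push_cast; ring]
  have t3 : ∀ d : ℕ, PowerSeries.coeff r (PowerSeries.X ^ (d + 2) * nodeSeries q s₀ (a - 1 - d)) =
      τ (d + 2) := fun d => by
    rw [hτ]; simp only; rw [show a + 1 - ((d + 2 : ℕ) : ℤ) = a - 1 - d by push_cast; ring]
  -- The last boundary term starts beyond degree r.
  have tz : τ (r + 2) = 0 := by
    rw [hτ]; simp only
    rw [PowerSeries.coeff_X_pow_mul', if_neg (by omega)]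
  simp only [add_zero, t0, t1, t2, t3, pow_zero, one_mul, pow_one] at h0 h1 h2 h3
  rw [map_add, map_add, PowerSeries.coeff_C_mul, PowerSeries.coeff_C_mul, h0, h1, h2, h3]
  simp only [mul_add]
  rw [Finset.sum_add_distrib,
    Finset.sum_range_succ (fun d => racahCoeff q s₀ s₁ s₂ s₃ a d * (_ * τ (d + 1))) (r + 1)]
  rw [tz, mul_zero, mul_zero, add_zero,
    Finset.sum_range_succ' (fun d => racahCoeff q s₀ s₁ s₂ s₃ a d * τ d) (r + 1),
    Finset.sum_range_succ' (fun d => racahCoeff q s₀ s₁ s₂ s₃ a (d + 1) * τ (d + 1)) r,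
    Finset.sum_range_succ' (fun d => racahCoeff q s₀ s₁ s₂ s₃ a d * (_ * τ (d + 1))) r,
    Finset.sum_range_succ' (fun d => racahCoeff q s₀ s₁ s₂ s₃ (a + 1) d * τ d) (r + 1),
    Finset.sum_range_succ' (fun d => racahCoeff q s₀ s₁ s₂ s₃ (a + 1) (d + 1) * τ (d + 1)) r,
    Finset.sum_range_succ' (fun d => racahCoeff q s₀ s₁ s₂ s₃ a d * τ (d + 1)) r]
  simp only [racahCoeff_zero]
  have k1 := racahCoeff_one_sub (s₁ := s₁) (s₂ := s₂) (s₃ := s₃) hq₀ hq₁ hs₀ hσ a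
  -- The part with d ≥ 2; d = 1 is `racahCoeff_one_sub` and d = 0 reduces to 1 = 1.
  have k2 : ∑ i ∈ Finset.range r, racahCoeff q s₀ s₁ s₂ s₃ a (i + 1 + 1) * τ (i + 1 + 1) +
      ∑ i ∈ Finset.range r, racahCoeff q s₀ s₁ s₂ s₃ a (i + 1) *
        (s₀⁻¹ * (q : ℂ) ^ (((i + 1 : ℕ) : ℤ) - 1 - a) * τ (i + 1 + 1)) =
      ∑ i ∈ Finset.range r, racahCoeff q s₀ s₁ s₂ s₃ (a + 1) (i + 1 + 1) * τ (i + 1 + 1) +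
      recB q s₀ s₁ s₂ s₃ a * ∑ i ∈ Finset.range r, racahCoeff q s₀ s₁ s₂ s₃ a (i + 1) *
        τ (i + 1 + 1) +
      recC q s₀ s₁ s₂ s₃ a * ∑ i ∈ Finset.range r, racahCoeff q s₀ s₁ s₂ s₃ (a - 1) i *
        τ (i + 2) := by
    rw [Finset.mul_sum, Finset.mul_sum, ← Finset.sum_add_distrib, ← Finset.sum_add_distrib,
      ← Finset.sum_add_distrib]
    refine Finset.sum_congr rfl fun i _ => ?_
    have := racahCoeff_recurrence (s₁ := s₁) (s₂ := s₂) (s₃ := s₃) hq₀ hq₁ hs₀ hσ a i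
    rw [show ((i + 1 : ℕ) : ℤ) - 1 - a = (i : ℤ) - a by push_cast; ring]
    linear_combination τ (i + 2) * this
  have e1 : ((0 : ℕ) : ℤ) - 1 - a = -1 - a := by simp
  rw [e1]
  linear_combination k2 + τ (0 + 1) * k1

lemma tendsto_coeff_pochInf {ι : Type*} {l : Filter ι} {c : ι → ℂ} {c₀ : ℂ}
    (h : Tendsto c l (𝓝 c₀)) (n : ℕ) :
    Tendsto (fun i => PowerSeries.coeff n (pochInf q (c i))) l
      (𝓝 (PowerSeries.coeff n (pochInf q c₀))) := by
  simp only [pochInf, PowerSeries.coeff_mk]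
  exact tendsto_finsetProd _ fun k _ => ((h.mul_const _).neg).div_const _

lemma pochInf_zero : pochInf q 0 = 1 := by
  ext n
  rw [pochInf, PowerSeries.coeff_mk, PowerSeries.coeff_one]
  split_ifs with h
  · simp [h]
  · exact Finset.prod_eq_zero (Finset.mem_range.mpr (Nat.pos_of_ne_zero h)) (by simp)

/-- The substitution w ↦ qw multiplies the coefficient of degree n+1 by q^{n+1} ≠ 1. This is the
uniqueness principle behind all identities between infinite products here. -/
lemma eq_one_of_rescale_eq (hq₀ : 0 < q) (hq₁ : q < 1) {V : PowerSeries ℂ}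
    (h : PowerSeries.rescale (q : ℂ) V = V) (h1 : PowerSeries.constantCoeff V = 1) : V = 1 := by
  ext n
  cases n with
  | zero => simpa using h1
  | succ n =>
    have := congrArg (PowerSeries.coeff (n + 1)) h
    rw [PowerSeries.coeff_rescale] at this
    rw [PowerSeries.coeff_one, if_neg n.succ_ne_zero]
    refine (mul_eq_zero.mp ?_).resolve_left (one_sub_q_pow_ne_zero hq₀ hq₁ n)
    linear_combination -this

/-- Euler's identity for 1/(cw;q)_∞: under w ↦ qw the sum gains the factor 1 - cw that the product
loses. -/
lemma mk_mul_pochInf (hq₀ : 0 < q) (hq₁ : q < 1) (c : ℂ) :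
    (PowerSeries.mk fun n => c ^ n / qPoch q (q : ℂ) n) * pochInf q c = 1 := by
  refine eq_one_of_rescale_eq hq₀ hq₁ ?_ ?_
  · have : PowerSeries.rescale (q : ℂ) (PowerSeries.mk fun n => c ^ n / qPoch q (q : ℂ) n) =
        lin c * PowerSeries.mk fun n => c ^ n / qPoch q (q : ℂ) n := by
      ext n
      cases n with
      | zero => rw [coeff_zero_lin_mul]; simp
      | succ n =>
        rw [coeff_succ_lin_mul, PowerSeries.coeff_rescale, PowerSeries.coeff_mk,
          PowerSeries.coeff_mk, qPoch_succ, ← pow_succ']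
        have h1 := one_sub_q_pow_ne_zero hq₀ hq₁ n
        have h2 := qPoch_self_ne_zero hq₀ hq₁ n
        field_simp
        ring
    rw [map_mul, this, rescale_pochInf, pochInf_eq hq₀ hq₁ c]
    ring
  · rw [map_mul, constantCoeff_pochInf, ← PowerSeries.coeff_zero_eq_constantCoeff_apply]
    simp [qPoch]

lemma prod_zpow_symm (hq₀ : 0 < q) (d : ℕ) :
    ∏ j ∈ Finset.range d, (q : ℂ) ^ (1 - (d : ℤ) + 2 * j) = 1 := by
  have hq := q_ne_zero hq₀
  have : ∀ (m : ℕ) (c : ℤ), ∏ j ∈ Finset.range m, (q : ℂ) ^ (c + 2 * (j : ℤ)) =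
      (q : ℂ) ^ ((m : ℤ) * (c + m - 1)) := by
    intro m c
    induction m with
    | zero => simp
    | succ m ih =>
      rw [Finset.prod_range_succ, ih, ← zpow_add₀ hq]
      congr 1; push_cast; ring
  rw [this, show (d : ℤ) * (1 - d + d - 1) = 0 by ring, zpow_zero]

/-- In each of the d slots the three numerator factors grow as q^{-3k}, balanced by q^{-k} from the
explicit power and q^{-2k} from the last Pochhammer symbol. The limiting ratios are -s₀ q^{1-d+2j},
and the powers of q cancel in the product over j. -/
lemma tendsto_racahCoeff (hq₀ : 0 < q) (hq₁ : q < 1) (hs₀ : s₀ ≠ 0) (hs₁ : s₁ ≠ 0) (hs₂ : s₂ ≠ 0)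
    (hs₃ : s₃ ≠ 0) (d : ℕ) :
    Tendsto (fun k : ℕ => racahCoeff q s₀ s₁ s₂ s₃ (-(k : ℤ)) d) atTop
      (𝓝 ((-s₀) ^ d / qPoch q (q : ℂ) d)) := by
  have hq := q_ne_zero hq₀
  have hu := tendsto_q_pow hq₀ hq₁
  have key : ∀ k : ℕ, racahCoeff q s₀ s₁ s₂ s₃ (-(k : ℤ)) d =
      (∏ j ∈ Finset.range d, (((q : ℂ) ^ k + s₀ * s₁ * (q : ℂ) ^ (1 - (d : ℤ) + j)) *
        ((q : ℂ) ^ k + s₀ * s₂ * (q : ℂ) ^ (1 - (d : ℤ) + j)) *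
        ((q : ℂ) ^ k + s₀ * s₃ * (q : ℂ) ^ (1 - (d : ℤ) + j)) /
        (s₀ * (q : ℂ) ^ (1 - (d : ℤ)) * (((q : ℂ) ^ k) ^ 2 -
          s₀ * s₁ * s₂ * s₃ * (q : ℂ) ^ (1 - (d : ℤ) + j))))) / qPoch q (q : ℂ) d := by
    intro k
    have hk : ((q : ℂ) ^ k) ≠ 0 := pow_ne_zero _ hq
    have e1 : ∀ (c : ℂ) (j : ℕ), 1 - -(c * (q : ℂ) ^ (-(k : ℤ) - d + 1)) * (q : ℂ) ^ j =
        ((q : ℂ) ^ k)⁻¹ * ((q : ℂ) ^ k + c * (q : ℂ) ^ (1 - (d : ℤ) + j)) := by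
      intro c j
      rw [show -(k : ℤ) - d + 1 = -(k : ℤ) + (1 - d) by ring, zpow_add₀ hq, zpow_add₀ hq _ (j : ℤ),
        zpow_neg, zpow_natCast, zpow_natCast]
      field_simp
      ring
    have e2 : ∀ (c : ℂ) (j : ℕ), 1 - c * (q : ℂ) ^ (2 * -(k : ℤ) - d + 1) * (q : ℂ) ^ j =
        (((q : ℂ) ^ k) ^ 2)⁻¹ * (((q : ℂ) ^ k) ^ 2 - c * (q : ℂ) ^ (1 - (d : ℤ) + j)) := by
      intro c j
      rw [show 2 * -(k : ℤ) - d + 1 = -(k : ℤ) + -(k : ℤ) + (1 - d) by ring, zpow_add₀ hq,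
        zpow_add₀ hq, zpow_add₀ hq _ (j : ℤ), zpow_neg, zpow_natCast, zpow_natCast]
      field_simp
    have e3 : (q : ℂ) ^ ((-(k : ℤ) - d + 1) * d) =
        ∏ j ∈ Finset.range d, (((q : ℂ) ^ k)⁻¹ * (q : ℂ) ^ (1 - (d : ℤ))) := by
      rw [Finset.prod_const, Finset.card_range, zpow_mul, zpow_natCast,
        show -(k : ℤ) - d + 1 = -(k : ℤ) + (1 - d) by ring, zpow_add₀ hq, zpow_neg, zpow_natCast]
    have e4 : s₀ ^ d = ∏ j ∈ Finset.range d, s₀ := by simp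
    rw [racahCoeff, e3, e4]
    simp only [qPoch, e1, e2]
    rw [show ∀ a b c e : ℂ, a * (b * (c * e)) = (a * (b * e)) * c by intros; ring, ← div_div]
    rw [← Finset.prod_mul_distrib, ← Finset.prod_mul_distrib, ← Finset.prod_mul_distrib,
      ← Finset.prod_mul_distrib, ← Finset.prod_div_distrib]
    congr 1
    refine Finset.prod_congr rfl fun j _ => ?_
    field_simp
  simp only [key]
  refine Tendsto.div_const ?_ _
  have hlim : ∏ j ∈ Finset.range d, ((0 + s₀ * s₁ * (q : ℂ) ^ (1 - (d : ℤ) + j)) *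
        (0 + s₀ * s₂ * (q : ℂ) ^ (1 - (d : ℤ) + j)) *
        (0 + s₀ * s₃ * (q : ℂ) ^ (1 - (d : ℤ) + j)) /
        (s₀ * (q : ℂ) ^ (1 - (d : ℤ)) * (0 ^ 2 -
          s₀ * s₁ * s₂ * s₃ * (q : ℂ) ^ (1 - (d : ℤ) + j)))) = (-s₀) ^ d := by
    rw [← mul_one ((-s₀) ^ d), ← prod_zpow_symm hq₀ d]
    rw [show (-s₀) ^ d = ∏ _j ∈ Finset.range d, (-s₀) by simp, ← Finset.prod_mul_distrib]
    refine Finset.prod_congr rfl fun j _ => ?_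
    rw [show 1 - (d : ℤ) + 2 * j = 1 - d + j + (j : ℤ) by ring, zpow_add₀ hq (1 - (d : ℤ) + j),
      zpow_add₀ hq _ (j : ℤ)]
    have := zpow_ne_zero (1 - (d : ℤ)) hq
    have := zpow_ne_zero (j : ℤ) hq
    field_simp
    ring
  rw [← hlim]
  refine tendsto_finsetProd _ fun j _ => ?_
  refine Tendsto.div (((hu.add_const _).mul (hu.add_const _)).mul (hu.add_const _))
    (((hu.pow 2).sub_const _).const_mul _) ?_
  have h1 : ∀ m : ℤ, (q : ℂ) ^ m ≠ 0 := fun m => zpow_ne_zero m hq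
  simp [hs₀, hs₁, hs₂, hs₃, h1]

/-- As a → -∞ the second factor of each G_{a-d} tends to 1, and the coefficients tend to those of
1/(-s₀w;q)_∞, cancelling the first factor. The limit 1 no longer depends on the parameters. -/
lemma tendsto_coeff_racahSeries (hq₀ : 0 < q) (hq₁ : q < 1) (hs₀ : s₀ ≠ 0) (hs₁ : s₁ ≠ 0)
    (hs₂ : s₂ ≠ 0) (hs₃ : s₃ ≠ 0) (n : ℕ) :
    Tendsto (fun k : ℕ => PowerSeries.coeff n (racahSeries q s₀ s₁ s₂ s₃ (-(k : ℤ)))) atTop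
      (𝓝 (PowerSeries.coeff n 1)) := by
  rw [← mk_mul_pochInf hq₀ hq₁ (-s₀), PowerSeries.coeff_mul,
    Finset.Nat.sum_antidiagonal_eq_sum_range_succ_mk]
  simp only [racahSeries, PowerSeries.coeff_mk]
  refine tendsto_finsetSum _ fun d _ => ?_
  refine (tendsto_racahCoeff hq₀ hq₁ hs₀ hs₁ hs₂ hs₃ d).mul ?_
  have h1 : ∀ m : ℕ, Tendsto (fun k : ℕ => PowerSeries.coeff m
      (pochInf q (s₀⁻¹ * (q : ℂ) ^ (-(-(k : ℤ) - d))))) atTop (𝓝 (PowerSeries.coeff m 1)) := by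
    intro m
    rw [← pochInf_zero (q := q)]
    refine tendsto_coeff_pochInf ?_ m
    have := ((tendsto_q_pow hq₀ hq₁).mul_const ((q : ℂ) ^ d)).const_mul s₀⁻¹
    rw [zero_mul, mul_zero] at this
    refine this.congr fun k => ?_
    rw [show -(-(k : ℤ) - d) = ((k + d : ℕ) : ℤ) by push_cast; ring, zpow_natCast, pow_add]
  have h2 : PowerSeries.coeff (n - d) (pochInf q (-s₀)) =
      PowerSeries.coeff (n - d) (pochInf q (-s₀) * 1) := by rw [mul_one]
  rw [h2]
  simp only [nodeSeries, PowerSeries.coeff_mul _ (pochInf q (-s₀))]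
  exact tendsto_finsetSum _ fun p _ => (h1 p.2).const_mul _

/-- If the lower coefficients agree, the recurrence makes the difference of the n-th coefficients
independent of a; letting a → -∞ shows that it is zero. -/
lemma eq_of_recurrence {F G : ℤ → PowerSeries ℂ} {β γ : ℤ → ℂ} {l : PowerSeries ℂ}
    (hF : ∀ a, F a = F (a + 1) + PowerSeries.C (β a) * (PowerSeries.X * F a) +
      PowerSeries.C (γ a) * (PowerSeries.X ^ 2 * F (a - 1)))
    (hG : ∀ a, G a = G (a + 1) + PowerSeries.C (β a) * (PowerSeries.X * G a) +
      PowerSeries.C (γ a) * (PowerSeries.X ^ 2 * G (a - 1)))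
    (hFl : ∀ n, Tendsto (fun k : ℕ => PowerSeries.coeff n (F (-(k : ℤ)))) atTop
      (𝓝 (PowerSeries.coeff n l)))
    (hGl : ∀ n, Tendsto (fun k : ℕ => PowerSeries.coeff n (G (-(k : ℤ)))) atTop
      (𝓝 (PowerSeries.coeff n l))) (a : ℤ) : F a = G a := by
  ext n
  induction n using Nat.strong_induction_on generalizing a with
  | _ n ih =>
    have hstep : ∀ b : ℤ, PowerSeries.coeff n (F (b + 1)) - PowerSeries.coeff n (G (b + 1)) =
        PowerSeries.coeff n (F b) - PowerSeries.coeff n (G b) := by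
      intro b
      have h1 := congrArg (PowerSeries.coeff n) (hF b)
      have h2 := congrArg (PowerSeries.coeff n) (hG b)
      have hX : ∀ f : PowerSeries ℂ, PowerSeries.coeff n (PowerSeries.X * f) =
          if 1 ≤ n then PowerSeries.coeff (n - 1) f else 0 := fun f => by
        rw [← PowerSeries.coeff_X_pow_mul', pow_one]
      rw [map_add, map_add, PowerSeries.coeff_C_mul, PowerSeries.coeff_C_mul, hX,
        PowerSeries.coeff_X_pow_mul'] at h1 h2
      have e1 : (if 1 ≤ n then PowerSeries.coeff (n - 1) (F b) else 0) =
          if 1 ≤ n then PowerSeries.coeff (n - 1) (G b) else 0 := by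
        split_ifs with h
        · exact ih _ (by omega) b
        · rfl
      have e2 : (if 2 ≤ n then PowerSeries.coeff (n - 2) (F (b - 1)) else 0) =
          if 2 ≤ n then PowerSeries.coeff (n - 2) (G (b - 1)) else 0 := by
        split_ifs with h
        · exact ih _ (by omega) _
        · rfl
      rw [e1, e2] at h1
      linear_combination h2 - h1
    have hconst : ∀ (b : ℤ) (k : ℕ), PowerSeries.coeff n (F (b + k)) -
        PowerSeries.coeff n (G (b + k)) = PowerSeries.coeff n (F b) - PowerSeries.coeff n (G b) := by
      intro b k
      induction k with
      | zero => simp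
      | succ k ihk => rw [← ihk, ← hstep (b + k)]; push_cast; rw [add_assoc]
    have hcst : ∀ b c : ℤ, PowerSeries.coeff n (F b) - PowerSeries.coeff n (G b) =
        PowerSeries.coeff n (F c) - PowerSeries.coeff n (G c) := by
      intro b c
      rcases le_total b c with h | h
      · obtain ⟨k, rfl⟩ := Int.le.dest h
        exact (hconst b k).symm
      · obtain ⟨k, rfl⟩ := Int.le.dest h
        exact hconst c k
    have hl := (hFl n).sub (hGl n)
    rw [sub_self] at hl
    have hl2 := hl.congr fun k : ℕ => hcst (-(k : ℤ)) a
    exact sub_eq_zero.mp (tendsto_const_nhds_iff.mp hl2)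

/-- Both families solve the same recurrence with the same limit at -∞. The exchange of s₀ and s₁
serves reality, the exchange of s₀ and s₂ the summation of the series against the grid. -/
lemma racahSeries_swap (hq₀ : 0 < q) (hq₁ : q < 1) {t₀ t₁ t₂ t₃ : ℂ} (hs₀ : s₀ ≠ 0) (hs₁ : s₁ ≠ 0)
    (hs₂ : s₂ ≠ 0) (hs₃ : s₃ ≠ 0) (ht₀ : t₀ ≠ 0) (ht₁ : t₁ ≠ 0) (ht₂ : t₂ ≠ 0) (ht₃ : t₃ ≠ 0)
    (hσ : ∀ k : ℤ, s₀ * s₁ * s₂ * s₃ * (q : ℂ) ^ k ≠ 1)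
    (hτ : t₀ * t₁ * t₂ * t₃ = s₀ * s₁ * s₂ * s₃)
    (hB : recB q t₀ t₁ t₂ t₃ = recB q s₀ s₁ s₂ s₃) (hC : recC q t₀ t₁ t₂ t₃ = recC q s₀ s₁ s₂ s₃)
    (a : ℤ) : racahSeries q t₀ t₁ t₂ t₃ a = racahSeries q s₀ s₁ s₂ s₃ a := by
  refine eq_of_recurrence (F := racahSeries q t₀ t₁ t₂ t₃) (G := racahSeries q s₀ s₁ s₂ s₃)
    (β := recB q s₀ s₁ s₂ s₃) (γ := recC q s₀ s₁ s₂ s₃) (l := 1) ?_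
    (racahSeries_recurrence hq₀ hq₁ hs₀ hσ)
    (tendsto_coeff_racahSeries hq₀ hq₁ ht₀ ht₁ ht₂ ht₃)
    (tendsto_coeff_racahSeries hq₀ hq₁ hs₀ hs₁ hs₂ hs₃) a
  rw [← hB, ← hC]
  exact racahSeries_recurrence hq₀ hq₁ ht₀ (by rwa [hτ])

lemma racahSeries_swap₀₁ (hq₀ : 0 < q) (hq₁ : q < 1) (hs₀ : s₀ ≠ 0) (hs₁ : s₁ ≠ 0)
    (hs₂ : s₂ ≠ 0) (hs₃ : s₃ ≠ 0) (hσ : ∀ k : ℤ, s₀ * s₁ * s₂ * s₃ * (q : ℂ) ^ k ≠ 1) (a : ℤ) :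
    racahSeries q s₁ s₀ s₂ s₃ a = racahSeries q s₀ s₁ s₂ s₃ a := by
  refine racahSeries_swap hq₀ hq₁ hs₀ hs₁ hs₂ hs₃ hs₁ hs₀ hs₂ hs₃ hσ (by ring) ?_ ?_ a
  · funext b; simp only [recB]; ring
  · funext b; simp only [recC]; rw [mul_comm s₁ s₀]; ring

lemma racahSeries_swap₀₂ (hq₀ : 0 < q) (hq₁ : q < 1) (hs₀ : s₀ ≠ 0) (hs₁ : s₁ ≠ 0)
    (hs₂ : s₂ ≠ 0) (hs₃ : s₃ ≠ 0) (hσ : ∀ k : ℤ, s₀ * s₁ * s₂ * s₃ * (q : ℂ) ^ k ≠ 1) (a : ℤ) :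
    racahSeries q s₂ s₁ s₀ s₃ a = racahSeries q s₀ s₁ s₂ s₃ a := by
  refine racahSeries_swap hq₀ hq₁ hs₀ hs₁ hs₂ hs₃ hs₂ hs₁ hs₀ hs₃ hσ (by ring) ?_ ?_ a
  · funext b; simp only [recB]; ring
  · funext b; simp only [recC]; rw [show s₂ * s₁ * s₀ = s₀ * s₁ * s₂ by ring]; ring

lemma conj_qPoch (x : ℂ) (n : ℕ) :
    starRingEnd ℂ (qPoch q x n) = qPoch q (starRingEnd ℂ x) n := by
  simp [qPoch, map_prod]

lemma conj_racahCoeff (a : ℤ) (d : ℕ) : starRingEnd ℂ (racahCoeff q s₀ s₁ s₂ s₃ a d) =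
    racahCoeff q (starRingEnd ℂ s₀) (starRingEnd ℂ s₁) (starRingEnd ℂ s₂) (starRingEnd ℂ s₃) a d := by
  simp only [racahCoeff, map_div₀, map_mul, conj_qPoch, map_neg, map_pow, map_zpow₀,
    Complex.conj_ofReal]

lemma conj_coeff_pochInf (c : ℂ) (n : ℕ) : starRingEnd ℂ (PowerSeries.coeff n (pochInf q c)) =
    PowerSeries.coeff n (pochInf q (starRingEnd ℂ c)) := by
  simp [pochInf, map_prod]

lemma conj_coeff_racahSeries (a : ℤ) (n : ℕ) :
    starRingEnd ℂ (PowerSeries.coeff n (racahSeries q s₀ s₁ s₂ s₃ a)) = PowerSeries.coeff n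
      (racahSeries q (starRingEnd ℂ s₀) (starRingEnd ℂ s₁) (starRingEnd ℂ s₂)
        (starRingEnd ℂ s₃) a) := by
  simp only [racahSeries, PowerSeries.coeff_mk, map_sum, map_mul, conj_racahCoeff, nodeSeries,
    PowerSeries.coeff_mul, conj_coeff_pochInf, map_neg, map_inv₀, map_zpow₀, Complex.conj_ofReal]

end Symmetry

/-! ### Parameters -/

/-- The properties of the parameters `s₀, s₁, s₂, s₃` and of an enumeration `x` of the grid. -/
structure RacahData (q : ℝ) (K : ℕ) (s₀ s₁ s₂ s₃ : ℂ) (x : ℕ → ℝ) : Prop where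
  q_pos : 0 < q
  q_lt_one : q < 1
  step : ∀ n, x (n + 2) = q * x n
  x_zero : 0 < x 0
  x_one : x 1 < 0
  s₂_eq : s₂ = -(x 0 : ℂ)
  s₃_eq : s₃ = -(x 1 : ℂ)
  prod_eq : x 0 * x 1 = -(q ^ (-(K : ℤ)))
  exists_real : ∃ e₁ e₂ : ℝ, s₀ + s₁ = e₁ ∧ s₀ * s₁ = e₂ ∧ 0 < e₂ ∧
    ∀ n, 0 < e₂ + e₁ * x n + x n ^ 2
  conj : (starRingEnd ℂ s₀ = s₁ ∧ starRingEnd ℂ s₁ = s₀) ∨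
    (starRingEnd ℂ s₀ = s₀ ∧ starRingEnd ℂ s₁ = s₁)

/-! ### Pairing power series with polynomials -/

/-- The pairing of a power series, shifted by `m`, with a polynomial. -/
def pair (G : PowerSeries ℂ) (m : ℤ) : Polynomial ℂ →ₗ[ℂ] ℂ :=
  Polynomial.lsum fun p => coeffZ ((p : ℤ) - m) G • LinearMap.id

lemma pair_monomial (G : PowerSeries ℂ) (m : ℤ) (p : ℕ) (c : ℂ) :
    pair G m (Polynomial.monomial p c) = coeffZ ((p : ℤ) - m) G * c := by
  rw [pair, Polynomial.lsum_apply, Polynomial.sum_monomial_index] <;> simp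

lemma pair_eq_sum (G : PowerSeries ℂ) (m : ℤ) (f : Polynomial ℂ) :
    pair G m f = ∑ p ∈ f.support, coeffZ ((p : ℤ) - m) G * f.coeff p := by
  simp [pair, Polynomial.lsum_apply, Polynomial.sum]

lemma pair_X_mul (G : PowerSeries ℂ) (m : ℤ) (f : Polynomial ℂ) :
    pair G m (Polynomial.X * f) = pair G (m - 1) f := by
  induction f using Polynomial.induction_on' with
  | add f g hf hg => rw [mul_add, map_add, map_add, hf, hg]
  | monomial p c =>
    rw [Polynomial.X_mul_monomial, pair_monomial, pair_monomial]
    congr 2; push_cast; ring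

lemma pair_add (G G' : PowerSeries ℂ) (m : ℤ) (f : Polynomial ℂ) :
    pair (G + G') m f = pair G m f + pair G' m f := by
  simp only [pair_eq_sum, coeffZ_add, add_mul, Finset.sum_add_distrib]

lemma pair_C_mul (c : ℂ) (G : PowerSeries ℂ) (m : ℤ) (f : Polynomial ℂ) :
    pair (PowerSeries.C c * G) m f = c * pair G m f := by
  simp only [pair_eq_sum, coeffZ_C_mul, Finset.mul_sum, mul_assoc]

lemma pair_series_X_mul (G : PowerSeries ℂ) (m : ℤ) (f : Polynomial ℂ) :
    pair (PowerSeries.X * G) m f = pair G (m + 1) f := by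
  simp only [pair_eq_sum, coeffZ_X_mul, sub_sub]

lemma pair_lin_mul (c : ℂ) (G : PowerSeries ℂ) (m : ℤ) (f : Polynomial ℂ) :
    pair (lin c * G) m f = pair G m f - c * pair G (m + 1) f := by
  have h : lin c * G = G + PowerSeries.C (-c) * (PowerSeries.X * G) := by
    rw [lin, map_neg]; ring
  rw [h, pair_add, pair_C_mul, pair_series_X_mul]; ring

/-- The dictionary between points and series: a zero c of the test polynomial is a factor 1 - cw of
the series together with a shift of the index. -/
lemma pair_X_sub_C_mul (c : ℂ) (G : PowerSeries ℂ) (m : ℤ) (f : Polynomial ℂ) :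
    pair G m ((Polynomial.X - Polynomial.C c) * f) = pair (lin c * G) (m - 1) f := by
  rw [pair_lin_mul, sub_mul, map_sub, pair_X_mul, Polynomial.C_mul', map_smul, smul_eq_mul,
    sub_add_cancel]

lemma pair_eq_zero_of_degree_lt {G : PowerSeries ℂ} {m : ℕ} {f : Polynomial ℂ}
    (hf : f.degree < m) : pair G m f = 0 := by
  rw [pair_eq_sum]
  refine Finset.sum_eq_zero fun p hp => ?_
  have : p < m := by
    have := Polynomial.le_degree_of_mem_supp p hp
    exact_mod_cast this.trans_lt hf
  rw [coeffZ_of_neg (by omega), zero_mul]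

lemma pair_of_monic {G : PowerSeries ℂ} (hG : PowerSeries.constantCoeff G = 1) {f : Polynomial ℂ}
    (hf : f.Monic) : pair G f.natDegree f = 1 := by
  nth_rewrite 2 [← Polynomial.eraseLead_add_monomial_natDegree_leadingCoeff f]
  rw [map_add, pair_monomial, sub_self, coeffZ_zero, hG, hf.leadingCoeff, pair_eq_zero_of_degree_lt,
    zero_add, one_mul]
  rw [← Polynomial.degree_eq_natDegree hf.ne_zero]
  exact Polynomial.degree_eraseLead_lt hf.ne_zero

namespace RacahData

variable {q : ℝ} {K : ℕ} {s₀ s₁ s₂ s₃ : ℂ} {x : ℕ → ℝ} (D : RacahData q K s₀ s₁ s₂ s₃ x)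

include D

lemma x_even (k : ℕ) : x (2 * k) = x 0 * q ^ k := by
  induction k with
  | zero => simp
  | succ k ih => rw [mul_add, mul_one, D.step, ih]; ring

lemma x_odd (k : ℕ) : x (2 * k + 1) = x 1 * q ^ k := by
  induction k with
  | zero => simp
  | succ k ih => rw [show 2 * (k + 1) + 1 = 2 * k + 1 + 2 by ring, D.step, ih]; ring

lemma summable_abs : Summable fun n => |x n| := by
  have hg := summable_geometric_of_lt_one D.q_pos.le D.q_lt_one
  refine Summable.even_add_odd ?_ ?_
  · simp only [D.x_even, abs_mul, abs_of_nonneg (pow_nonneg D.q_pos.le _)]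
    exact hg.mul_left _
  · simp only [D.x_odd, abs_mul, abs_of_nonneg (pow_nonneg D.q_pos.le _)]
    exact hg.mul_left _

lemma summable : Summable x := D.summable_abs.of_abs

lemma x_ne_zero (n : ℕ) : x n ≠ 0 := by
  rcases Nat.even_or_odd' n with ⟨k, rfl | rfl⟩
  · rw [D.x_even]; exact mul_ne_zero D.x_zero.ne' (pow_ne_zero _ D.q_pos.ne')
  · rw [D.x_odd]; exact mul_ne_zero D.x_one.ne (pow_ne_zero _ D.q_pos.ne')

lemma x_injective : Function.Injective x := by
  have hp : ∀ k, 0 < x (2 * k) := fun k => by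
    rw [D.x_even]; exact mul_pos D.x_zero (pow_pos D.q_pos _)
  have hn : ∀ k, x (2 * k + 1) < 0 := fun k => by
    rw [D.x_odd]; exact mul_neg_of_neg_of_pos D.x_one (pow_pos D.q_pos _)
  have hinj := (pow_right_strictAnti₀ D.q_pos D.q_lt_one).injective
  intro m n h
  rcases Nat.even_or_odd' m with ⟨k, rfl | rfl⟩ <;> rcases Nat.even_or_odd' n with ⟨l, rfl | rfl⟩
  · rw [D.x_even, D.x_even] at h
    rw [hinj (mul_left_cancel₀ D.x_zero.ne' h)]
  · exact absurd h ((hn l).trans (hp k)).ne'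
  · exact absurd h ((hn k).trans (hp l)).ne
  · rw [D.x_odd, D.x_odd] at h
    rw [hinj (mul_left_cancel₀ D.x_one.ne h)]

lemma q_ne : (q : ℂ) ≠ 0 := q_ne_zero D.q_pos

lemma s₀_mul_s₁_ne : s₀ * s₁ ≠ 0 := by
  obtain ⟨e₁, e₂, -, h, hpos, -⟩ := D.exists_real
  rw [h]; exact_mod_cast hpos.ne'

lemma s₀_ne : s₀ ≠ 0 := left_ne_zero_of_mul D.s₀_mul_s₁_ne

lemma s₁_ne : s₁ ≠ 0 := right_ne_zero_of_mul D.s₀_mul_s₁_ne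

lemma s₂_ne : s₂ ≠ 0 := by
  rw [D.s₂_eq, neg_ne_zero]; exact_mod_cast D.x_zero.ne'

lemma s₃_ne : s₃ ≠ 0 := by
  rw [D.s₃_eq, neg_ne_zero]; exact_mod_cast D.x_one.ne

lemma s₂_mul_s₃ : s₂ * s₃ = -((q : ℂ) ^ (-(K : ℤ))) := by
  rw [D.s₂_eq, D.s₃_eq, neg_mul_neg]
  exact_mod_cast D.prod_eq

lemma s₂_inv : s₂⁻¹ = -s₃ * (q : ℂ) ^ (K : ℤ) := by
  have h := D.s₂_mul_s₃
  have hq := zpow_ne_zero (K : ℤ) D.q_ne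
  rw [zpow_neg] at h
  field_simp [D.s₂_ne] at h ⊢
  linear_combination h

lemma prod_mul_zpow_ne_one (k : ℤ) : s₀ * s₁ * s₂ * s₃ * (q : ℂ) ^ k ≠ 1 := by
  obtain ⟨e₁, e₂, -, h, hpos, -⟩ := D.exists_real
  rw [h, mul_assoc (e₂ : ℂ), D.s₂_mul_s₃]
  intro h1
  have h2 : e₂ * -(q ^ (-(K : ℤ))) * q ^ k = 1 := by exact_mod_cast h1
  have h3 : 0 < e₂ * q ^ (-(K : ℤ)) * q ^ k :=
    mul_pos (mul_pos hpos (zpow_pos D.q_pos _)) (zpow_pos D.q_pos _)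
  linarith

lemma one_add_s₀_mul_s₁_ne (k : ℤ) : 1 + s₀ * s₁ * (q : ℂ) ^ k ≠ 0 := by
  obtain ⟨e₁, e₂, -, h, hpos, -⟩ := D.exists_real
  rw [h]
  intro h1
  have h2 : 1 + e₂ * q ^ k = 0 := by exact_mod_cast h1
  have h3 : 0 < e₂ * q ^ k := mul_pos hpos (zpow_pos D.q_pos _)
  linarith

lemma add_x_ne_zero (n : ℕ) : s₀ + x n ≠ 0 ∧ s₁ + x n ≠ 0 := by
  obtain ⟨e₁, e₂, h1, h2, -, hpos⟩ := D.exists_real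
  have : (s₀ + x n) * (s₁ + x n) ≠ 0 := by
    have e : (s₀ + x n) * (s₁ + x n) = ((e₂ + e₁ * x n + x n ^ 2 : ℝ) : ℂ) := by
      push_cast; rw [← h1, ← h2]; ring
    rw [e]; exact_mod_cast (hpos n).ne'
  exact ⟨left_ne_zero_of_mul this, right_ne_zero_of_mul this⟩

/-- Because s₂s₃ = -q^{-K}, a zero of this factor would mean s = -x 1 · q^{K-a}, the negative of a
point of the negative half-grid when a ≤ K. -/
lemma one_add_mul_s₂_ne {s : ℂ} (hs : ∀ n, s + x n ≠ 0) {a : ℤ} (ha : a ≤ K) :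
    1 + s * s₂ * (q : ℂ) ^ a ≠ 0 := by
  obtain ⟨j, hj⟩ : ∃ j : ℕ, (K : ℤ) - a = j := ⟨((K : ℤ) - a).toNat, by omega⟩
  have h := hs (2 * j + 1)
  contrapose! h
  have e : (q : ℂ) ^ (K : ℤ) = (q : ℂ) ^ a * (q : ℂ) ^ j := by
    rw [← zpow_natCast, ← zpow_add₀ D.q_ne]; congr 1; omega
  have e2 := D.s₂_inv
  rw [D.s₃_eq, neg_neg, e] at e2
  have e3 : (x 1 : ℂ) * ((q : ℂ) ^ a * (q : ℂ) ^ j) * s₂ = 1 := by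
    rw [← e2, inv_mul_cancel₀ D.s₂_ne]
  have hq := zpow_ne_zero a D.q_ne
  rw [D.x_odd]
  push_cast
  refine (mul_eq_zero.mp (?_ : (s₂ * (q : ℂ) ^ a) * (s + x 1 * (q : ℂ) ^ j) = 0)).resolve_left
    (mul_ne_zero D.s₂_ne hq)
  linear_combination h + e3

lemma one_add_mul_s₃_ne {s : ℂ} (hs : ∀ n, s + x n ≠ 0) {a : ℤ} (ha : a ≤ K) :
    1 + s * s₃ * (q : ℂ) ^ a ≠ 0 := by
  obtain ⟨j, hj⟩ : ∃ j : ℕ, (K : ℤ) - a = j := ⟨((K : ℤ) - a).toNat, by omega⟩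
  have h := hs (2 * j)
  contrapose! h
  have e : (q : ℂ) ^ (K : ℤ) = (q : ℂ) ^ a * (q : ℂ) ^ j := by
    rw [← zpow_natCast, ← zpow_add₀ D.q_ne]; congr 1; omega
  have e2 := D.s₂_inv
  rw [e] at e2
  have e3 : -s₃ * ((q : ℂ) ^ a * (q : ℂ) ^ j) * s₂ = 1 := by
    rw [← e2, inv_mul_cancel₀ D.s₂_ne]
  rw [D.s₂_eq] at e3
  have hq := zpow_ne_zero a D.q_ne
  rw [D.x_even]
  push_cast
  refine (mul_eq_zero.mp (?_ : (s₃ * (q : ℂ) ^ a) * (s + x 0 * (q : ℂ) ^ j) = 0)).resolve_left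
    (mul_ne_zero D.s₃_ne hq)
  linear_combination h + e3

/-- The factor 1 + s₂s₃q^a = 1 - q^{a-K} vanishes exactly at a = K, hence the strict bound. The
other factors are nonzero because s₀ and s₁ avoid the negatives of grid points and s₀s₁ > 0. -/
lemma recC_ne_zero {a : ℤ} (ha : a < K) : recC q s₀ s₁ s₂ s₃ a ≠ 0 := by
  have hσ := D.prod_mul_zpow_ne_one
  have h23 : 1 + s₂ * s₃ * (q : ℂ) ^ a ≠ 0 := by
    obtain ⟨j, hj⟩ : ∃ j : ℕ, (K : ℤ) - a = (j + 1 : ℕ) := ⟨((K : ℤ) - a).toNat - 1, by omega⟩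
    rw [D.s₂_mul_s₃, neg_mul, ← zpow_add₀ D.q_ne, ← sub_eq_add_neg]
    have h1 := one_sub_q_pow_ne_zero D.q_pos D.q_lt_one j
    intro h2
    refine h1 ?_
    rw [← zpow_natCast, ← hj]
    have e : (q : ℂ) ^ ((K : ℤ) - a) * (q : ℂ) ^ (-(K : ℤ) + a) = 1 := by
      rw [← zpow_add₀ D.q_ne, show (K : ℤ) - a + (-K + a) = 0 by ring, zpow_zero]
    linear_combination -(q : ℂ) ^ ((K : ℤ) - a) * h2 - e
  have hx := fun n => (D.add_x_ne_zero n).1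
  have hx' := fun n => (D.add_x_ne_zero n).2
  have hm : ∀ k : ℤ, 1 - s₀ * s₁ * s₂ * s₃ * (q : ℂ) ^ k ≠ 0 := fun k =>
    sub_ne_zero.mpr (hσ k).symm
  have z1 : (q : ℂ) ^ (2 * a - 1) = ((q : ℂ) ^ a) ^ 2 / q := by
    rw [zpow_sub₀ D.q_ne, zpow_one, two_mul, zpow_add₀ D.q_ne]; ring
  have z2 : (q : ℂ) ^ (2 * a) = ((q : ℂ) ^ a) ^ 2 := by rw [two_mul, zpow_add₀ D.q_ne]; ring
  have z3 : (q : ℂ) ^ (2 * a + 1) = q * ((q : ℂ) ^ a) ^ 2 := by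
    rw [zpow_add_one₀ D.q_ne, z2]; ring
  simp only [recC]
  refine div_ne_zero (mul_ne_zero (div_ne_zero (mul_ne_zero ?_ (zpow_ne_zero _ D.q_ne)) D.q_ne) ?_)
    ?_
  · exact mul_ne_zero (mul_ne_zero D.s₀_mul_s₁_ne D.s₂_ne) D.s₃_ne
  · exact mul_ne_zero (mul_ne_zero (mul_ne_zero (mul_ne_zero (mul_ne_zero
      (D.one_add_s₀_mul_s₁_ne a) (D.one_add_mul_s₂_ne hx ha.le)) (D.one_add_mul_s₃_ne hx ha.le))
      (D.one_add_mul_s₂_ne hx' ha.le)) (D.one_add_mul_s₃_ne hx' ha.le)) h23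
  · refine mul_ne_zero (mul_ne_zero ?_ (pow_ne_zero 2 ?_)) ?_
    · have := hm (2 * a - 1); rwa [z1, ← mul_div_assoc] at this
    · have := hm (2 * a); rwa [z2] at this
    · have := hm (2 * a + 1); rwa [z3, ← mul_assoc] at this

/-! ### The full grid -/

/-- Scaling the grid by q deletes x 0 and x 1, so H(qw) = H(w)(1 - x 0 · w)(1 - x 1 · w), opposite
to the equations of the two infinite products. The scaling relation is proved for truncations, where
it shifts N by two. -/
lemma hSeries_mul_pochInf : hSeries x * (pochInf q (x 0) * pochInf q (x 1)) = 1 := by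
  have key : ∀ N, PowerSeries.rescale (q : ℂ) (hSeries (truncSeq x N)) =
      hSeries (truncSeq x (N + 2)) * (lin (x 0 : ℂ) * lin (x 1 : ℂ)) := by
    intro N
    have h1 := congrArg (PowerSeries.rescale (q : ℂ)) (hSeries_truncSeq_mul x N)
    rw [map_mul, map_prod, map_one] at h1
    have h2 := hSeries_truncSeq_mul x (N + 2)
    rw [Finset.prod_range_succ', Finset.prod_range_succ'] at h2
    have h3 : ∏ i ∈ Finset.range N, lin (x (i + 1 + 1) : ℂ) =
        ∏ i ∈ Finset.range N, PowerSeries.rescale (q : ℂ) (lin (x i : ℂ)) := by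
      refine Finset.prod_congr rfl fun i _ => ?_
      rw [rescale_lin, D.step]; push_cast; rw [mul_comm]
    rw [h3, zero_add] at h2
    obtain ⟨P, hP⟩ : ∃ P, P = ∏ i ∈ Finset.range N, PowerSeries.rescale (q : ℂ) (lin (x i : ℂ)) :=
      ⟨_, rfl⟩
    rw [← hP] at h1 h2
    linear_combination hSeries (truncSeq x (N + 2)) * lin (x 0 : ℂ) * lin (x 1 : ℂ) * h1 -
      PowerSeries.rescale (q : ℂ) (hSeries (truncSeq x N)) * h2
  have hlim : PowerSeries.rescale (q : ℂ) (hSeries x) =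
      hSeries x * (lin (x 0 : ℂ) * lin (x 1 : ℂ)) := by
    ext n
    have t1 : Tendsto (fun N => PowerSeries.coeff n
        (PowerSeries.rescale (q : ℂ) (hSeries (truncSeq x N)))) atTop
        (𝓝 (PowerSeries.coeff n (PowerSeries.rescale (q : ℂ) (hSeries x)))) := by
      simp only [PowerSeries.coeff_rescale, hSeries, PowerSeries.coeff_mk]
      exact (tendsto_hVal_truncSeq D.summable_abs n).const_mul _
    have t2 : Tendsto (fun N => PowerSeries.coeff n
        (hSeries (truncSeq x (N + 2)) * (lin (x 0 : ℂ) * lin (x 1 : ℂ)))) atTop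
        (𝓝 (PowerSeries.coeff n (hSeries x * (lin (x 0 : ℂ) * lin (x 1 : ℂ))))) := by
      simp only [PowerSeries.coeff_mul n (hSeries _)]
      refine tendsto_finsetSum _ fun p _ => ?_
      simp only [hSeries, PowerSeries.coeff_mk]
      exact ((tendsto_hVal_truncSeq D.summable_abs p.1).comp (tendsto_add_atTop_nat 2)).mul_const _
    simp only [key] at t1
    exact tendsto_nhds_unique t1 t2
  refine eq_one_of_rescale_eq D.q_pos D.q_lt_one ?_ ?_
  · rw [map_mul, map_mul, hlim, rescale_pochInf, rescale_pochInf,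
      pochInf_eq D.q_pos D.q_lt_one (x 0), pochInf_eq D.q_pos D.q_lt_one (x 1)]
    ring
  · rw [map_mul, map_mul, constantCoeff_hSeries, constantCoeff_pochInf, constantCoeff_pochInf]
    simp

/-- With s₂ as base parameter the two progressions of nodes at b = K are the two halves of the grid.
This is the purpose of exchanging s₀ and s₂, and the origin of K. -/
lemma nodeSeries_mul_hSeries : nodeSeries q s₂ (K : ℤ) * hSeries x = 1 := by
  have e : s₂⁻¹ * (q : ℂ) ^ (-(K : ℤ)) = x 1 := by
    rw [D.s₂_inv, mul_assoc, ← zpow_add₀ D.q_ne, add_neg_cancel, zpow_zero, mul_one, D.s₃_eq,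
      neg_neg]
  rw [← D.hSeries_mul_pochInf, nodeSeries, e, D.s₂_eq, neg_neg, mul_comm]

lemma s₂_inv_mul_zpow (i : ℤ) : s₂⁻¹ * (q : ℂ) ^ (-(K : ℤ) + i) = -s₃ * (q : ℂ) ^ i := by
  rw [D.s₂_inv, mul_assoc, ← zpow_add₀ D.q_ne]; congr 2; ring

lemma nodeSeries_add_mul_hSeries (j : ℕ) :
    nodeSeries q s₂ ((K : ℤ) + j) * hSeries x =
      ∏ i ∈ Finset.range j, lin (-s₃ * (q : ℂ) ^ (-1 - i : ℤ)) := by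
  induction j with
  | zero => simpa using D.nodeSeries_mul_hSeries
  | succ j ih =>
    rw [Finset.prod_range_succ, ← ih, show ((K : ℤ) + ((j + 1 : ℕ) : ℤ)) = K + j + 1 by
      push_cast; ring, nodeSeries_add_one D.q_pos D.q_lt_one,
      show -((K : ℤ) + j) - 1 = -(K : ℤ) + (-1 - j) by ring, D.s₂_inv_mul_zpow]
    ring

lemma nodeSeries_sub_mul_hSeries (d : ℕ) :
    nodeSeries q s₂ ((K : ℤ) - d) * hSeries x *
      ∏ i ∈ Finset.range d, lin (-s₃ * (q : ℂ) ^ i) = 1 := by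
  induction d with
  | zero => simpa using D.nodeSeries_mul_hSeries
  | succ d ih =>
    have h := nodeSeries_add_one D.q_pos D.q_lt_one s₂ ((K : ℤ) - ((d + 1 : ℕ) : ℤ))
    rw [show (K : ℤ) - ((d + 1 : ℕ) : ℤ) + 1 = K - d by push_cast; ring,
      show -((K : ℤ) - ((d + 1 : ℕ) : ℤ)) - 1 = -(K : ℤ) + (d : ℤ) by push_cast; ring,
      D.s₂_inv_mul_zpow, zpow_natCast] at h
    rw [Finset.prod_range_succ, ← ih, h]
    ring

lemma racahSeries_eq_swap (a : ℤ) :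
    racahSeries q s₀ s₁ s₂ s₃ a = racahSeries q s₂ s₁ s₀ s₃ a :=
  (racahSeries_swap₀₂ D.q_pos D.q_lt_one D.s₀_ne D.s₁_ne D.s₂_ne D.s₃_ne
    D.prod_mul_zpow_ne_one a).symm

/-- One numerator symbol is (q^{a-d+1-K};q)_d, which contains the factor 1 - q⁰ whenever a - d < K ≤
a. -/
lemma racahCoeff_swap_eq_zero {a : ℤ} {d : ℕ} (ha : (K : ℤ) ≤ a) (hd : a - d < K) :
    racahCoeff q s₂ s₁ s₀ s₃ a d = 0 := by
  have : zPoch q (-(s₂ * s₃)) (a - d + 1) d = 0 := by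
    refine Finset.prod_eq_zero (i := (K - (a - d + 1)).toNat) (Finset.mem_range.mpr (by omega)) ?_
    rw [mul_assoc, ← zpow_natCast, ← zpow_add₀ D.q_ne, D.s₂_mul_s₃, neg_neg,
      ← zpow_add₀ D.q_ne, show -(K : ℤ) + (a - d + 1 + ((K - (a - d + 1)).toNat : ℤ)) = 0 by omega,
      zpow_zero, sub_self]
  rw [racahCoeff_eq, this]
  simp

/-- For `a ≥ K` the product with the generating series of the grid is a polynomial. -/
lemma coeffZ_racahSeries_mul_hSeries_eq_zero {a n : ℤ} (ha : (K : ℤ) ≤ a) (hn : a - K < n) :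
    coeffZ n (racahSeries q s₀ s₁ s₂ s₃ a * hSeries x) = 0 := by
  rw [D.racahSeries_eq_swap, coeffZ_racahSeries_mul q s₂ s₁ s₀ s₃ a n (n.toNat + 1) (by omega)]
  refine Finset.sum_eq_zero fun d _ => ?_
  -- The expansion splits at a - d = K: below, the coefficient vanishes; above, G_{a-d} H is a
  -- polynomial of degree a - d - K < n - d.
  rcases lt_or_ge (a - d) K with h | h
  · rw [D.racahCoeff_swap_eq_zero ha h, zero_mul]
  · obtain ⟨j, hj⟩ : ∃ j : ℕ, a - d = K + j := ⟨(a - d - K).toNat, by omega⟩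
    rw [hj, D.nodeSeries_add_mul_hSeries, coeffZ_of_nonneg (by omega), coeff_prod_lin_eq_zero,
      mul_zero]
    rw [Finset.card_range]
    omega

end RacahData

/-! ### The moment functionals -/

/-- The functional `u^p ↦ [w^{p-m}] F_{K-1-m}(w) H(w)` on polynomials. -/
def momentFun (q : ℝ) (K : ℕ) (s₀ s₁ s₂ s₃ : ℂ) (x : ℕ → ℝ) (m : ℤ) : Polynomial ℂ →ₗ[ℂ] ℂ :=
  pair (racahSeries q s₀ s₁ s₂ s₃ ((K : ℤ) - 1 - m) * hSeries x) m

/-- The monic orthogonal polynomials. -/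
def orthPoly (q : ℝ) (K : ℕ) (s₀ s₁ s₂ s₃ : ℂ) : ℕ → Polynomial ℂ
  | 0 => 1
  | 1 => Polynomial.X - Polynomial.C (recB q s₀ s₁ s₂ s₃ ((K : ℤ) - 1))
  | m + 2 => (Polynomial.X - Polynomial.C (recB q s₀ s₁ s₂ s₃ ((K : ℤ) - 1 - (m + 1 : ℕ)))) *
      orthPoly q K s₀ s₁ s₂ s₃ (m + 1) -
      Polynomial.C (recC q s₀ s₁ s₂ s₃ ((K : ℤ) - 1 - m)) * orthPoly q K s₀ s₁ s₂ s₃ m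

/-- The squared norms of the monic orthogonal polynomials. -/
def orthNorm (q : ℝ) (K : ℕ) (s₀ s₁ s₂ s₃ : ℂ) (m : ℕ) : ℂ :=
  ∏ i ∈ Finset.range m, recC q s₀ s₁ s₂ s₃ ((K : ℤ) - 1 - i)

lemma orthNorm_succ (q : ℝ) (K : ℕ) (s₀ s₁ s₂ s₃ : ℂ) (m : ℕ) :
    orthNorm q K s₀ s₁ s₂ s₃ (m + 1) =
      orthNorm q K s₀ s₁ s₂ s₃ m * recC q s₀ s₁ s₂ s₃ ((K : ℤ) - 1 - m) :=
  Finset.prod_range_succ _ _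

lemma orthPoly_monic_natDegree (q : ℝ) (K : ℕ) (s₀ s₁ s₂ s₃ : ℂ) (m : ℕ) :
    (orthPoly q K s₀ s₁ s₂ s₃ m).Monic ∧ (orthPoly q K s₀ s₁ s₂ s₃ m).natDegree = m := by
  induction m using Nat.strong_induction_on with
  | _ m ih =>
    match m, ih with
    | 0, _ => exact ⟨Polynomial.monic_one, Polynomial.natDegree_one⟩
    | 1, _ => exact ⟨Polynomial.monic_X_sub_C _, Polynomial.natDegree_X_sub_C _⟩
    | m + 2, ih =>
      obtain ⟨h1, h2⟩ := ih m (by omega)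
      obtain ⟨h3, h4⟩ := ih (m + 1) (by omega)
      have hm := (Polynomial.monic_X_sub_C
        (recB q s₀ s₁ s₂ s₃ ((K : ℤ) - 1 - (m + 1 : ℕ)))).mul h3
      have hdeg : ((Polynomial.X - Polynomial.C (recB q s₀ s₁ s₂ s₃ ((K : ℤ) - 1 - (m + 1 : ℕ)))) *
          orthPoly q K s₀ s₁ s₂ s₃ (m + 1)).natDegree = m + 2 := by
        rw [(Polynomial.monic_X_sub_C _).natDegree_mul h3, h4, Polynomial.natDegree_X_sub_C]
        ring
      have hlt : (Polynomial.C (recC q s₀ s₁ s₂ s₃ ((K : ℤ) - 1 - m)) *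
          orthPoly q K s₀ s₁ s₂ s₃ m).degree < ((Polynomial.X - Polynomial.C
            (recB q s₀ s₁ s₂ s₃ ((K : ℤ) - 1 - (m + 1 : ℕ)))) *
              orthPoly q K s₀ s₁ s₂ s₃ (m + 1)).degree := by
        refine Polynomial.degree_lt_degree ?_
        rw [hdeg]
        refine (Polynomial.natDegree_C_mul_le _ _).trans_lt ?_
        omega
      rw [orthPoly]
      exact ⟨hm.sub_of_left hlt, by rw [Polynomial.natDegree_sub_eq_left_of_natDegree_lt (by
        rw [hdeg]; refine (Polynomial.natDegree_C_mul_le _ _).trans_lt ?_; omega), hdeg]⟩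

section

variable {q : ℝ} {K : ℕ} {s₀ s₁ s₂ s₃ : ℂ} {x : ℕ → ℝ}

lemma momentFun_eq_zero_of_degree_lt {m : ℕ} {f : Polynomial ℂ} (hf : f.degree < m) :
    momentFun q K s₀ s₁ s₂ s₃ x m f = 0 := pair_eq_zero_of_degree_lt hf

lemma momentFun_of_monic {f : Polynomial ℂ} (hf : f.Monic) :
    momentFun q K s₀ s₁ s₂ s₃ x f.natDegree f = 1 := by
  refine pair_of_monic ?_ hf
  rw [map_mul, constantCoeff_racahSeries, constantCoeff_hSeries, one_mul]

end

namespace RacahData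

variable {q : ℝ} {K : ℕ} {s₀ s₁ s₂ s₃ : ℂ} {x : ℕ → ℝ} (D : RacahData q K s₀ s₁ s₂ s₃ x)

include D

/-- The recurrence for F in dual form: multiplication by u acts on the functionals as a tridiagonal
matrix. -/
lemma momentFun_X_mul (m : ℤ) (f : Polynomial ℂ) :
    momentFun q K s₀ s₁ s₂ s₃ x m (Polynomial.X * f) = momentFun q K s₀ s₁ s₂ s₃ x (m - 1) f +
      recB q s₀ s₁ s₂ s₃ ((K : ℤ) - 1 - m) * momentFun q K s₀ s₁ s₂ s₃ x m f +
      recC q s₀ s₁ s₂ s₃ ((K : ℤ) - 1 - m) * momentFun q K s₀ s₁ s₂ s₃ x (m + 1) f := by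
  have h := racahSeries_recurrence D.q_pos D.q_lt_one D.s₀_ne D.prod_mul_zpow_ne_one
    ((K : ℤ) - 1 - m)
  unfold momentFun
  conv_lhs => rw [pair_X_mul, h, add_mul, add_mul, mul_assoc, mul_assoc, mul_assoc, mul_assoc,
    pair_add, pair_add, pair_C_mul, pair_C_mul, pair_series_X_mul, pow_two, mul_assoc,
    pair_series_X_mul, pair_series_X_mul, sub_add_cancel]
  rw [show (K : ℤ) - 1 - m + 1 = K - 1 - (m - 1) by ring,
    show (K : ℤ) - 1 - m - 1 = K - 1 - (m + 1) by ring]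

/-- Here K-1-m ≥ K, so F H has degree at most -m-1, while only indices p-m ≥ -m are paired. This
cuts the doubly infinite tridiagonal matrix down to a Jacobi matrix. -/
lemma momentFun_of_neg {m : ℤ} (hm : m < 0) (f : Polynomial ℂ) :
    momentFun q K s₀ s₁ s₂ s₃ x m f = 0 := by
  rw [momentFun, pair_eq_sum]
  refine Finset.sum_eq_zero fun p _ => ?_
  rw [D.coeffZ_racahSeries_mul_hSeries_eq_zero (by omega) (by omega), zero_mul]

lemma orthNorm_ne_zero (m : ℕ) : orthNorm q K s₀ s₁ s₂ s₃ m ≠ 0 :=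
  Finset.prod_ne_zero_iff.mpr fun i _ => D.recC_ne_zero (by omega)

/-- Favard's argument: the recursion for P_m is the one that carries ℓ_0 to a multiple of ℓ_m, the
multiple gaining one γ at each step. -/
lemma momentFun_orthPoly_mul (m : ℕ) (f : Polynomial ℂ) :
    momentFun q K s₀ s₁ s₂ s₃ x 0 (orthPoly q K s₀ s₁ s₂ s₃ m * f) =
      orthNorm q K s₀ s₁ s₂ s₃ m * momentFun q K s₀ s₁ s₂ s₃ x m f := by
  induction m using Nat.strong_induction_on generalizing f with
  | _ m ih =>
    match m, ih with
    | 0, _ => simp [orthPoly, orthNorm]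
    | 1, _ =>
      have h := D.momentFun_X_mul 0 f
      rw [D.momentFun_of_neg (m := 0 - 1) (by omega), sub_zero, zero_add, zero_add] at h
      rw [orthPoly, sub_mul, map_sub, h, Polynomial.C_mul', map_smul, smul_eq_mul, orthNorm,
        Finset.prod_range_one, Nat.cast_zero, sub_zero, Nat.cast_one]
      ring
    | m + 2, ih =>
      have h := D.momentFun_X_mul ((m + 1 : ℕ) : ℤ) f
      rw [orthPoly, sub_mul, map_sub, mul_assoc, Polynomial.C_mul', smul_mul_assoc, map_smul,
        ih m (by omega), sub_mul, map_sub, mul_left_comm, ih (m + 1) (by omega), Polynomial.C_mul', map_smul,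
        ih (m + 1) (by omega), h, orthNorm_succ, orthNorm_succ, orthNorm_succ, smul_eq_mul, smul_eq_mul,
        show ((m + 1 : ℕ) : ℤ) - 1 = m by push_cast; ring,
        show ((m + 1 : ℕ) : ℤ) + 1 = ((m + 2 : ℕ) : ℤ) by push_cast; ring]
      ring

/-- ℓ_m annihilates degrees below m and equals 1 on monic polynomials of degree m. -/
lemma momentFun_orthPoly_mul_orthPoly (m n : ℕ) :
    momentFun q K s₀ s₁ s₂ s₃ x 0 (orthPoly q K s₀ s₁ s₂ s₃ m * orthPoly q K s₀ s₁ s₂ s₃ n) =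
      if m = n then orthNorm q K s₀ s₁ s₂ s₃ m else 0 := by
  have key : ∀ m n : ℕ, n < m → momentFun q K s₀ s₁ s₂ s₃ x 0
      (orthPoly q K s₀ s₁ s₂ s₃ m * orthPoly q K s₀ s₁ s₂ s₃ n) = 0 := by
    intro m n h
    obtain ⟨h1, h2⟩ := orthPoly_monic_natDegree q K s₀ s₁ s₂ s₃ n
    rw [D.momentFun_orthPoly_mul, momentFun_eq_zero_of_degree_lt, mul_zero]
    rw [Polynomial.degree_eq_natDegree h1.ne_zero, h2]
    exact_mod_cast h
  split_ifs with h
  · subst h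
    obtain ⟨h1, h2⟩ := orthPoly_monic_natDegree q K s₀ s₁ s₂ s₃ m
    have := momentFun_of_monic (q := q) (K := K) (s₀ := s₀) (s₁ := s₁) (s₂ := s₂) (s₃ := s₃)
      (x := x) h1
    rw [h2] at this
    rw [D.momentFun_orthPoly_mul, this, mul_one]
  · rcases lt_or_gt_of_ne h with h | h
    · rw [mul_comm, key n m h]
    · exact key m n h

end RacahData

/-! ### The weights -/

/-- The logarithm of the ratio of the weight factors at `y` and `q⁻¹ y`. -/
def logRatio (s₀ s₁ : ℂ) (x : ℕ → ℝ) (y : ℝ) : ℝ :=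
  Real.log (1 + ((s₀ + s₁).re / (s₀ * s₁).re * y + y ^ 2 / (s₀ * s₁).re)) -
    Real.log (1 + -(y / x 0)) - Real.log (1 + -(y / x 1))

/-- The weight of a point of the grid, up to the absolute value of the point. -/
def weightFactor (s₀ s₁ : ℂ) (x : ℕ → ℝ) (n : ℕ) : ℝ :=
  Real.exp (-∑' j : ℕ, logRatio s₀ s₁ x (x (n + 2 * (j + 1))))

/-- The weight of a point of the grid. -/
def weight (s₀ s₁ : ℂ) (x : ℕ → ℝ) (n : ℕ) : ℝ := |x n| * weightFactor s₀ s₁ x n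

lemma weightFactor_pos (s₀ s₁ : ℂ) (x : ℕ → ℝ) (n : ℕ) : 0 < weightFactor s₀ s₁ x n :=
  Real.exp_pos _

/-- Normalization at the accumulation point 0. The common limit 1 on both halves of the grid makes
the boundary terms at 0 cancel in the summation by parts. -/
lemma tendsto_weightFactor (s₀ s₁ : ℂ) (x : ℕ → ℝ) (n : ℕ) :
    Tendsto (fun k => weightFactor s₀ s₁ x (n + 2 * k)) atTop (𝓝 1) := by
  -- Tails tend to zero without a summability hypothesis, owing to the default value 0 of divergent
  -- sums.
  have h := tendsto_sum_nat_add fun j : ℕ => logRatio s₀ s₁ x (x (n + 2 * (j + 1)))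
  have h2 := (Real.continuous_exp.tendsto _).comp h.neg
  rw [neg_zero, Real.exp_zero] at h2
  refine h2.congr fun k => ?_
  simp only [Function.comp, weightFactor]
  congr 3
  funext j
  congr 2
  ring

lemma linearMap_ext_of_monic {P : ℕ → Polynomial ℂ}
    (hP : ∀ d, (P d).Monic ∧ (P d).natDegree = d) {f g : Polynomial ℂ →ₗ[ℂ] ℂ}
    (h : ∀ d, f (P d) = g (P d)) : f = g := by
  let S : Polynomial.Sequence ℂ := ⟨P, fun d => by
    rw [Polynomial.degree_eq_natDegree (hP d).1.ne_zero, (hP d).2]⟩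
  refine LinearMap.ext_on (s := Set.range S) (S.span fun i => ?_) ?_
  · change IsUnit (P i).leadingCoeff
    rw [(hP i).1.leadingCoeff]; exact isUnit_one
  · rintro _ ⟨d, rfl⟩
    exact h d

/-- The polynomial with zeros `x 1 * q ^ i`. -/
def gridPoly (q : ℝ) (x : ℕ → ℝ) (d : ℕ) : Polynomial ℂ :=
  ∏ i ∈ Finset.range d, (Polynomial.X - Polynomial.C ((x 1 : ℂ) * (q : ℂ) ^ i))

lemma gridPoly_monic_natDegree (q : ℝ) (x : ℕ → ℝ) (d : ℕ) :
    (gridPoly q x d).Monic ∧ (gridPoly q x d).natDegree = d := by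
  refine ⟨Polynomial.monic_prod_of_monic _ _ fun i _ => Polynomial.monic_X_sub_C _, ?_⟩
  rw [gridPoly, Polynomial.natDegree_prod_of_monic _ _ fun i _ => Polynomial.monic_X_sub_C _]
  simp only [Polynomial.natDegree_X_sub_C, Finset.sum_const, Finset.card_range, smul_eq_mul, mul_one]

lemma gridPoly_succ (q : ℝ) (x : ℕ → ℝ) (d : ℕ) : gridPoly q x (d + 1) =
    gridPoly q x d * (Polynomial.X - Polynomial.C ((x 1 : ℂ) * (q : ℂ) ^ d)) :=
  Finset.prod_range_succ _ _

namespace RacahData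

variable {q : ℝ} {K : ℕ} {s₀ s₁ s₂ s₃ : ℂ} {x : ℕ → ℝ} (D : RacahData q K s₀ s₁ s₂ s₃ x)

include D

lemma weight_pos (n : ℕ) : 0 < weight s₀ s₁ x n :=
  mul_pos (abs_pos.mpr (D.x_ne_zero n)) (weightFactor_pos _ _ _ _)

lemma summable_logRatio (n : ℕ) : Summable fun j : ℕ => logRatio s₀ s₁ x (x (n + 2 * (j + 1))) := by
  have hs : Summable fun j : ℕ => x (n + 2 * (j + 1)) :=
    D.summable.comp_injective (i := fun j : ℕ => n + 2 * (j + 1)) fun a b h => by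
      simp only at h; omega
  have hs2 : Summable fun j : ℕ => x (n + 2 * (j + 1)) ^ 2 := by
    have h1 := (summable_pow_of_summable_abs D.summable_abs 1)
    have h2 : Summable fun i => x i ^ 2 := by
      simpa using h1
    exact h2.comp_injective (i := fun j : ℕ => n + 2 * (j + 1)) fun a b h => by
      simp only at h; omega
  refine Summable.sub (Summable.sub ?_ ?_) ?_
  · exact Real.summable_log_one_add_of_summable ((hs.mul_left _).add (hs2.div_const _))
  · exact Real.summable_log_one_add_of_summable (hs.div_const _).neg
  · exact Real.summable_log_one_add_of_summable (hs.div_const _).neg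

lemma weightFactor_add_two (n : ℕ) : weightFactor s₀ s₁ x (n + 2) =
    weightFactor s₀ s₁ x n * Real.exp (logRatio s₀ s₁ x (x (n + 2))) := by
  rw [weightFactor, weightFactor, ← Real.exp_add, (D.summable_logRatio n).tsum_eq_zero_add]
  congr 1
  simp only [zero_add, mul_one]
  have : ∀ j : ℕ, n + 2 * (j + 1 + 1) = n + 2 + 2 * (j + 1) := fun j => by ring
  simp only [this]
  ring

lemma factors_pos (n : ℕ) : 0 < 1 + -(x (n + 2) / x 0) ∧ 0 < 1 + -(x (n + 2) / x 1) := by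
  have hq := D.q_pos
  rcases Nat.even_or_odd' n with ⟨k, rfl | rfl⟩
  · rw [show 2 * k + 2 = 2 * (k + 1) by ring, D.x_even]
    have hp := pow_lt_one₀ hq.le D.q_lt_one (Nat.succ_ne_zero k)
    have hp0 := pow_pos hq (k + 1)
    constructor
    · rw [mul_div_cancel_left₀ _ D.x_zero.ne']
      simp only [Nat.succ_eq_add_one] at hp
      linarith
    · have : x 0 * q ^ (k + 1) / x 1 < 0 := div_neg_of_pos_of_neg (mul_pos D.x_zero hp0) D.x_one
      rw [← sub_eq_add_neg]
      exact sub_pos.mpr (this.trans one_pos)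
  · rw [show 2 * k + 1 + 2 = 2 * (k + 1) + 1 by ring, D.x_odd]
    have hp := pow_lt_one₀ hq.le D.q_lt_one (Nat.succ_ne_zero k)
    have hp0 := pow_pos hq (k + 1)
    constructor
    · have : x 1 * q ^ (k + 1) / x 0 < 0 :=
        div_neg_of_neg_of_pos (mul_neg_of_neg_of_pos D.x_one hp0) D.x_zero
      rw [← sub_eq_add_neg]
      exact sub_pos.mpr (this.trans one_pos)
    · rw [mul_div_cancel_left₀ _ D.x_one.ne]
      simp only [Nat.succ_eq_add_one] at hp
      linarith

/-- The Pearson equation for the weights. -/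
lemma weightFactor_pearson (n : ℕ) :
    (weightFactor s₀ s₁ x (n + 2) : ℂ) * ((1 + x (n + 2) / s₂) * (1 + x (n + 2) / s₃)) =
      weightFactor s₀ s₁ x n * ((1 + x (n + 2) / s₀) * (1 + x (n + 2) / s₁)) := by
  obtain ⟨e₁, e₂, h1, h2, h3, hpos⟩ := D.exists_real
  obtain ⟨p1, p2⟩ := D.factors_pos n
  have p3 : 0 < 1 + (e₁ / e₂ * x (n + 2) + x (n + 2) ^ 2 / e₂) := by
    have := div_pos (hpos (n + 2)) h3
    have e : (e₂ + e₁ * x (n + 2) + x (n + 2) ^ 2) / e₂ =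
        1 + (e₁ / e₂ * x (n + 2) + x (n + 2) ^ 2 / e₂) := by field_simp; ring
    rwa [e] at this
  have hexp : Real.exp (logRatio s₀ s₁ x (x (n + 2))) *
      ((1 + -(x (n + 2) / x 0)) * (1 + -(x (n + 2) / x 1))) =
      1 + (e₁ / e₂ * x (n + 2) + x (n + 2) ^ 2 / e₂) := by
    rw [logRatio, h1, h2, Complex.ofReal_re, Complex.ofReal_re, Real.exp_sub, Real.exp_sub,
      Real.exp_log p1, Real.exp_log p2, Real.exp_log p3]
    field_simp
  have hc : (1 + (x (n + 2) : ℂ) / s₀) * (1 + x (n + 2) / s₁) =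
      ((1 + (e₁ / e₂ * x (n + 2) + x (n + 2) ^ 2 / e₂) : ℝ) : ℂ) := by
    push_cast
    rw [← h1, ← h2]
    have := D.s₀_ne
    have := D.s₁_ne
    field_simp
    ring
  rw [hc, ← hexp, D.weightFactor_add_two, D.s₂_eq, D.s₃_eq]
  push_cast
  simp only [div_neg]
  ring

lemma summable_weight : Summable (weight s₀ s₁ x) := by
  have key : ∀ c : ℕ, Summable fun k => weight s₀ s₁ x (c + 2 * k) := by
    intro c
    obtain ⟨C, hC⟩ := (Metric.isBounded_range_of_tendsto _ (tendsto_weightFactor s₀ s₁ x c)).exists_norm_le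
    have hs : Summable fun k : ℕ => |x (c + 2 * k)| :=
      D.summable_abs.comp_injective (i := fun k : ℕ => c + 2 * k) fun a b h => by
        simp only at h; omega
    refine Summable.of_norm_bounded (hs.mul_right C) fun k => ?_
    rw [weight, norm_mul, Real.norm_eq_abs, abs_abs]
    exact mul_le_mul_of_nonneg_left (hC _ ⟨k, rfl⟩) (abs_nonneg _)
  refine Summable.even_add_odd ?_ ?_
  · simpa using key 0
  · simpa [add_comm] using key 1

lemma tendsto_eval_x (f : Polynomial ℂ) :
    Tendsto (fun n => f.eval (x n : ℂ)) atTop (𝓝 (f.eval 0)) := by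
  have h1 : Tendsto (fun n => (x n : ℂ)) atTop (𝓝 0) := by
    have := (Complex.continuous_ofReal.tendsto 0).comp D.summable.tendsto_atTop_zero
    simpa [Function.comp_def] using this
  exact (f.continuous.tendsto 0).comp h1

lemma summable_weight_mul_eval (f : Polynomial ℂ) :
    Summable fun n => (weight s₀ s₁ x n : ℂ) * f.eval (x n : ℂ) := by
  obtain ⟨C, hC⟩ := (Metric.isBounded_range_of_tendsto _ (D.tendsto_eval_x f)).exists_norm_le
  refine Summable.of_norm_bounded (D.summable_weight.mul_right C) fun k => ?_
  rw [norm_mul, Complex.norm_real, Real.norm_of_nonneg (D.weight_pos k).le]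
  exact mul_le_mul_of_nonneg_left (hC _ ⟨k, rfl⟩) (D.weight_pos k).le

lemma tsum_weight_pos : 0 < ∑' n, weight s₀ s₁ x n :=
  D.summable_weight.tsum_pos (fun n => (D.weight_pos n).le) 0 (D.weight_pos 0)

/-! ### The weighted sum over the grid and its identification with ℓ_0 -/

/-- The weighted sum over the grid, as a functional on polynomials. -/
def weightSum : Polynomial ℂ →ₗ[ℂ] ℂ where
  toFun f := ∑' n, (weight s₀ s₁ x n : ℂ) * f.eval (x n : ℂ)
  map_add' f g := by
    rw [← (D.summable_weight_mul_eval f).tsum_add (D.summable_weight_mul_eval g)]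
    simp only [Polynomial.eval_add, mul_add]
  map_smul' c f := by
    simp only [Polynomial.eval_smul, smul_eq_mul, RingHom.id_apply, ← tsum_mul_left]
    exact tsum_congr fun n => by ring

lemma weightSum_apply (f : Polynomial ℂ) :
    D.weightSum f = ∑' n, (weight s₀ s₁ x n : ℂ) * f.eval (x n : ℂ) := rfl

/-- By the Pearson equation the summands telescope along one half of the grid, whose sign is ε. The
end at c contributes nothing since a factor vanishes there; the end at 0 contributes g(0). -/
lemma tsum_chain (c : ℕ) (hc : (1 + (x c : ℂ) / s₂) * (1 + x c / s₃) = 0) {ε : ℂ}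
    (hε : ∀ k : ℕ, ((|x (c + 2 * k)| : ℝ) : ℂ) = ε * x (c + 2 * k)) {f g : Polynomial ℂ}
    (hfg : ∀ n, (x n : ℂ) * f.eval (x n : ℂ) = (1 + x n / s₂) * (1 + x n / s₃) * g.eval (x n : ℂ) -
      (1 + q * x n / s₀) * (1 + q * x n / s₁) * g.eval (q * x n : ℂ)) :
    ∑' k, (weight s₀ s₁ x (c + 2 * k) : ℂ) * f.eval (x (c + 2 * k) : ℂ) = -ε * g.eval 0 := by
  have hinj : Function.Injective fun k : ℕ => c + 2 * k := fun a b h => by simp only at h; omega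
  have hs := (D.summable_weight_mul_eval f).comp_injective hinj
  refine tendsto_nhds_unique hs.hasSum.tendsto_sum_nat ?_
  obtain ⟨t, ht⟩ : ∃ t : ℕ → ℂ, t = fun k => (weightFactor s₀ s₁ x (c + 2 * k) : ℂ) *
      ((1 + x (c + 2 * k) / s₂) * (1 + x (c + 2 * k) / s₃)) * g.eval (x (c + 2 * k) : ℂ) :=
    ⟨_, rfl⟩
  have hstep : ∀ k, (weight s₀ s₁ x (c + 2 * k) : ℂ) * f.eval (x (c + 2 * k) : ℂ) =
      ε * (t k - t (k + 1)) := by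
    intro k
    rw [weight, Complex.ofReal_mul, hε k, ht]
    simp only
    rw [show c + 2 * (k + 1) = c + 2 * k + 2 by ring, D.weightFactor_pearson, D.step]
    push_cast
    linear_combination ε * weightFactor s₀ s₁ x (c + 2 * k) * hfg (c + 2 * k)
  simp only [Function.comp_def, hstep]
  rw [show (-ε * g.eval 0) = ε * (0 - g.eval 0) by ring]
  simp only [← Finset.mul_sum]
  refine Tendsto.const_mul _ ?_
  have ht0 : t 0 = 0 := by
    rw [ht]; simp only [mul_zero, add_zero]; rw [hc]; ring
  have hsum : ∀ N, ∑ k ∈ Finset.range N, (t k - t (k + 1)) = 0 - t N := fun N => by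
    rw [Finset.sum_range_sub', ht0]
  simp only [hsum]
  refine Tendsto.const_sub _ ?_
  rw [ht]
  have hx : Tendsto (fun k : ℕ => c + 2 * k) atTop atTop :=
    tendsto_atTop_mono (fun k => by dsimp; omega) tendsto_id
  have hx0 : Tendsto (fun k : ℕ => (x (c + 2 * k) : ℂ)) atTop (𝓝 0) := by
    have := (D.tendsto_eval_x Polynomial.X).comp hx
    simpa [Function.comp_def] using this
  have hv : Tendsto (fun k : ℕ => (weightFactor s₀ s₁ x (c + 2 * k) : ℂ)) atTop (𝓝 1) := by
    have := (Complex.continuous_ofReal.tendsto 1).comp (tendsto_weightFactor s₀ s₁ x c)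
    simpa [Function.comp_def] using this
  have := (hv.mul (((hx0.div_const s₂).const_add 1).mul ((hx0.div_const s₃).const_add 1))).mul
    ((D.tendsto_eval_x g).comp hx)
  simpa [Function.comp_def] using this

/-- Summation by parts. -/
lemma weightSum_eq_zero {f g : Polynomial ℂ}
    (hfg : ∀ n, (x n : ℂ) * f.eval (x n : ℂ) = (1 + x n / s₂) * (1 + x n / s₃) * g.eval (x n : ℂ) -
      (1 + q * x n / s₀) * (1 + q * x n / s₁) * g.eval (q * x n : ℂ)) :
    D.weightSum f = 0 := by
  have h0 := D.tsum_chain 0 (ε := 1) (f := f) (g := g) (by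
    have : (x 0 : ℂ) ≠ 0 := by exact_mod_cast D.x_zero.ne'
    rw [D.s₂_eq, div_neg, div_self this]; ring) (fun k => by
    rw [zero_add, D.x_even, abs_of_pos (mul_pos D.x_zero (pow_pos D.q_pos _)), one_mul]) hfg
  have h1 := D.tsum_chain 1 (ε := -1) (f := f) (g := g) (by
    have : (x 1 : ℂ) ≠ 0 := by exact_mod_cast D.x_one.ne
    rw [D.s₃_eq, div_neg, div_self this]; ring) (fun k => by
    rw [add_comm 1, D.x_odd, abs_of_neg (mul_neg_of_neg_of_pos D.x_one (pow_pos D.q_pos _))]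
    push_cast; ring) hfg
  have hs := D.summable_weight_mul_eval f
  have h2 := tsum_even_add_odd (f := fun n => (weight s₀ s₁ x n : ℂ) * f.eval (x n : ℂ))
    (hs.comp_injective (i := fun k : ℕ => 2 * k) fun a b h => by simp only at h; omega)
    (hs.comp_injective (i := fun k : ℕ => 2 * k + 1) fun a b h => by simp only at h; omega)
  rw [weightSum_apply, ← h2]
  simp only [zero_add, add_comm 1] at h0 h1
  -- The halves contribute -g(0) and g(0).
  rw [h0, h1]
  ring

/-- Summation by parts with g(u) = ∏_{i<d} (u - x 1 · q^{i+1}). This g is adapted to the negative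
half-grid: (1 + u/s₃) g(u) is s₃⁻¹ times `gridPoly` of degree d+1, and g(qu) is q^d times that of
degree d. -/
lemma weightSum_gridPoly_succ (d : ℕ) :
    ((s₂ * s₃)⁻¹ - (q : ℂ) ^ (d + 2) * (s₀ * s₁)⁻¹) * D.weightSum (gridPoly q x (d + 1)) +
      s₃⁻¹ * (1 - (q : ℂ) ^ (d + 1) * s₃ / s₀) * (1 - (q : ℂ) ^ (d + 1) * s₃ / s₁) *
        D.weightSum (gridPoly q x d) = 0 := by
  have h := D.weightSum_eq_zero
    (f := ((s₂ * s₃)⁻¹ - (q : ℂ) ^ (d + 2) * (s₀ * s₁)⁻¹) • gridPoly q x (d + 1) +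
      (s₃⁻¹ * (1 - (q : ℂ) ^ (d + 1) * s₃ / s₀) * (1 - (q : ℂ) ^ (d + 1) * s₃ / s₁)) • gridPoly q x d)
    (g := ∏ i ∈ Finset.range d, (Polynomial.X - Polynomial.C ((x 1 : ℂ) * (q : ℂ) ^ (i + 1)))) ?_
  · rw [map_add, map_smul, map_smul] at h
    exact h
  · intro n
    have e1 : ∀ y : ℂ, (gridPoly q x (d + 1)).eval y = (y - x 1) * ∏ i ∈ Finset.range d,
        (y - (x 1 : ℂ) * (q : ℂ) ^ (i + 1)) := by
      intro y
      rw [gridPoly, Polynomial.eval_prod, Finset.prod_range_succ', mul_comm]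
      simp
    have e2 : ∀ y : ℂ, (gridPoly q x (d + 1)).eval y =
        (y - x 1 * (q : ℂ) ^ d) * (gridPoly q x d).eval y := by
      intro y
      rw [gridPoly_succ, Polynomial.eval_mul, mul_comm]
      simp
    have e3 : ∀ y : ℂ, ∏ i ∈ Finset.range d, (q * y - (x 1 : ℂ) * (q : ℂ) ^ (i + 1)) =
        (q : ℂ) ^ d * (gridPoly q x d).eval y := by
      intro y
      rw [gridPoly, Polynomial.eval_prod, show (q : ℂ) ^ d = ∏ _i ∈ Finset.range d, (q : ℂ) by simp,
        ← Finset.prod_mul_distrib]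
      refine Finset.prod_congr rfl fun i _ => ?_
      simp only [Polynomial.eval_sub, Polynomial.eval_X, Polynomial.eval_C]
      ring
    simp only [Polynomial.eval_add, Polynomial.eval_smul, smul_eq_mul, Polynomial.eval_prod,
      Polynomial.eval_sub, Polynomial.eval_X, Polynomial.eval_C, e3]
    have e4 := (e1 (x n)).symm.trans (e2 (x n))
    rw [e2]
    obtain ⟨G, hG⟩ : ∃ G, G = ∏ i ∈ Finset.range d, ((x n : ℂ) - x 1 * (q : ℂ) ^ (i + 1)) :=
      ⟨_, rfl⟩
    obtain ⟨P, hP⟩ : ∃ P, P = (gridPoly q x d).eval (x n : ℂ) := ⟨_, rfl⟩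
    rw [← hG, ← hP] at e4 ⊢
    have e5 : (1 + (x n : ℂ) / s₃) * G = s₃⁻¹ * ((x n + s₃ * (q : ℂ) ^ d) * P) := by
      have h3 := D.s₃_ne
      rw [show (x 1 : ℂ) = -s₃ by rw [D.s₃_eq, neg_neg]] at e4
      field_simp
      linear_combination e4
    rw [mul_assoc (1 + (x n : ℂ) / s₂), e5, show (x 1 : ℂ) = -s₃ by rw [D.s₃_eq, neg_neg]]
    have h0 := D.s₀_ne
    have h1 := D.s₁_ne
    have h2 := D.s₂_ne
    have h3 := D.s₃_ne
    field_simp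
    ring

/-- The recurrence of `weightSum_gridPoly_succ`, read off from the ratio of consecutive coefficients
at a = K-1, where s₂s₃ = -q^{-K} simplifies the Pochhammer symbols. -/
lemma racahCoeff_succ (d : ℕ) :
    ((s₂ * s₃)⁻¹ - (q : ℂ) ^ (d + 2) * (s₀ * s₁)⁻¹) *
        racahCoeff q s₂ s₁ s₀ s₃ ((K : ℤ) - 1) (d + 1) +
      s₃⁻¹ * (1 - (q : ℂ) ^ (d + 1) * s₃ / s₀) * (1 - (q : ℂ) ^ (d + 1) * s₃ / s₁) *
        racahCoeff q s₂ s₁ s₀ s₃ ((K : ℤ) - 1) d = 0 := by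
  have hq := D.q_ne
  obtain ⟨k, hk⟩ : ∃ k, k = (q : ℂ) ^ (K : ℤ) := ⟨_, rfl⟩
  have hk0 : k ≠ 0 := hk ▸ zpow_ne_zero _ hq
  obtain ⟨t, ht⟩ : ∃ t, t = (q : ℂ) ^ d := ⟨_, rfl⟩
  have ht0 : t ≠ 0 := ht ▸ pow_ne_zero _ hq
  have hti : (q : ℂ) ^ (d : ℤ) = t := by rw [ht, zpow_natCast]
  have h23 : s₂ * s₃ = -k⁻¹ := by rw [D.s₂_mul_s₃, zpow_neg, hk]
  have h2 : s₂ = -(k * s₃)⁻¹ := by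
    have := D.s₃_ne
    field_simp at h23 ⊢
    linear_combination h23
  have z1 : (q : ℂ) ^ ((K : ℤ) - 1 - d) = k / (q * t) := by
    rw [zpow_sub₀ hq, zpow_sub₀ hq, hti, ← hk, zpow_one]; field_simp
  have z2 : (q : ℂ) ^ (2 * ((K : ℤ) - 1) - d) = k ^ 2 / (q ^ 2 * t) := by
    rw [zpow_sub₀ hq, hti, two_mul, zpow_add₀ hq, zpow_sub₀ hq, ← hk, zpow_one]; field_simp
  have p1 : ∀ c : ℂ, zPoch q c ((K : ℤ) - 1 - ((d + 1 : ℕ) : ℤ) + 1) (d + 1) =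
      (1 - c * (k / (q * t))) * zPoch q c ((K : ℤ) - 1 - d + 1) d := by
    intro c
    rw [show (K : ℤ) - 1 - ((d + 1 : ℕ) : ℤ) + 1 = K - 1 - d by push_cast; ring,
      zPoch_succ' D.q_pos, z1]
  have p2 : ∀ c : ℂ, zPoch q c (2 * ((K : ℤ) - 1) - ((d + 1 : ℕ) : ℤ) + 1) (d + 1) =
      (1 - c * (k ^ 2 / (q ^ 2 * t))) * zPoch q c (2 * ((K : ℤ) - 1) - d + 1) d := by
    intro c
    rw [show 2 * ((K : ℤ) - 1) - ((d + 1 : ℕ) : ℤ) + 1 = 2 * ((K : ℤ) - 1) - d by push_cast; ring,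
      zPoch_succ' D.q_pos, z2]
  have w1 : (q : ℂ) ^ (((K : ℤ) - 1 - ((d + 1 : ℕ) : ℤ) + 1) * ((d + 1 : ℕ) : ℤ)) =
      (q : ℂ) ^ (((K : ℤ) - 1 - d + 1) * d) * (k / (q * t ^ 2)) := by
    rw [show ((K : ℤ) - 1 - ((d + 1 : ℕ) : ℤ) + 1) * ((d + 1 : ℕ) : ℤ) =
      ((K : ℤ) - 1 - d + 1) * d + (K - 1 - d) + -(d : ℤ) by push_cast; ring, zpow_add₀ hq,
      zpow_add₀ hq, z1, zpow_neg, hti]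
    field_simp
  rw [racahCoeff_eq, racahCoeff_eq, p1, p1, p1, p2, w1, qPoch_succ, ← ht]
  obtain ⟨Z, hZ⟩ : ∃ Z, Z = (q : ℂ) ^ (((K : ℤ) - 1 - d + 1) * d) := ⟨_, rfl⟩
  obtain ⟨P1, hP1⟩ : ∃ P, P = zPoch q (-(s₂ * s₁)) ((K : ℤ) - 1 - d + 1) d := ⟨_, rfl⟩
  obtain ⟨P2, hP2⟩ : ∃ P, P = zPoch q (-(s₂ * s₀)) ((K : ℤ) - 1 - d + 1) d := ⟨_, rfl⟩
  obtain ⟨P3, hP3⟩ : ∃ P, P = zPoch q (-(s₂ * s₃)) ((K : ℤ) - 1 - d + 1) d := ⟨_, rfl⟩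
  obtain ⟨S, hS⟩ : ∃ P, P = zPoch q (s₂ * s₁ * s₀ * s₃) (2 * ((K : ℤ) - 1) - d + 1) d := ⟨_, rfl⟩
  obtain ⟨Q, hQ⟩ : ∃ P, P = qPoch q (q : ℂ) d := ⟨_, rfl⟩
  have hQ0 : Q ≠ 0 := hQ ▸ qPoch_self_ne_zero D.q_pos D.q_lt_one d
  have hZ0 : Z ≠ 0 := hZ ▸ zpow_ne_zero _ hq
  have hS0 : S ≠ 0 := hS ▸ zPoch_ne_zero D.q_pos (by
    rw [show s₂ * s₁ * s₀ * s₃ = s₀ * s₁ * s₂ * s₃ by ring]; exact D.prod_mul_zpow_ne_one) _ _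
  have hQ1 : 1 - (q : ℂ) * t ≠ 0 := by
    rw [ht, ← pow_succ']; exact one_sub_q_pow_ne_zero D.q_pos D.q_lt_one d
  have hM : 1 - s₂ * s₁ * s₀ * s₃ * (k ^ 2 / (q ^ 2 * t)) ≠ 0 := by
    rw [← z2, sub_ne_zero, show s₂ * s₁ * s₀ * s₃ = s₀ * s₁ * s₂ * s₃ by ring]
    exact (D.prod_mul_zpow_ne_one _).symm
  rw [← hZ, ← hP1, ← hP2, ← hP3, ← hS, ← hQ, h23]
  rw [show s₂ * s₁ * s₀ * s₃ * (k ^ 2 / (q ^ 2 * t)) = -(s₀ * s₁ * k / (q ^ 2 * t)) by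
    rw [show s₂ * s₁ * s₀ * s₃ = s₀ * s₁ * (s₂ * s₃) by ring, h23]; field_simp] at hM ⊢
  have hM2 : 1 + s₀ * s₁ * k / (q ^ 2 * t) ≠ 0 := by rwa [sub_neg_eq_add] at hM
  rw [sub_neg_eq_add]
  obtain ⟨M, hMd⟩ : ∃ M, M = 1 + s₀ * s₁ * k / (q ^ 2 * t) := ⟨_, rfl⟩
  obtain ⟨Q1, hQ1d⟩ : ∃ M, M = 1 - (q : ℂ) * t := ⟨_, rfl⟩
  have e1 : (-k⁻¹)⁻¹ - (q : ℂ) ^ (d + 2) * (s₀ * s₁)⁻¹ = -(q ^ 2 * t / (s₀ * s₁)) * M := by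
    have h0 := D.s₀_ne
    have h1 := D.s₁_ne
    rw [hMd, pow_add, ← ht]; field_simp; ring
  have e3 : 1 - -(-k⁻¹) * (k / (q * t)) = -(Q1 / (q * t)) := by
    rw [hQ1d]; field_simp; ring
  have e2 : ∀ s : ℂ, s ≠ 0 → 1 - -(s₂ * s) * (k / (q * t)) =
      -(s / (s₃ * q * t)) * (1 - q ^ (d + 1) * s₃ / s) := by
    intro s hs
    have := D.s₃_ne
    rw [h2, pow_succ, ← ht]; field_simp; ring
  rw [← hMd] at hM2 ⊢
  rw [← hQ1d] at hQ1 ⊢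
  rw [e1, e3, e2 s₀ D.s₀_ne, e2 s₁ D.s₁_ne]
  obtain ⟨U0, hU0⟩ : ∃ U, U = 1 - (q : ℂ) ^ (d + 1) * s₃ / s₀ := ⟨_, rfl⟩
  obtain ⟨U1, hU1⟩ : ∃ U, U = 1 - (q : ℂ) ^ (d + 1) * s₃ / s₁ := ⟨_, rfl⟩
  rw [← hU0, ← hU1, pow_succ s₂ d]
  have h0 := D.s₀_ne
  have h1 := D.s₁_ne
  have h2' := D.s₂_ne
  have h3 := D.s₃_ne
  have h2e : k * s₃ * s₂ = -1 := by rw [h2]; field_simp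
  field_simp
  linear_combination U1 * P1 * U0 * P2 * P3 * h2e

omit D in
-- The e+1 linear factors of the polynomial cancel the inverse series G_e completely and lower the
-- shift from e to -1; only coefficients of positive degree of the series 1 are then paired.
lemma pair_gridPoly_succ_mul {G : ℕ → PowerSeries ℂ}
    (hG : ∀ e, G e * ∏ i ∈ Finset.range (e + 1), lin ((x 1 : ℂ) * (q : ℂ) ^ i) = 1) (e : ℕ)
    (f : Polynomial ℂ) : pair (G e) e (gridPoly q x (e + 1) * f) = 0 := by
  have hunit : ∀ n : ℕ, ∏ i ∈ Finset.range n, lin ((x 1 : ℂ) * (q : ℂ) ^ i) ≠ 0 := fun n h => by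
    cases n with
    | zero => simp at h
    | succ n => have := hG n; rw [h, mul_zero] at this; exact zero_ne_one this
  induction e generalizing f with
  | zero =>
    have h0 := hG 0
    rw [zero_add, Finset.prod_range_one, mul_comm] at h0
    rw [gridPoly_succ, gridPoly, Finset.prod_range_zero, one_mul, pair_X_sub_C_mul, h0, pair_eq_sum]
    refine Finset.sum_eq_zero fun p _ => ?_
    rw [show (p : ℤ) - (((0 : ℕ) : ℤ) - 1) = ((p + 1 : ℕ) : ℤ) by push_cast; ring, coeffZ_natCast,
      PowerSeries.coeff_one, if_neg p.succ_ne_zero, zero_mul]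
  | succ e ih =>
    have h1 : lin ((x 1 : ℂ) * (q : ℂ) ^ (e + 1)) * G (e + 1) = G e := by
      refine mul_right_cancel₀ (hunit (e + 1)) ?_
      rw [hG e, ← hG (e + 1), Finset.prod_range_succ _ (e + 1)]
      ring
    rw [gridPoly_succ, mul_comm (gridPoly q x (e + 1)), mul_assoc, pair_X_sub_C_mul, h1,
      show ((e + 1 : ℕ) : ℤ) - 1 = e by push_cast; ring]
    exact ih f

/-- In the expansion of F_{K-1} H with s₂ as base parameter, the terms e < d vanish by divisibility,
the terms e > d for reasons of degree, and e = d pairs to 1. -/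
lemma momentFun_zero_gridPoly (d : ℕ) : momentFun q K s₀ s₁ s₂ s₃ x 0 (gridPoly q x d) =
    racahCoeff q s₂ s₁ s₀ s₃ ((K : ℤ) - 1) d := by
  obtain ⟨G, hGd⟩ : ∃ G : ℕ → PowerSeries ℂ, G = fun e : ℕ =>
    nodeSeries q s₂ ((K : ℤ) - 1 - e) * hSeries x := ⟨_, rfl⟩
  have hG : ∀ e, G e * ∏ i ∈ Finset.range (e + 1), lin ((x 1 : ℂ) * (q : ℂ) ^ i) = 1 := by
    intro e
    have h := D.nodeSeries_sub_mul_hSeries (e + 1)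
    rw [D.s₃_eq, neg_neg, show (K : ℤ) - ((e + 1 : ℕ) : ℤ) = K - 1 - e by push_cast; ring] at h
    rw [hGd]
    exact h
  obtain ⟨hmon, hdeg⟩ := gridPoly_monic_natDegree q x d
  have hsum : momentFun q K s₀ s₁ s₂ s₃ x 0 (gridPoly q x d) = ∑ e ∈ Finset.range (d + 1),
      racahCoeff q s₂ s₁ s₀ s₃ ((K : ℤ) - 1) e * pair (G e) e (gridPoly q x d) := by
    simp only [momentFun, pair_eq_sum, Finset.mul_sum]
    rw [Finset.sum_comm]
    refine Finset.sum_congr rfl fun p hp => ?_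
    have hpd : p ≤ d := hdeg ▸ Polynomial.le_natDegree_of_mem_supp p hp
    rw [sub_zero, sub_zero, D.racahSeries_eq_swap,
      coeffZ_racahSeries_mul q s₂ s₁ s₀ s₃ _ p (d + 1) (by omega), Finset.sum_mul]
    refine Finset.sum_congr rfl fun e _ => ?_
    rw [hGd, mul_assoc]
  rw [hsum, Finset.sum_range_succ, Finset.sum_eq_zero, zero_add]
  · have h1 : pair (G d) d (gridPoly q x d) = 1 := by
      have := pair_of_monic (G := G d) (by
        have h2 := congrArg PowerSeries.constantCoeff (hG d)
        simpa [map_prod] using h2) hmon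
      rwa [hdeg] at this
    rw [h1, mul_one]
  · intro e he
    rw [Finset.mem_range] at he
    obtain ⟨f, hf⟩ : gridPoly q x (e + 1) ∣ gridPoly q x d :=
      Finset.prod_dvd_prod_of_subset _ _ _ (Finset.range_subset_range.mpr he)
    rw [hf, pair_gridPoly_succ_mul hG, mul_zero]

lemma weightSum_one : D.weightSum 1 = ((∑' n, weight s₀ s₁ x n : ℝ) : ℂ) := by
  rw [weightSum_apply, Complex.ofReal_tsum]
  simp

/-- The zeroth moment functional is the weighted sum over the grid. -/
theorem weightSum_eq (f : Polynomial ℂ) :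
    D.weightSum f = D.weightSum 1 * momentFun q K s₀ s₁ s₂ s₃ x 0 f := by
  have key : D.weightSum = D.weightSum 1 • momentFun q K s₀ s₁ s₂ s₃ x 0 := by
    refine linearMap_ext_of_monic (gridPoly_monic_natDegree q x) fun d => ?_
    rw [LinearMap.smul_apply, smul_eq_mul, D.momentFun_zero_gridPoly]
    induction d with
    | zero => rw [racahCoeff_zero, mul_one]; simp [gridPoly]
    | succ d ih =>
      have h1 := D.weightSum_gridPoly_succ d
      have h2 := D.racahCoeff_succ d
      rw [ih] at h1
      -- The leading factor of the common first-order recurrence is negative, since s₂s₃ < 0 < s₀s₁;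
      -- hence the recurrence determines all values from d = 0.
      have hne : (s₂ * s₃)⁻¹ - (q : ℂ) ^ (d + 2) * (s₀ * s₁)⁻¹ ≠ 0 := by
        obtain ⟨e₁, e₂, -, h4, h5, -⟩ := D.exists_real
        rw [D.s₂_mul_s₃, h4]
        have h6 : (0 : ℝ) < (q ^ (-(K : ℤ)))⁻¹ + q ^ (d + 2) * e₂⁻¹ :=
          add_pos (inv_pos.mpr (zpow_pos D.q_pos _))
            (mul_pos (pow_pos D.q_pos _) (inv_pos.mpr h5))
        have h7 : (-((q : ℂ) ^ (-(K : ℤ))))⁻¹ - (q : ℂ) ^ (d + 2) * (e₂ : ℂ)⁻¹ =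
            ((-((q ^ (-(K : ℤ)))⁻¹ + q ^ (d + 2) * e₂⁻¹) : ℝ) : ℂ) := by
          push_cast; rw [inv_neg]; ring
        rw [h7]
        exact_mod_cast (neg_lt_zero.mpr h6).ne
      refine mul_left_cancel₀ hne ?_
      linear_combination h1 - D.weightSum 1 * h2
  exact DFunLike.congr_fun key f

end RacahData

/-! ### Configurations with finite complement -/

/-- The sequence `x` with the entries at the indices in `T` replaced by zeros. -/
def removeSeq (x : ℕ → ℝ) (T : Finset ℕ) (n : ℕ) : ℝ := if n ∈ T then 0 else x n

lemma summable_abs_removeSeq {x : ℕ → ℝ} (hx : Summable fun n => |x n|) (T : Finset ℕ) :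
    Summable fun n => |removeSeq x T n| :=
  hx.of_nonneg_of_le (fun _ => abs_nonneg _) fun n => by
    unfold removeSeq; split_ifs
    · rw [abs_zero]; exact abs_nonneg _
    · exact le_rfl

lemma hSeries_removeSeq {x : ℕ → ℝ} (hx : Summable fun n => |x n|) (T : Finset ℕ) :
    hSeries (removeSeq x T) = hSeries x * ∏ n ∈ T, lin (x n : ℂ) := by
  induction T using Finset.induction_on with
  | empty =>
    rw [Finset.prod_empty, mul_one]
    congr 1
  | insert a T ha ih =>
    have h := lin_mul_hSeries (summable_abs_removeSeq hx T).of_abs a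
    have h1 : removeSeq x T a = x a := by simp [removeSeq, ha]
    have h2 : Function.update (removeSeq x T) a 0 = removeSeq x (insert a T) := by
      funext n
      rcases eq_or_ne n a with rfl | hn
      · simp [removeSeq]
      · rw [Function.update_of_ne hn]
        simp [removeSeq, hn]
    rw [h1, h2] at h
    rw [← h, ih, Finset.prod_insert ha]
    ring

lemma pair_X_pow_mul (G : PowerSeries ℂ) (m : ℤ) (k : ℕ) (f : Polynomial ℂ) :
    pair G m (Polynomial.X ^ k * f) = pair G (m - k) f := by
  induction k generalizing m with
  | zero => simp
  | succ k ih =>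
    rw [pow_succ', mul_assoc, pair_X_mul, ih]
    congr 2; push_cast; ring

lemma pair_prod_X_sub_C {ι : Type*} (s : Finset ι) (c : ι → ℂ) (G : PowerSeries ℂ) (m : ℤ) :
    pair G m (∏ i ∈ s, (Polynomial.X - Polynomial.C (c i))) =
      coeffZ ((s.card : ℤ) - m) (G * ∏ i ∈ s, lin (c i)) := by
  classical
  induction s using Finset.induction_on generalizing G m with
  | empty =>
    rw [Finset.prod_empty, Finset.prod_empty, mul_one, ← Polynomial.monomial_zero_one,
      pair_monomial, mul_one]
    simp
  | insert a s ha ih =>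
    rw [Finset.prod_insert ha, pair_X_sub_C_mul, ih, Finset.prod_insert ha,
      Finset.card_insert_of_notMem ha]
    congr 1
    · push_cast; ring
    · ring

/-- The determinant of a matrix of values of functionals on a family of monic polynomials does not
depend on the family. -/
lemma det_eq_of_monic {ι : Type*} [Fintype ι] [DecidableEq ι] {N : ℕ} (e : ι ≃ Fin N)
    (ℓ : ι → Polynomial ℂ →ₗ[ℂ] ℂ) {f g : ℕ → Polynomial ℂ}
    (hf : ∀ d, (f d).Monic ∧ (f d).natDegree = d) (hg : ∀ d, (g d).Monic ∧ (g d).natDegree = d) :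
    (Matrix.of fun r c : ι => ℓ r (f (e c))).det = (Matrix.of fun r c : ι => ℓ r (g (e c))).det := by
  have key : ∀ f : ℕ → Polynomial ℂ, (∀ d, (f d).Monic ∧ (f d).natDegree = d) →
      (Matrix.of fun r c : ι => ℓ r (f (e c))).det =
        (Matrix.of fun r c : ι => ℓ r (Polynomial.X ^ (e c : ℕ))).det := by
    intro f hf
    have h1 := Matrix.det_matrixOfPolynomials (fun i : Fin N => f i) (fun i => (hf i).2)
      fun i => (hf i).1
    have h2 : (Matrix.of fun r c : ι => ℓ r (f (e c))) =
        (Matrix.of fun r c : ι => ℓ r (Polynomial.X ^ (e c : ℕ))) *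
          (Matrix.of fun i j : Fin N => (f j).coeff i).submatrix e e := by
      ext r c
      rw [Matrix.mul_apply]
      simp only [Matrix.of_apply, Matrix.submatrix_apply]
      rw [Equiv.sum_comp e fun i : Fin N =>
        ℓ r (Polynomial.X ^ (i : ℕ)) * (f (e c)).coeff i]
      conv_lhs => rw [(f (e c)).as_sum_range' N (by rw [(hf _).2]; exact (e c).2)]
      rw [map_sum, Finset.sum_range]
      refine Finset.sum_congr rfl fun i _ => ?_
      rw [← Polynomial.C_mul_X_pow_eq_monomial, Polynomial.C_mul', map_smul, smul_eq_mul, mul_comm]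
    rw [h2, Matrix.det_mul, Matrix.det_submatrix_equiv_self, h1, mul_one]
  rw [key f hf, key g hg]

/-- The Vandermonde determinant of the points with indices `y 0, y 1, …`. -/
def vandAt {K : ℕ} (x : ℕ → ℝ) (y : Fin K → ℕ) : ℂ :=
  (Matrix.vandermonde fun k => (x (y k) : ℂ)).det

/-- The minors of the matrix of values of the orthogonal polynomials. -/
def orthDet {K : ℕ} (q : ℝ) (s₀ s₁ s₂ s₃ : ℂ) (x : ℕ → ℝ) (s : Fin K → ℕ) (y : Fin K → ℕ) : ℂ :=
  (Matrix.of fun k j : Fin K => (orthPoly q K s₀ s₁ s₂ s₃ (s j)).eval (x (y k) : ℂ)).det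

namespace RacahData

variable {q : ℝ} {K : ℕ} {s₀ s₁ s₂ s₃ : ℂ} {x : ℕ → ℝ} (D : RacahData q K s₀ s₁ s₂ s₃ x)

include D

lemma momentFun_orthPoly (m n : ℕ) :
    momentFun q K s₀ s₁ s₂ s₃ x m (orthPoly q K s₀ s₁ s₂ s₃ n) = if m = n then 1 else 0 := by
  have h := D.momentFun_orthPoly_mul m (orthPoly q K s₀ s₁ s₂ s₃ n)
  rw [D.momentFun_orthPoly_mul_orthPoly] at h
  have h0 := D.orthNorm_ne_zero m
  split_ifs at h ⊢ with hmn
  · exact (mul_left_cancel₀ h0 (by rw [mul_one]; exact h)).symm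
  · exact (mul_eq_zero.mp h.symm).resolve_left h0

/-- Removing K points multiplies H by ∏(1 - x w); in the pairing this is the factor ∏(u - x) in the
polynomial and a shift by K. -/
lemma evalAt_Phi_removeSeq (lam : YoungDiagram) {n : ℕ} (hn : lam.colLen 0 ≤ n) {y : Fin K → ℕ}
    (hy : Function.Injective y) :
    evalAt (Phi q s₀ s₁ s₂ s₃ lam) (removeSeq x (Finset.univ.image y)) =
      (Matrix.of fun i k : Fin n => momentFun q K s₀ s₁ s₂ s₃ x ((K : ℤ) + i - lam.rowLen i)
        (Polynomial.X ^ (k : ℕ) *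
          ∏ j : Fin K, (Polynomial.X - Polynomial.C (x (y j) : ℂ)))).det := by
  rw [evalAt_Phi D.q_pos D.q_lt_one D.s₀_ne s₁ s₂ s₃ (summable_abs_removeSeq D.summable_abs _).of_abs
    lam n hn]
  congr 2
  funext i k
  rw [hSeries_removeSeq D.summable_abs, Finset.prod_image fun _ _ _ _ h => hy h, momentFun,
    pair_X_pow_mul, pair_prod_X_sub_C, Finset.card_univ, Fintype.card_fin, mul_assoc,
    show (K : ℤ) - 1 - (K + i - lam.rowLen i) = (lam.rowLen i : ℤ) - i - 1 by ring,
    show (K : ℤ) - ((K : ℤ) + i - lam.rowLen i - k) = (lam.rowLen i : ℤ) - i + k by ring]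

/-- `Φ_λ` vanishes on the configurations whose complement has `K` points if `λ₁ > K`. -/
lemma evalAt_Phi_eq_zero {lam : YoungDiagram} (h : K < lam.rowLen 0) {y : Fin K → ℕ}
    (hy : Function.Injective y) :
    evalAt (Phi q s₀ s₁ s₂ s₃ lam) (removeSeq x (Finset.univ.image y)) = 0 := by
  have hn : 0 < lam.colLen 0 := by
    by_contra h0
    rw [colLen_le_iff.mp (not_lt.mp h0)] at h
    omega
  rw [D.evalAt_Phi_removeSeq lam le_rfl hy]
  -- The first row uses the functional with index K - λ₁ < 0.
  refine Matrix.det_eq_zero_of_row_eq_zero ⟨0, hn⟩ fun k => ?_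
  exact D.momentFun_of_neg (by simp only [Nat.cast_zero]; omega) _

omit D in
lemma vandAt_eq_zero {y : Fin K → ℕ} (hy : ¬ Function.Injective y) : vandAt x y = 0 := by
  by_contra h
  exact hy fun _ _ hab => Matrix.det_vandermonde_ne_zero_iff.mp h (by simp only [hab])

/-- On the configurations whose complement has `K` points, the function `Φ_λ` is the ratio of a minor
of the matrix of values of the orthogonal polynomials and the Vandermonde determinant. -/
theorem exists_vandAt_mul_evalAt_Phi {lam : YoungDiagram} (h : lam.rowLen 0 ≤ K) {n : ℕ}
    (hn : lam.colLen 0 ≤ n) : ∃ (s : Fin K → ℕ) (ε : ℂ), StrictMono s ∧ (ε = 1 ∨ ε = -1) ∧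
      (∀ j, j ∈ Set.range s ↔ j < K + n ∧ ∀ i : Fin n, (j : ℤ) ≠ (K : ℤ) + i - lam.rowLen i) ∧
      ∀ y : Fin K → ℕ, vandAt x y *
        evalAt (Phi q s₀ s₁ s₂ s₃ lam) (removeSeq x (Finset.univ.image y)) =
          ε * orthDet q s₀ s₁ s₂ s₃ x s y := by
  classical
  have hle : ∀ i, lam.rowLen i ≤ K := fun i => (lam.rowLen_anti 0 i (Nat.zero_le _)).trans h
  let m : Fin n → Fin (K + n) := fun i => ⟨K + i - lam.rowLen i, by omega⟩
  have hm : StrictMono m := by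
    intro i j hij
    have h1 := lam.rowLen_anti i j hij.le
    have h2 : (i : ℕ) < j := hij
    have h3 := hle i
    change K + i - lam.rowLen i < K + j - lam.rowLen j
    omega
  have hmZ : ∀ i : Fin n, (K : ℤ) + i - lam.rowLen i = ((m i : ℕ) : ℤ) := by
    intro i
    have h3 := hle i
    change _ = ((K + i - lam.rowLen i : ℕ) : ℤ)
    omega
  -- S has K elements, and its increasing enumeration is s. The bijection e lists S first and then
  -- the numbers m_i; its sign is ε.
  obtain ⟨S, hS⟩ : ∃ S : Finset (Fin (K + n)), S = (Finset.univ.image m)ᶜ := ⟨_, rfl⟩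
  have hSc : Sᶜ = Finset.univ.image m := by rw [hS, compl_compl]
  have hScard' : Sᶜ.card = n := by
    rw [hSc, Finset.card_image_of_injective _ hm.injective, Finset.card_univ, Fintype.card_fin]
  have hScard : S.card = K := by
    have := Finset.card_add_card_compl S
    rw [hScard', Fintype.card_fin] at this
    omega
  have hmu : m = Sᶜ.orderEmbOfFin hScard' := Finset.orderEmbOfFin_unique hScard' (fun i => by
    rw [hSc]; exact Finset.mem_image_of_mem _ (Finset.mem_univ _)) hm
  let e : Fin K ⊕ Fin n ≃ Fin (K + n) := finSumEquivOfFinset hScard hScard'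
  have hr : ∀ i, e (Sum.inr i) = m i := fun i => by rw [hmu]; rfl
  have hrange : ∀ j : Fin (K + n), (∃ k, e (Sum.inl k) = j) ↔ ∀ i, m i ≠ j := by
    intro j
    constructor
    · rintro ⟨k, rfl⟩ i hi
      rw [← hr] at hi
      exact Sum.inr_ne_inl (e.injective hi)
    · intro hj
      obtain ⟨c, rfl⟩ := e.surjective j
      cases c with
      | inl k => exact ⟨k, rfl⟩
      | inr i => exact absurd (hr i).symm (hj i)
  refine ⟨fun k => e (Sum.inl k), Equiv.Perm.sign (e.trans finSumFinEquiv.symm), ?_, ?_, ?_, ?_⟩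
  · intro i j hij
    exact (S.orderEmbOfFin hScard).strictMono hij
  · rcases Int.units_eq_one_or (Equiv.Perm.sign (e.trans finSumFinEquiv.symm)) with h | h <;>
      rw [h] <;> simp
  · intro j
    constructor
    · rintro ⟨k, rfl⟩
      refine ⟨(e (Sum.inl k)).2, fun i hi => ?_⟩
      rw [hmZ i] at hi
      exact (hrange _).mp ⟨k, rfl⟩ i (Fin.ext (by exact_mod_cast hi.symm))
    · rintro ⟨hj, hne⟩
      obtain ⟨k, hk⟩ := (hrange ⟨j, hj⟩).mpr fun i hi => hne i (by rw [hmZ, hi])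
      exact ⟨k, by simp only [hk]⟩
  · intro y
    -- Repeated points make both sides zero, as two rows coincide.
    by_cases hy : Function.Injective y
    swap
    · rw [vandAt_eq_zero hy, zero_mul, orthDet]
      simp only [Function.Injective, not_forall] at hy
      obtain ⟨a, b, hab, hne⟩ := hy
      rw [Matrix.det_zero_of_row_eq hne (funext fun j => by simp only [Matrix.of_apply, hab]),
        mul_zero]
    let P : Polynomial ℂ := ∏ j : Fin K, (Polynomial.X - Polynomial.C (x (y j) : ℂ))
    have hP : P.Monic ∧ P.natDegree = K := by
      refine ⟨Polynomial.monic_prod_of_monic _ _ fun i _ => Polynomial.monic_X_sub_C _, ?_⟩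
      change (∏ j : Fin K, (Polynomial.X - Polynomial.C (x (y j) : ℂ))).natDegree = K
      rw [Polynomial.natDegree_prod_of_monic _ _ fun i _ => Polynomial.monic_X_sub_C _]
      simp only [Polynomial.natDegree_X_sub_C, Finset.sum_const, Finset.card_univ, Fintype.card_fin,
        smul_eq_mul, mul_one]
    -- In this basis the polynomials of degree at least K are multiples of P and vanish at the
    -- points y, so the evaluation rows form the block (Vandermonde, 0).
    let f : ℕ → Polynomial ℂ := fun d =>
      if d < K then Polynomial.X ^ d else Polynomial.X ^ (d - K) * P
    have hf : ∀ d, (f d).Monic ∧ (f d).natDegree = d := by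
      intro d
      simp only [f]
      split_ifs with hd
      · exact ⟨Polynomial.monic_X_pow d, Polynomial.natDegree_X_pow d⟩
      · refine ⟨(Polynomial.monic_X_pow _).mul hP.1, ?_⟩
        rw [(Polynomial.monic_X_pow _).natDegree_mul hP.1, Polynomial.natDegree_X_pow, hP.2]
        omega
    -- The square system of K evaluations and n moment functionals is expanded in two monic bases.
    -- One gives V(y) Φ_λ; in the other, duality turns the moment rows into (0, 1) and leaves the
    -- minor of the orthogonal polynomials.
    let ℓ : Fin K ⊕ Fin n → Polynomial ℂ →ₗ[ℂ] ℂ := Sum.elim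
      (fun k => Polynomial.leval (x (y k) : ℂ))
      (fun i => momentFun q K s₀ s₁ s₂ s₃ x ((m i : ℕ) : ℤ))
    have hdet := det_eq_of_monic finSumFinEquiv ℓ hf (orthPoly_monic_natDegree q K s₀ s₁ s₂ s₃)
    have h1 : (Matrix.of fun r c : Fin K ⊕ Fin n => ℓ r (f (finSumFinEquiv c : Fin (K + n)))) =
        Matrix.fromBlocks (Matrix.vandermonde fun k => (x (y k) : ℂ)) 0
          (Matrix.of fun i j => ℓ (Sum.inr i) (f (finSumFinEquiv (Sum.inl j) : Fin (K + n))))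
          (Matrix.of fun i k : Fin n => momentFun q K s₀ s₁ s₂ s₃ x ((K : ℤ) + i - lam.rowLen i)
            (Polynomial.X ^ (k : ℕ) * P)) := by
      ext r c
      rcases r with r | r <;> rcases c with c | c
      · simp [ℓ, f, Polynomial.leval_apply, Matrix.vandermonde_apply]
      · have : P.eval (x (y r) : ℂ) = 0 := by
          change (∏ j : Fin K, (Polynomial.X - Polynomial.C (x (y j) : ℂ))).eval _ = 0
          rw [Polynomial.eval_prod]
          exact Finset.prod_eq_zero (Finset.mem_univ r) (by simp)
        simp [ℓ, f, Polynomial.leval_apply, this]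
      · simp
      · simp [ℓ, f, hmZ]
    have h2 : (Matrix.of fun r c : Fin K ⊕ Fin n =>
        ℓ r (orthPoly q K s₀ s₁ s₂ s₃ (e c))) =
        Matrix.fromBlocks (Matrix.of fun k j : Fin K =>
          (orthPoly q K s₀ s₁ s₂ s₃ (e (Sum.inl j))).eval (x (y k) : ℂ))
          (Matrix.of fun k i => ℓ (Sum.inl k) (orthPoly q K s₀ s₁ s₂ s₃ (e (Sum.inr i)))) 0 1 := by
      ext r c
      rcases r with r | r <;> rcases c with c | c
      · simp [ℓ, Polynomial.leval_apply]
      · simp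
      · simp only [ℓ, Matrix.of_apply, Sum.elim_inr, Matrix.fromBlocks_apply₂₁, Matrix.zero_apply]
        rw [D.momentFun_orthPoly, if_neg]
        intro hh
        exact (hrange (e (Sum.inl c))).mp ⟨c, rfl⟩ r (Fin.ext hh)
      · simp only [ℓ, Matrix.of_apply, Sum.elim_inr, Matrix.fromBlocks_apply₂₂, Matrix.one_apply]
        rw [D.momentFun_orthPoly, hr]
        congr 1
        rw [← Fin.ext_iff, hm.injective.eq_iff]
    have h3 : (Matrix.of fun r c : Fin K ⊕ Fin n => ℓ r (orthPoly q K s₀ s₁ s₂ s₃ (e c))) =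
        (Matrix.of fun r c : Fin K ⊕ Fin n => ℓ r (orthPoly q K s₀ s₁ s₂ s₃
          (finSumFinEquiv c : Fin (K + n)))).submatrix id (e.trans finSumFinEquiv.symm) := by
      ext r c
      simp
    have h4 := congrArg Matrix.det h3
    rw [h2, Matrix.det_permute', ← hdet, h1, Matrix.det_fromBlocks_zero₂₁,
      Matrix.det_fromBlocks_zero₁₂, Matrix.det_one, mul_one] at h4
    rw [D.evalAt_Phi_removeSeq lam hn hy, orthDet, h4, vandAt, ← mul_assoc]
    rcases Int.units_eq_one_or (Equiv.Perm.sign (e.trans finSumFinEquiv.symm)) with h | h <;>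
      rw [h] <;> simp [P]

end RacahData

/-! ### The orthogonal polynomial ensemble -/

lemma orthDet_eq_sum {K : ℕ} (q : ℝ) (s₀ s₁ s₂ s₃ : ℂ) (x : ℕ → ℝ) (s y : Fin K → ℕ) :
    orthDet q s₀ s₁ s₂ s₃ x s y = ∑ σ : Equiv.Perm (Fin K), ((Equiv.Perm.sign σ : ℤ) : ℂ) *
      ∏ k, (orthPoly q K s₀ s₁ s₂ s₃ (s (σ k))).eval (x (y k) : ℂ) := by
  rw [orthDet, ← Matrix.det_transpose, Matrix.det_apply']
  rfl

namespace RacahData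

variable {q : ℝ} {K : ℕ} {s₀ s₁ s₂ s₃ : ℂ} {x : ℕ → ℝ} (D : RacahData q K s₀ s₁ s₂ s₃ x)

include D

lemma tsum_ofReal_weight :
    ∑' n, ENNReal.ofReal (weight s₀ s₁ x n / ∑' n, weight s₀ s₁ x n) = 1 := by
  rw [← ENNReal.ofReal_tsum_of_nonneg
    (fun n => div_nonneg (D.weight_pos n).le D.tsum_weight_pos.le) (D.summable_weight.div_const _),
    tsum_div_const, div_self D.tsum_weight_pos.ne', ENNReal.ofReal_one]

/-- The normalized weights, as a probability mass function. -/
def gridPMF : PMF ℕ :=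
  ⟨fun n => ENNReal.ofReal (weight s₀ s₁ x n / ∑' n, weight s₀ s₁ x n),
    ENNReal.summable.hasSum_iff.mpr D.tsum_ofReal_weight⟩

lemma integrable_eval (f : Polynomial ℂ) :
    Integrable (fun n => f.eval (x n : ℂ)) D.gridPMF.toMeasure := by
  obtain ⟨C, hC⟩ := (Metric.isBounded_range_of_tendsto _ (D.tendsto_eval_x f)).exists_norm_le
  exact Integrable.of_bound (Measurable.of_discrete.aestronglyMeasurable) C
    (Eventually.of_forall fun n => hC _ ⟨n, rfl⟩)

lemma integral_eval (f : Polynomial ℂ) :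
    ∫ n, f.eval (x n : ℂ) ∂D.gridPMF.toMeasure = momentFun q K s₀ s₁ s₂ s₃ x 0 f := by
  have h := D.weightSum_eq f
  have hW := D.weightSum_one
  have hW0 : ((∑' n, weight s₀ s₁ x n : ℝ) : ℂ) ≠ 0 := by exact_mod_cast D.tsum_weight_pos.ne'
  rw [PMF.integral_eq_tsum _ _ (D.integrable_eval f)]
  have e : ∀ n, (D.gridPMF n).toReal • f.eval (x n : ℂ) =
      ((∑' n, weight s₀ s₁ x n : ℝ) : ℂ)⁻¹ * ((weight s₀ s₁ x n : ℂ) * f.eval (x n : ℂ)) := by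
    intro n
    change (ENNReal.ofReal (weight s₀ s₁ x n / ∑' n, weight s₀ s₁ x n)).toReal • _ = _
    rw [ENNReal.toReal_ofReal (div_nonneg (D.weight_pos n).le D.tsum_weight_pos.le),
      Complex.real_smul]
    push_cast
    ring
  simp only [e]
  rw [tsum_mul_left, ← D.weightSum_apply, h, hW, inv_mul_cancel_left₀ hW0]

/-- The distribution of `K` independent points of the grid. -/
def tupleMeasure : Measure (Fin K → ℕ) := Measure.pi fun _ => D.gridPMF.toMeasure

lemma integrable_prod_eval (f : Fin K → Polynomial ℂ) :
    Integrable (fun y : Fin K → ℕ => ∏ k, (f k).eval (x (y k) : ℂ)) D.tupleMeasure :=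
  Integrable.fintype_prod (f := fun k (n : ℕ) => (f k).eval (x n : ℂ)) fun k => D.integrable_eval (f k)

lemma integral_prod_eval (f : Fin K → Polynomial ℂ) :
    ∫ y, ∏ k, (f k).eval (x (y k) : ℂ) ∂D.tupleMeasure =
      ∏ k, momentFun q K s₀ s₁ s₂ s₃ x 0 (f k) := by
  rw [tupleMeasure, integral_fintype_prod_eq_prod fun k (n : ℕ) => (f k).eval (x n : ℂ)]
  simp only [D.integral_eval]

omit D in
lemma orthDet_mul_orthDet (s t y : Fin K → ℕ) :
    orthDet q s₀ s₁ s₂ s₃ x s y * orthDet q s₀ s₁ s₂ s₃ x t y =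
      ∑ σ : Equiv.Perm (Fin K), ∑ τ : Equiv.Perm (Fin K),
        (((Equiv.Perm.sign σ : ℤ) : ℂ) * ((Equiv.Perm.sign τ : ℤ) : ℂ)) *
          ∏ k, (orthPoly q K s₀ s₁ s₂ s₃ (s (σ k)) *
            orthPoly q K s₀ s₁ s₂ s₃ (t (τ k))).eval (x (y k) : ℂ) := by
  rw [orthDet_eq_sum, orthDet_eq_sum, Finset.sum_mul_sum]
  refine Finset.sum_congr rfl fun σ _ => Finset.sum_congr rfl fun τ _ => ?_
  simp only [Polynomial.eval_mul, Finset.prod_mul_distrib]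
  ring

lemma integrable_orthDet_mul_orthDet (s t : Fin K → ℕ) :
    Integrable (fun y => orthDet q s₀ s₁ s₂ s₃ x s y * orthDet q s₀ s₁ s₂ s₃ x t y)
      D.tupleMeasure := by
  simp only [orthDet_mul_orthDet]
  exact integrable_finsetSum _ fun σ _ => integrable_finsetSum _ fun τ _ =>
    (D.integrable_prod_eval _).const_mul _

/-- Andréief's identity: both determinants are expanded, and independence of the K points factors
each integral into one-point pairings. -/
lemma integral_orthDet_mul_orthDet (s t : Fin K → ℕ) :
    ∫ y, orthDet q s₀ s₁ s₂ s₃ x s y * orthDet q s₀ s₁ s₂ s₃ x t y ∂D.tupleMeasure =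
      ∑ σ : Equiv.Perm (Fin K), ∑ τ : Equiv.Perm (Fin K),
        (((Equiv.Perm.sign σ : ℤ) : ℂ) * ((Equiv.Perm.sign τ : ℤ) : ℂ)) *
          ∏ k, if s (σ k) = t (τ k) then orthNorm q K s₀ s₁ s₂ s₃ (s (σ k)) else 0 := by
  simp only [orthDet_mul_orthDet]
  rw [integral_finsetSum _ fun σ _ => integrable_finsetSum _ fun τ _ =>
    (D.integrable_prod_eval _).const_mul _]
  refine Finset.sum_congr rfl fun σ _ => ?_
  rw [integral_finsetSum _ fun τ _ => (D.integrable_prod_eval _).const_mul _]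
  refine Finset.sum_congr rfl fun τ _ => ?_
  rw [integral_const_mul, D.integral_prod_eval]
  simp only [D.momentFun_orthPoly_mul_orthPoly]

lemma integral_orthDet_mul_orthDet_of_range_ne {s t : Fin K → ℕ} (h : Set.range s ≠ Set.range t) :
    ∫ y, orthDet q s₀ s₁ s₂ s₃ x s y * orthDet q s₀ s₁ s₂ s₃ x t y ∂D.tupleMeasure = 0 := by
  rw [D.integral_orthDet_mul_orthDet]
  refine Finset.sum_eq_zero fun σ _ => Finset.sum_eq_zero fun τ _ => ?_
  obtain ⟨k, hk⟩ : ∃ k, s (σ k) ≠ t (τ k) := by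
    by_contra! hall
    refine h ?_
    rw [← σ.surjective.range_comp s, ← τ.surjective.range_comp t]
    congr 1
    exact funext hall
  rw [Finset.prod_eq_zero (Finset.mem_univ k) (if_neg hk), mul_zero]

lemma integral_orthDet_mul_self {s : Fin K → ℕ} (hs : Function.Injective s) :
    ∫ y, orthDet q s₀ s₁ s₂ s₃ x s y * orthDet q s₀ s₁ s₂ s₃ x s y ∂D.tupleMeasure =
      (K.factorial : ℂ) * ∏ k, orthNorm q K s₀ s₁ s₂ s₃ (s k) := by
  rw [D.integral_orthDet_mul_orthDet]
  have h1 : ∀ σ : Equiv.Perm (Fin K), ∑ τ : Equiv.Perm (Fin K),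
      (((Equiv.Perm.sign σ : ℤ) : ℂ) * ((Equiv.Perm.sign τ : ℤ) : ℂ)) *
          (∏ k, if s (σ k) = s (τ k) then orthNorm q K s₀ s₁ s₂ s₃ (s (σ k)) else 0) =
      ∏ k, orthNorm q K s₀ s₁ s₂ s₃ (s k) := by
    intro σ
    rw [Finset.sum_eq_single σ]
    · simp only [if_true]
      rw [Equiv.prod_comp σ fun k => orthNorm q K s₀ s₁ s₂ s₃ (s k)]
      rcases Int.units_eq_one_or (Equiv.Perm.sign σ) with h | h <;> rw [h] <;> simp
    · intro τ _ hτ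
      obtain ⟨k, hk⟩ : ∃ k, σ k ≠ τ k := by
        by_contra! hall
        exact hτ (Equiv.ext fun k => (hall k).symm)
      rw [Finset.prod_eq_zero (Finset.mem_univ k) (if_neg fun h => hk (hs h)), mul_zero]
    · intro h; exact absurd (Finset.mem_univ _) h
  simp only [h1]
  rw [Finset.sum_const, Finset.card_univ, Fintype.card_perm, Fintype.card_fin, nsmul_eq_mul]

omit D in
lemma vandAt_eq_ofReal (y : Fin K → ℕ) :
    vandAt x y = (((Matrix.vandermonde fun k => x (y k)).det : ℝ) : ℂ) := by
  rw [vandAt, Matrix.det_vandermonde, Matrix.det_vandermonde]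
  push_cast
  rfl

/-- `Φ_λ` at the configuration whose complement consists of the points with indices
`y 0, y 1, …`. -/
def phiAt (_ : RacahData q K s₀ s₁ s₂ s₃ x) (lam : YoungDiagram) (y : Fin K → ℕ) : ℂ :=
  evalAt (Phi q s₀ s₁ s₂ s₃ lam) (removeSeq x (Finset.univ.image y))

lemma phiAt_bot (y : Fin K → ℕ) : D.phiAt ⊥ y = 1 := by
  have h0 : (⊥ : YoungDiagram).colLen 0 ≤ 0 := colLen_le_iff.mpr (by
    by_contra h
    exact YoungDiagram.notMem_bot _
      (YoungDiagram.mem_iff_lt_rowLen.mpr (Nat.pos_of_ne_zero h)))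
  rw [phiAt, evalAt_Phi D.q_pos D.q_lt_one D.s₀_ne s₁ s₂ s₃
    (summable_abs_removeSeq D.summable_abs _).of_abs ⊥ 0 h0, Matrix.det_isEmpty]

lemma integrable_vandAt_mul_phiAt_mul_phiAt (lam mu : YoungDiagram) :
    Integrable (fun y => vandAt x y ^ 2 * (D.phiAt lam y * D.phiAt mu y)) D.tupleMeasure := by
  by_cases hl : lam.rowLen 0 ≤ K
  · by_cases hm : mu.rowLen 0 ≤ K
    · obtain ⟨s, ε, -, -, -, h1⟩ := D.exists_vandAt_mul_evalAt_Phi hl le_rfl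
      obtain ⟨t, ε', -, -, -, h2⟩ := D.exists_vandAt_mul_evalAt_Phi hm le_rfl
      refine ((D.integrable_orthDet_mul_orthDet s t).const_mul (ε * ε')).congr
        (Eventually.of_forall fun y => ?_)
      dsimp only [phiAt]
      linear_combination -(ε' * orthDet q s₀ s₁ s₂ s₃ x t y) * h1 y - vandAt x y *
        evalAt (Phi q s₀ s₁ s₂ s₃ lam) (removeSeq x (Finset.univ.image y)) * h2 y
    · refine (integrable_zero _ _ _).congr (Eventually.of_forall fun y => ?_)
      by_cases hy : Function.Injective y
      · simp only [Pi.zero_apply, phiAt, D.evalAt_Phi_eq_zero (not_le.mp hm) hy, mul_zero]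
      · simp [vandAt_eq_zero hy]
  · refine (integrable_zero _ _ _).congr (Eventually.of_forall fun y => ?_)
    by_cases hy : Function.Injective y
    · simp only [Pi.zero_apply, phiAt, D.evalAt_Phi_eq_zero (not_le.mp hl) hy, zero_mul, mul_zero]
    · simp [vandAt_eq_zero hy]

lemma vandAt_mul_phiAt_eq_zero {lam : YoungDiagram} (h : K < lam.rowLen 0) (y : Fin K → ℕ) :
    vandAt x y * D.phiAt lam y = 0 := by
  by_cases hy : Function.Injective y
  · rw [phiAt, D.evalAt_Phi_eq_zero h hy, mul_zero]
  · rw [vandAt_eq_zero hy, zero_mul]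

lemma integral_vandAt_mul_phiAt_mul_phiAt {lam mu : YoungDiagram} (h : lam ≠ mu) :
    ∫ y, vandAt x y ^ 2 * (D.phiAt lam y * D.phiAt mu y) ∂D.tupleMeasure = 0 := by
  by_cases hl : lam.rowLen 0 ≤ K
  swap
  · rw [← integral_zero (Fin K → ℕ) ℂ]
    congr 1; funext y
    linear_combination vandAt x y * D.phiAt mu y * D.vandAt_mul_phiAt_eq_zero (not_le.mp hl) y
  by_cases hm : mu.rowLen 0 ≤ K
  swap
  · rw [← integral_zero (Fin K → ℕ) ℂ]
    congr 1; funext y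
    linear_combination vandAt x y * D.phiAt lam y * D.vandAt_mul_phiAt_eq_zero (not_le.mp hm) y
  -- A common n places both index sets inside {0, …, K+n-1}, so that they can be compared.
  obtain ⟨n, hn⟩ : ∃ n, n = max (lam.colLen 0) (mu.colLen 0) := ⟨_, rfl⟩
  have hnl : lam.colLen 0 ≤ n := hn ▸ le_max_left _ _
  have hnm : mu.colLen 0 ≤ n := hn ▸ le_max_right _ _
  obtain ⟨s, ε, -, -, hs, h1⟩ := D.exists_vandAt_mul_evalAt_Phi hl hnl
  obtain ⟨t, ε', -, -, ht, h2⟩ := D.exists_vandAt_mul_evalAt_Phi hm hnm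
  have hne : Set.range s ≠ Set.range t := by
    intro hst
    refine h (yd_ext fun i => ?_)
    have hle : ∀ (ν : YoungDiagram), ν.rowLen 0 ≤ K → ∀ i, ν.rowLen i ≤ K := fun ν hν i =>
      (ν.rowLen_anti 0 i (Nat.zero_le _)).trans hν
    -- Equal ranges have equal complements, hence equal sets of numbers K + i - λ_i; these increase
    -- strictly with i and so determine λ.
    have key : ∀ (ν κ : YoungDiagram) (u v : Fin K → ℕ), ν.rowLen 0 ≤ K →
        (∀ j, j ∈ Set.range u ↔ j < K + n ∧ ∀ i : Fin n, (j : ℤ) ≠ (K : ℤ) + i - ν.rowLen i) →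
        (∀ j, j ∈ Set.range v ↔ j < K + n ∧ ∀ i : Fin n, (j : ℤ) ≠ (K : ℤ) + i - κ.rowLen i) →
        Set.range u = Set.range v →
        ∀ i : Fin n, ∃ j : Fin n, (K : ℤ) + i - ν.rowLen i = (K : ℤ) + j - κ.rowLen j := by
      intro ν κ u v hν hu hv huv i
      have hi := hle ν hν i
      have h3 : K + i - ν.rowLen i ∉ Set.range u := fun h4 => ((hu _).mp h4).2 i (by omega)
      rw [huv, hv] at h3
      push Not at h3
      obtain ⟨j, hj⟩ := h3 (by omega)
      exact ⟨j, by omega⟩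
    have hmono : ∀ ν : YoungDiagram, StrictMono fun i : Fin n => (K : ℤ) + i - ν.rowLen i := by
      intro ν i j hij
      have h3 := ν.rowLen_anti i j hij.le
      have h4 : (i : ℕ) < j := hij
      dsimp only
      omega
    have hrange : Set.range (fun i : Fin n => (K : ℤ) + i - lam.rowLen i) =
        Set.range fun i : Fin n => (K : ℤ) + i - mu.rowLen i := by
      ext z
      constructor
      · rintro ⟨i, rfl⟩
        obtain ⟨j, hj⟩ := key lam mu s t hl hs ht hst i
        exact ⟨j, hj.symm⟩
      · rintro ⟨i, rfl⟩
        obtain ⟨j, hj⟩ := key mu lam t s hm ht hs hst.symm i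
        exact ⟨j, hj.symm⟩
    have hfun := ((hmono lam).range_inj (hmono mu)).mp hrange
    rcases lt_or_ge i n with hi | hi
    · have := congrFun hfun ⟨i, hi⟩
      simp only at this
      omega
    · rw [rowLen_eq_zero_of_colLen_le lam (hnl.trans hi),
        rowLen_eq_zero_of_colLen_le mu (hnm.trans hi)]
  have e : ∀ y, vandAt x y ^ 2 * (D.phiAt lam y * D.phiAt mu y) = ε * ε' *
      (orthDet q s₀ s₁ s₂ s₃ x s y * orthDet q s₀ s₁ s₂ s₃ x t y) := fun y => by
    dsimp only [phiAt]
    linear_combination (ε' * orthDet q s₀ s₁ s₂ s₃ x t y) * h1 y + vandAt x y *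
      evalAt (Phi q s₀ s₁ s₂ s₃ lam) (removeSeq x (Finset.univ.image y)) * h2 y
  simp only [e]
  rw [integral_const_mul, D.integral_orthDet_mul_orthDet_of_range_ne hne, mul_zero]

lemma integral_vandAt_mul_phiAt_sq {lam : YoungDiagram} (hl : lam.rowLen 0 ≤ K) :
    ∫ y, vandAt x y ^ 2 * (D.phiAt lam y * D.phiAt lam y) ∂D.tupleMeasure ≠ 0 := by
  obtain ⟨s, ε, hs, hε, -, h1⟩ := D.exists_vandAt_mul_evalAt_Phi hl le_rfl
  have e : ∀ y, vandAt x y ^ 2 * (D.phiAt lam y * D.phiAt lam y) =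
      orthDet q s₀ s₁ s₂ s₃ x s y * orthDet q s₀ s₁ s₂ s₃ x s y := fun y => by
    have h2 : ε * ε = 1 := by rcases hε with rfl | rfl <;> norm_num
    dsimp only [phiAt]
    linear_combination (ε * orthDet q s₀ s₁ s₂ s₃ x s y + vandAt x y *
      evalAt (Phi q s₀ s₁ s₂ s₃ lam) (removeSeq x (Finset.univ.image y))) * h1 y +
      orthDet q s₀ s₁ s₂ s₃ x s y * orthDet q s₀ s₁ s₂ s₃ x s y * h2
  simp only [e]
  rw [D.integral_orthDet_mul_self hs.injective]
  exact mul_ne_zero (by exact_mod_cast K.factorial_ne_zero)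
    (Finset.prod_ne_zero_iff.mpr fun k _ => D.orthNorm_ne_zero _)

/-! ### The probability measure on K-tuples -/

/-- The normalization constant of the ensemble. -/
def partitionFun : ℝ := ∫ y, (Matrix.vandermonde fun k => x (y k)).det ^ 2 ∂D.tupleMeasure

lemma ofReal_partitionFun : (D.partitionFun : ℂ) = ∫ y, vandAt x y ^ 2 ∂D.tupleMeasure := by
  rw [partitionFun, ← integral_complex_ofReal]
  simp only [vandAt_eq_ofReal, Complex.ofReal_pow]

lemma integrable_vandermonde_sq :
    Integrable (fun y => (Matrix.vandermonde fun k => x (y k)).det ^ 2) D.tupleMeasure := by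
  have h := D.integrable_vandAt_mul_phiAt_mul_phiAt ⊥ ⊥
  simp only [phiAt_bot, mul_one, vandAt_eq_ofReal] at h
  have := h.re
  refine this.congr (Eventually.of_forall fun y => ?_)
  simp only [← Complex.ofReal_pow]
  exact Complex.ofReal_re _

omit D in
lemma rowLen_bot_le : (⊥ : YoungDiagram).rowLen 0 ≤ K := by
  by_contra h
  exact YoungDiagram.notMem_bot _
    (YoungDiagram.mem_iff_lt_rowLen.mpr (lt_of_le_of_lt (Nat.zero_le _) (not_le.mp h)))

/-- The normalization constant is the squared norm for λ = ∅, already known to be nonzero. -/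
lemma partitionFun_pos : 0 < D.partitionFun := by
  refine lt_of_le_of_ne (integral_nonneg fun y => sq_nonneg _) fun h => ?_
  refine D.integral_vandAt_mul_phiAt_sq rowLen_bot_le ?_
  simp only [phiAt_bot, mul_one]
  rw [← D.ofReal_partitionFun, ← h, Complex.ofReal_zero]

/-- The distribution of the `K`-point orthogonal polynomial ensemble. -/
def ensemble : Measure (Fin K → ℕ) := D.tupleMeasure.withDensity fun y =>
  ENNReal.ofReal ((Matrix.vandermonde fun k => x (y k)).det ^ 2 / D.partitionFun)

instance : IsProbabilityMeasure D.ensemble := by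
  constructor
  rw [ensemble, withDensity_apply _ MeasurableSet.univ, Measure.restrict_univ,
    ← ofReal_integral_eq_lintegral_ofReal (D.integrable_vandermonde_sq.div_const _)
      (Eventually.of_forall fun y => div_nonneg (sq_nonneg _) D.partitionFun_pos.le),
    integral_div, ← partitionFun, div_self D.partitionFun_pos.ne', ENNReal.ofReal_one]

lemma integral_ensemble (F : (Fin K → ℕ) → ℂ) :
    ∫ y, F y ∂D.ensemble =
      (D.partitionFun : ℂ)⁻¹ * ∫ y, vandAt x y ^ 2 * F y ∂D.tupleMeasure := by
  rw [ensemble, integral_withDensity_eq_integral_toReal_smul Measurable.of_discrete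
    (Eventually.of_forall fun y => ENNReal.ofReal_lt_top), ← integral_const_mul]
  congr 1
  funext y
  rw [ENNReal.toReal_ofReal (div_nonneg (sq_nonneg _) D.partitionFun_pos.le), Complex.real_smul,
    vandAt_eq_ofReal]
  push_cast
  ring

lemma integral_ensemble_phiAt_mul_phiAt {lam mu : YoungDiagram} (h : lam ≠ mu) :
    ∫ y, D.phiAt lam y * D.phiAt mu y ∂D.ensemble = 0 := by
  rw [D.integral_ensemble, D.integral_vandAt_mul_phiAt_mul_phiAt h, mul_zero]

lemma integral_ensemble_phiAt_sq_ne_zero {lam : YoungDiagram} (h : lam.rowLen 0 ≤ K) :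
    ∫ y, D.phiAt lam y * D.phiAt lam y ∂D.ensemble ≠ 0 := by
  rw [D.integral_ensemble]
  exact mul_ne_zero (inv_ne_zero (by exact_mod_cast D.partitionFun_pos.ne'))
    (D.integral_vandAt_mul_phiAt_sq h)

lemma integral_ensemble_phiAt_sq_eq_zero {lam : YoungDiagram} (h : K < lam.rowLen 0) :
    ∫ y, D.phiAt lam y * D.phiAt lam y ∂D.ensemble = 0 := by
  rw [D.integral_ensemble]
  have e : ∀ y, vandAt x y ^ 2 * (D.phiAt lam y * D.phiAt lam y) = 0 := fun y => by
    linear_combination vandAt x y * D.phiAt lam y * D.vandAt_mul_phiAt_eq_zero h y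
  simp only [e, integral_zero, mul_zero]

end RacahData

/-! ### Real values -/

lemma conj_coeffZ_mul {f f' h : PowerSeries ℂ}
    (hf : ∀ n, starRingEnd ℂ (PowerSeries.coeff n f) = PowerSeries.coeff n f')
    (hh : ∀ n, starRingEnd ℂ (PowerSeries.coeff n h) = PowerSeries.coeff n h) (n : ℤ) :
    starRingEnd ℂ (coeffZ n (f * h)) = coeffZ n (f' * h) := by
  rcases lt_or_ge n 0 with hn | hn
  · simp [coeffZ_of_neg hn]
  · simp only [coeffZ_of_nonneg hn, PowerSeries.coeff_mul, map_sum, map_mul, hf, hh]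

/-- Conjugation either fixes s₀ and s₁ or exchanges them, and F is symmetric in s₀ and s₁. -/
lemma RacahData.conj_evalAt_Phi {q : ℝ} {K : ℕ} {s₀ s₁ s₂ s₃ : ℂ} {x : ℕ → ℝ}
    (D : RacahData q K s₀ s₁ s₂ s₃ x) (lam : YoungDiagram) {ξ : ℕ → ℝ} (hξ : Summable ξ) :
    starRingEnd ℂ (evalAt (Phi q s₀ s₁ s₂ s₃ lam) ξ) = evalAt (Phi q s₀ s₁ s₂ s₃ lam) ξ := by
  have key : ∀ (a : ℤ) (n : ℕ), starRingEnd ℂ (PowerSeries.coeff n (racahSeries q s₀ s₁ s₂ s₃ a)) =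
      PowerSeries.coeff n (racahSeries q s₀ s₁ s₂ s₃ a) := by
    intro a n
    have h2 : starRingEnd ℂ s₂ = s₂ := by rw [D.s₂_eq, map_neg, Complex.conj_ofReal]
    have h3 : starRingEnd ℂ s₃ = s₃ := by rw [D.s₃_eq, map_neg, Complex.conj_ofReal]
    rw [conj_coeff_racahSeries, h2, h3]
    rcases D.conj with ⟨h0, h1⟩ | ⟨h0, h1⟩
    · rw [h0, h1, racahSeries_swap₀₁ D.q_pos D.q_lt_one D.s₀_ne D.s₁_ne D.s₂_ne D.s₃_ne
        D.prod_mul_zpow_ne_one]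
    · rw [h0, h1]
  rw [evalAt_Phi D.q_pos D.q_lt_one D.s₀_ne s₁ s₂ s₃ hξ lam _ le_rfl, RingHom.map_det]
  congr 1
  ext i k
  exact conj_coeffZ_mul (key _) (fun n => by
    rw [hSeries, PowerSeries.coeff_mk]; exact conj_hVal ξ n) _

/-! ### Products of complete symmetric functions -/

lemma coeffZ_mul_eq_sum {A : Type*} [CommRing A] (m : ℤ) (f g : PowerSeries A) :
    coeffZ m (f * g) = ∑ k ∈ Finset.range (m + 1).toNat,
      PowerSeries.coeff (m.toNat - k) f * PowerSeries.coeff k g := by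
  rcases lt_or_ge m 0 with hm | hm
  · rw [coeffZ_of_neg hm, show (m + 1).toNat = 0 by omega, Finset.sum_range_zero]
  · rw [coeffZ_of_nonneg hm, mul_comm, PowerSeries.coeff_mul,
      Finset.Nat.sum_antidiagonal_eq_sum_range_succ_mk, show (m + 1).toNat = m.toNat + 1 by omega]
    exact Finset.sum_congr rfl fun k _ => mul_comm _ _

/-- By rearrangement Σ α_i σ(i) ≥ Σ α_i i for decreasing α, and expanding the squares leaves the
extra positive term Σ (σ(i) - i)². This orders the terms of a Jacobi-Trudi determinant. -/
lemma sum_sq_lt_of_perm {n : ℕ} {α p : Fin n → ℕ} (hα : Antitone α) {σ : Equiv.Perm (Fin n)}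
    (hσ : σ ≠ 1) (hp : ∀ i, (p i : ℤ) = (α i : ℤ) - i + σ i) :
    ∑ i, α i ^ 2 < ∑ i, p i ^ 2 := by
  have h1 : ∑ i, (α i : ℤ) * ((i : ℕ) : ℤ) ≤ ∑ i, (α i : ℤ) * ((σ i : ℕ) : ℤ) := by
    have : Antivary (fun i : Fin n => (α i : ℤ)) (fun i : Fin n => ((i : ℕ) : ℤ)) := by
      intro i j hij
      have : i < j := by simpa using hij
      exact Nat.cast_le.mpr (hα this.le)
    exact this.sum_mul_le_sum_mul_comp_perm
  have h2 : 0 < ∑ i, (((σ i : ℕ) : ℤ) - ((i : ℕ) : ℤ)) ^ 2 := by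
    obtain ⟨i, hi⟩ : ∃ i, σ i ≠ i := by
      by_contra! h
      exact hσ (Equiv.ext h)
    refine Finset.sum_pos' (fun i _ => sq_nonneg _) ⟨i, Finset.mem_univ _, ?_⟩
    have : ((σ i : ℕ) : ℤ) - ((i : ℕ) : ℤ) ≠ 0 := by
      intro h
      exact hi (Fin.ext (by omega))
    positivity
  have h3 : ∑ i, (p i : ℤ) ^ 2 = ∑ i, (α i : ℤ) ^ 2 + 2 * (∑ i, (α i : ℤ) * ((σ i : ℕ) : ℤ) -
      ∑ i, (α i : ℤ) * ((i : ℕ) : ℤ)) + ∑ i, (((σ i : ℕ) : ℤ) - ((i : ℕ) : ℤ)) ^ 2 := by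
    rw [← Finset.sum_sub_distrib, Finset.mul_sum, ← Finset.sum_add_distrib,
      ← Finset.sum_add_distrib]
    refine Finset.sum_congr rfl fun i _ => ?_
    rw [hp i]
    ring
  zify
  linarith

lemma exists_antitone_comp_perm {n : ℕ} (α : Fin n → ℕ) :
    ∃ τ : Equiv.Perm (Fin n), Antitone (α ∘ τ) :=
  ⟨Fin.revPerm.trans (Tuple.sort α), fun _ _ h => Tuple.monotone_sort α (Fin.rev_le_rev.mpr h)⟩

lemma exists_yd_rowLen {n : ℕ} {α : Fin n → ℕ} (hα : Antitone α) :
    ∃ lam : YoungDiagram, lam.colLen 0 ≤ n ∧ ∀ i : Fin n, lam.rowLen i = α i := by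
  let f : ℕ → ℕ := fun i => if h : i < n then α ⟨i, h⟩ else 0
  have hf : Antitone f := by
    intro i j hij
    by_cases hj : j < n
    · simp only [f, hj, lt_of_le_of_lt hij hj, dif_pos]
      exact hα hij
    · simp [f, hj]
  have h0 : ∀ i, n ≤ i → f i = 0 := fun i hi => by simp [f, not_lt.mpr hi]
  refine ⟨ydOf f hf n, ?_, fun i => ?_⟩
  · rw [colLen_le_iff, rowLen_ydOf f hf n h0, h0 n le_rfl]
  · rw [rowLen_ydOf f hf n h0]
    simp [f]

/-- The induction is on the degree, and then on the sum of the squares of the indices: up to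
smaller products in this order, `Φ_lam` is the product of the `h_{lam_i}`. -/
lemma prod_hVal_mem_span {q : ℝ} (hq₀ : 0 < q) (hq₁ : q < 1) {s₀ : ℂ} (hs₀ : s₀ ≠ 0)
    (s₁ s₂ s₃ : ℂ) {T : Type*} {ξ : T → ℕ → ℝ} (hξ : ∀ t, Summable (ξ t)) {n : ℕ}
    (α : Fin n → ℕ) :
    (fun t => ∏ i, hVal (ξ t) (α i)) ∈ Submodule.span ℂ
      (Set.range fun (lam : YoungDiagram) t => evalAt (Phi q s₀ s₁ s₂ s₃ lam) (ξ t)) := by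
  set V := Submodule.span ℂ
      (Set.range fun (lam : YoungDiagram) t => evalAt (Phi q s₀ s₁ s₂ s₃ lam) (ξ t)) with hV
  obtain ⟨d, hd⟩ : ∃ d, d = ∑ i, α i := ⟨_, rfl⟩
  induction d using Nat.strong_induction_on generalizing α with
  | _ d ihd =>
  -- The subtraction does not truncate, since Σ α_i² ≤ (Σ α_i)²; so k decreases as the sum of
  -- squares increases.
  obtain ⟨k, hk⟩ : ∃ k, k = d ^ 2 - ∑ i, α i ^ 2 := ⟨_, rfl⟩
  induction k using Nat.strong_induction_on generalizing α with
  | _ k ihk =>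
  suffices H : ∀ β : Fin n → ℕ, Antitone β → d = ∑ i, β i → k = d ^ 2 - ∑ i, β i ^ 2 →
      (fun t => ∏ i, hVal (ξ t) (β i)) ∈ V by
    obtain ⟨τ, hτ⟩ := exists_antitone_comp_perm α
    have := H (α ∘ τ) hτ (by rw [hd]; exact (Equiv.sum_comp τ α).symm)
      (by rw [hk]; congr 1; exact (Equiv.sum_comp τ fun i => α i ^ 2).symm)
    convert this using 2 with t
    exact (Equiv.prod_comp τ fun i => hVal (ξ t) (α i)).symm
  clear hd hk α
  intro α hα hd hk
  obtain ⟨lam, hlam, hrow⟩ := exists_yd_rowLen hα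
  let r : Fin n → PowerSeries ℂ := fun i => racahSeries q s₀ s₁ s₂ s₃ ((lam.rowLen i : ℤ) - i - 1)
  let m : Equiv.Perm (Fin n) → Fin n → ℤ := fun σ i => (α i : ℤ) - i + σ i
  let c : (Equiv.Perm (Fin n) × (Fin n → ℕ)) → ℂ := fun z =>
    ((Equiv.Perm.sign z.1 : ℤ) : ℂ) * ∏ i, PowerSeries.coeff ((m z.1 i).toNat - z.2 i) (r i)
  let S : Finset (Equiv.Perm (Fin n) × (Fin n → ℕ)) :=
    Finset.univ.biUnion fun σ => (Fintype.piFinset fun i => Finset.range (m σ i + 1).toNat).map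
      ⟨fun p => (σ, p), fun _ _ h => (Prod.mk.inj h).2⟩
  have hS : ∀ z, z ∈ S ↔ ∀ i, (z.2 i : ℤ) ≤ m z.1 i := by
    rintro ⟨σ, p⟩
    simp only [S, Finset.mem_biUnion, Finset.mem_univ, true_and, Finset.mem_map,
      Fintype.mem_piFinset, Finset.mem_range]
    constructor
    · rintro ⟨σ', p', h, hh⟩ i
      obtain ⟨rfl, rfl⟩ := Prod.mk.inj hh
      have := h i
      omega
    · exact fun h => ⟨σ, p, fun i => by have := h i; omega, rfl⟩
  have hsum : (fun t => evalAt (Phi q s₀ s₁ s₂ s₃ lam) (ξ t)) =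
      ∑ z ∈ S, c z • fun t => ∏ i, hVal (ξ t) (z.2 i) := by
    funext t
    rw [evalAt_Phi hq₀ hq₁ hs₀ s₁ s₂ s₃ (hξ t) lam n hlam, ← Matrix.det_transpose,
      Matrix.det_apply', Finset.sum_apply, Finset.sum_biUnion]
    · refine Finset.sum_congr rfl fun σ _ => ?_
      simp only [Matrix.transpose_apply, Matrix.of_apply, Finset.sum_map, Pi.smul_apply,
        smul_eq_mul]
      rw [Finset.prod_congr rfl fun i _ => coeffZ_mul_eq_sum _ _ _, Finset.prod_univ_sum,
        Finset.mul_sum]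
      simp only [hrow, m, c, r, Finset.prod_mul_distrib, mul_assoc, hSeries, PowerSeries.coeff_mk]
      rfl
    · intro σ _ σ' _ h
      rw [Function.onFun, Finset.disjoint_left]
      rintro ⟨a, b⟩ ha hb
      obtain ⟨_, _, ha⟩ := Finset.mem_map.mp ha
      obtain ⟨_, _, hb⟩ := Finset.mem_map.mp hb
      exact h ((Prod.mk.inj ha).1.trans (Prod.mk.inj hb).1.symm)
  -- The term σ = 1, p = α has coefficient 1, and every other term precedes it in the order.
  have h1α : ((1 : Equiv.Perm (Fin n)), α) ∈ S := by
    rw [hS]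
    intro i
    simp [m]
  have hc : c (1, α) = 1 := by
    simp [c, m, r, constantCoeff_racahSeries]
  rw [← Finset.add_sum_erase S _ h1α, hc, one_smul, ← sub_eq_iff_eq_add] at hsum
  rw [← hsum]
  refine V.sub_mem (Submodule.subset_span ⟨lam, rfl⟩)
    (V.sum_mem fun z hz => V.smul_mem _ ?_)
  obtain ⟨σ, p⟩ := z
  obtain ⟨hne, hz⟩ := Finset.mem_erase.mp hz
  rw [hS] at hz
  have hsm : ∑ i, m σ i = d := by
    simp only [m, Finset.sum_add_distrib, Finset.sum_sub_distrib]
    rw [Equiv.sum_comp σ fun i : Fin n => ((i : ℕ) : ℤ), hd]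
    push_cast
    ring
  have hle : ((∑ i, p i : ℕ) : ℤ) ≤ d := by
    rw [← hsm]
    push_cast
    exact Finset.sum_le_sum fun i _ => hz i
  -- Either the degree drops, or p equals its upper bound α_i - i + σ(i) everywhere with σ ≠ 1, and
  -- then the sum of squares grows.
  rcases (Nat.cast_le.mp hle).lt_or_eq with hlt | heq
  · exact ihd _ hlt p rfl
  · have hp : ∀ i, (p i : ℤ) = m σ i := by
      have : ∑ i, (p i : ℤ) = ∑ i, m σ i := by rw [hsm, ← heq]; push_cast; rfl
      exact fun i => (Finset.sum_eq_sum_iff_of_le fun i _ => hz i).mp this i (Finset.mem_univ _)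
    have hσ : σ ≠ 1 := by
      rintro rfl
      refine hne (Prod.ext rfl (funext fun i => ?_))
      have := hp i
      simp only [m, Equiv.Perm.one_apply] at this
      change p i = α i
      omega
    have hlt := sum_sq_lt_of_perm hα hσ hp
    have hsq : ∑ i, p i ^ 2 ≤ d ^ 2 := by
      rw [← heq]
      exact Finset.sum_sq_le_sq_sum_of_nonneg fun i _ => Nat.zero_le _
    exact ihk _ (by omega) p heq.symm rfl

/-- The generators are real-valued, so a complex combination splits into two real ones. -/
lemma re_im_mem_span {ι T : Type*} {F : ι → T → ℂ} (hF : ∀ i t, (F i t).im = 0) {f : T → ℂ}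
    (hf : f ∈ Submodule.span ℂ (Set.range F)) :
    (fun t => (f t).re) ∈ Submodule.span ℝ (Set.range fun i t => (F i t).re) ∧
      (fun t => (f t).im) ∈ Submodule.span ℝ (Set.range fun i t => (F i t).re) := by
  induction hf using Submodule.span_induction with
  | mem f hf =>
    obtain ⟨i, rfl⟩ := hf
    refine ⟨Submodule.subset_span ⟨i, rfl⟩, ?_⟩
    simp only [hF]
    exact Submodule.zero_mem _
  | zero => exact ⟨Submodule.zero_mem _, Submodule.zero_mem _⟩
  | add f g _ _ hf hg => exact ⟨Submodule.add_mem _ hf.1 hg.1, Submodule.add_mem _ hf.2 hg.2⟩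
  | smul a f _ hf =>
    constructor
    · convert Submodule.sub_mem _ (Submodule.smul_mem _ a.re hf.1)
        (Submodule.smul_mem _ a.im hf.2) using 1
      funext t
      simp [Complex.mul_re]
    · convert Submodule.add_mem _ (Submodule.smul_mem _ a.re hf.2)
        (Submodule.smul_mem _ a.im hf.1) using 1
      funext t
      simp [Complex.mul_im]

/-! ### The grid -/

lemma coe_gridPoint_even (q ζ : ℝ) (L R : ℤ) (k : ℕ) :
    (gridPoint q ζ L R (2 * k) : ℝ) = ζ * q ^ (R + k) := by
  simp [gridPoint]

lemma coe_gridPoint_odd (q ζ : ℝ) (L R : ℤ) (k : ℕ) :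
    (gridPoint q ζ L R (2 * k + 1) : ℝ) = -(ζ⁻¹ * q ^ (-L + k)) := by
  have h : (2 * k + 1) / 2 = k := by omega
  have h' : ¬ (2 * k + 1) % 2 = 0 := by omega
  rw [gridPoint, if_neg h']
  change -(ζ⁻¹ * q ^ (-L + (((2 * k + 1) / 2 : ℕ) : ℤ))) = _
  rw [h]

lemma gridPoint_surjective (q ζ : ℝ) (L R : ℤ) : Function.Surjective (gridPoint q ζ L R) := by
  rintro ⟨x, ⟨n, rfl⟩ | ⟨n, rfl⟩⟩
  · exact ⟨2 * n + 1, Subtype.ext (coe_gridPoint_odd q ζ L R n)⟩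
  · exact ⟨2 * n, Subtype.ext (coe_gridPoint_even q ζ L R n)⟩

lemma le_zpow_or_zpow_le {q : ℝ} (hq₀ : 0 < q) (hq₁ : q < 1) (m j : ℤ) :
    q ^ m ≤ q ^ j ∨ q ^ j ≤ q ^ (m + 1) := by
  rcases le_or_gt j m with h | h
  · exact Or.inl (zpow_le_zpow_right_of_le_one₀ hq₀ hq₁.le h)
  · exact Or.inr (zpow_le_zpow_right_of_le_one₀ hq₀ hq₁.le (by omega))

/-- No point c q^j lies strictly between c q^{m+1} and c q^m, so a and b are on the same side of
each. -/
lemma mul_sub_zpow_pos {q c a b : ℝ} (hq₀ : 0 < q) (hq₁ : q < 1) (hc : 0 < c) {m : ℤ}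
    (ha : a ∈ Set.Ioo (c * q ^ (m + 1)) (c * q ^ m))
    (hb : b ∈ Set.Ioo (c * q ^ (m + 1)) (c * q ^ m)) (j : ℤ) :
    0 < (a - c * q ^ j) * (b - c * q ^ j) := by
  rcases le_zpow_or_zpow_le hq₀ hq₁ m j with h | h
  · have := mul_le_mul_of_nonneg_left h hc.le
    exact mul_pos_of_neg_of_neg (by linarith [ha.2]) (by linarith [hb.2])
  · have := mul_le_mul_of_nonneg_left h hc.le
    exact mul_pos (by linarith [ha.1]) (by linarith [hb.1])

/-- The common content of the three admissibility conditions: (s₀ + x)(s₁ + x) > 0 on the grid. It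
is a squared modulus in the conjugate case. In the real cases one half of the grid is harmless by
sign, and on the other half -s₀ and -s₁ lie in the same gap. -/
lemma Admissible.exists_real {q ζ : ℝ} (hq₀ : 0 < q) (hq₁ : q < 1) (hζ : 0 < ζ) {L R : ℤ}
    {s₀ s₁ s₂ s₃ : ℂ} (hs : Admissible q ζ L R s₀ s₁ s₂ s₃) :
    ∃ e₁ e₂ : ℝ, s₀ + s₁ = e₁ ∧ s₀ * s₁ = e₂ ∧ 0 < e₂ ∧
      ∀ n, 0 < e₂ + e₁ * (gridPoint q ζ L R n : ℝ) + (gridPoint q ζ L R n : ℝ) ^ 2 := by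
  have hζ' := inv_pos.mpr hζ
  obtain ⟨-, -, -, ⟨h0, him⟩ | ⟨a, b, rfl, rfl, m, ha, hb⟩ | ⟨a, b, rfl, rfl, m, ha, hb⟩⟩ := hs
  · have h1 : s₁ = starRingEnd ℂ s₀ := by rw [h0, Complex.conj_conj]
    refine ⟨2 * s₀.re, Complex.normSq s₀, ?_, ?_, ?_, fun n => ?_⟩
    · rw [h1, Complex.add_conj]
    · rw [h1, Complex.mul_conj]
    · rw [Complex.normSq_pos]
      rintro rfl
      exact him rfl
    · generalize (gridPoint q ζ L R n : ℝ) = x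
      rw [Complex.normSq_apply]
      nlinarith [sq_nonneg (s₀.re + x), pow_pos (abs_pos.mpr him) 2, sq_abs s₀.im]
  · have ha0 : 0 < a := (by positivity : 0 < ζ⁻¹ * q ^ (m + 1)).trans ha.1
    have hb0 : 0 < b := (by positivity : 0 < ζ⁻¹ * q ^ (m + 1)).trans hb.1
    refine ⟨a + b, a * b, by push_cast; rfl, by push_cast; rfl, mul_pos ha0 hb0, fun n => ?_⟩
    rcases Nat.even_or_odd' n with ⟨k, rfl | rfl⟩
    · rw [coe_gridPoint_even]
      positivity
    · rw [coe_gridPoint_odd]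
      linarith [mul_sub_zpow_pos hq₀ hq₁ hζ' ha hb (-L + k)]
  · have ha' : -a ∈ Set.Ioo (ζ * q ^ (m + 1)) (ζ * q ^ m) :=
      ⟨by linarith [ha.2], by linarith [ha.1]⟩
    have hb' : -b ∈ Set.Ioo (ζ * q ^ (m + 1)) (ζ * q ^ m) :=
      ⟨by linarith [hb.2], by linarith [hb.1]⟩
    have ha0 : 0 < -a := (by positivity : 0 < ζ * q ^ (m + 1)).trans ha'.1
    have hb0 : 0 < -b := (by positivity : 0 < ζ * q ^ (m + 1)).trans hb'.1
    refine ⟨a + b, a * b, by push_cast; rfl, by push_cast; rfl, by nlinarith, fun n => ?_⟩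
    rcases Nat.even_or_odd' n with ⟨k, rfl | rfl⟩
    · rw [coe_gridPoint_even]
      linarith [mul_sub_zpow_pos hq₀ hq₁ hζ ha' hb' (R + k)]
    · rw [coe_gridPoint_odd]
      have : 0 < ζ⁻¹ * q ^ (-L + k) := by positivity
      nlinarith [mul_pos (add_pos this ha0) (add_pos this hb0)]

lemma Admissible.racahData {q ζ : ℝ} (hq₀ : 0 < q) (hq₁ : q < 1) (hζ : 0 < ζ) {L R : ℤ}
    {s₀ s₁ s₂ s₃ : ℂ} (hs : Admissible q ζ L R s₀ s₁ s₂ s₃) :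
    RacahData q (L - R).toNat s₀ s₁ s₂ s₃ fun n => (gridPoint q ζ L R n : ℝ) where
  q_pos := hq₀
  q_lt_one := hq₁
  step n := by
    rcases Nat.even_or_odd' n with ⟨k, rfl | rfl⟩
    · rw [show 2 * k + 2 = 2 * (k + 1) by ring, coe_gridPoint_even, coe_gridPoint_even]
      push_cast
      rw [← add_assoc, zpow_add_one₀ hq₀.ne']
      ring
    · rw [show 2 * k + 1 + 2 = 2 * (k + 1) + 1 by ring, coe_gridPoint_odd, coe_gridPoint_odd]
      push_cast
      rw [← add_assoc, zpow_add_one₀ hq₀.ne']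
      ring
  x_zero := by
    have := coe_gridPoint_even q ζ L R 0
    rw [mul_zero] at this
    rw [this]
    positivity
  x_one := by
    have := coe_gridPoint_odd q ζ L R 0
    rw [mul_zero, zero_add] at this
    rw [this, neg_lt_zero]
    positivity
  s₂_eq := by
    have := coe_gridPoint_even q ζ L R 0
    rw [mul_zero, Nat.cast_zero, add_zero] at this
    rw [this, hs.2.1]
  s₃_eq := by
    have := coe_gridPoint_odd q ζ L R 0
    rw [mul_zero, zero_add, Nat.cast_zero, add_zero] at this
    rw [this, hs.2.2.1, Complex.ofReal_neg, neg_neg]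
  prod_eq := by
    have h0 := coe_gridPoint_even q ζ L R 0
    have h1 := coe_gridPoint_odd q ζ L R 0
    rw [mul_zero, Nat.cast_zero, add_zero] at h0
    rw [mul_zero, zero_add, Nat.cast_zero, add_zero] at h1
    have hRL := hs.1
    rw [h0, h1, show -(((L - R).toNat : ℕ) : ℤ) = R + -L by omega, zpow_add₀ hq₀.ne']
    field_simp
  exists_real := hs.exists_real hq₀ hq₁ hζ
  conj := by
    obtain ⟨-, -, -, ⟨h0, -⟩ | ⟨a, b, rfl, rfl, -⟩ | ⟨a, b, rfl, rfl, -⟩⟩ := hs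
    · exact Or.inl ⟨by rw [h0, Complex.conj_conj], h0.symm⟩
    · exact Or.inr ⟨Complex.conj_ofReal a, Complex.conj_ofReal b⟩
    · exact Or.inr ⟨Complex.conj_ofReal a, Complex.conj_ofReal b⟩

/-! ### Power sums determine a configuration -/

/-- Among the indices with c ≠ 0 one chooses j with |x_j| maximal, which exists since x tends to
zero; dividing the moments by powers of x_j isolates c_j in the limit. -/
lemma eq_zero_of_tsum_mul_pow {x c : ℕ → ℝ} (hx : Summable fun i => |x i|)
    (hx0 : ∀ i, x i ≠ 0) (hinj : Function.Injective x) (hc : ∀ i, |c i| ≤ 1)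
    (h : ∀ k, ∑' i, c i * x i ^ (k + 1) = 0) (i : ℕ) : c i = 0 := by
  by_contra hi
  obtain ⟨j, hj, hmax⟩ : ∃ j, c j ≠ 0 ∧ ∀ k, c k ≠ 0 → |x k| ≤ |x j| := by
    have hfin : {k | |x i| ≤ |x k|}.Finite := by
      have := hx.tendsto_cofinite_zero.eventually (gt_mem_nhds (abs_pos.mpr (hx0 i)))
      refine (Filter.eventually_cofinite.mp this).subset fun k hk => ?_
      simpa using hk
    have hfin' : {k | c k ≠ 0 ∧ |x i| ≤ |x k|}.Finite := hfin.subset fun k hk => hk.2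
    obtain ⟨j, hj, hmax⟩ := Set.exists_max_image _ (fun k => |x k|) hfin' ⟨i, hi, le_rfl⟩
    refine ⟨j, hj.1, fun k hk => ?_⟩
    rcases le_total |x i| |x k| with hle | hle
    · exact hmax k ⟨hk, hle⟩
    · exact hle.trans hj.2
  have hsum : ∀ k, Summable fun i => c i * x i ^ (k + 1) := fun k => by
    refine (summable_pow_of_summable_abs hx k).of_norm_bounded fun i => ?_
    rw [norm_mul, Real.norm_eq_abs, norm_pow, Real.norm_eq_abs]
    exact mul_le_of_le_one_left (by positivity) (hc i)
  have hjj := abs_pos.mpr (hx0 j)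
  -- The point -x_j could have the same modulus. Adding two consecutive normalized moments
  -- introduces the factor 1 + x_i/x_j, which kills it and equals 2 at i = j.
  have hlim : Tendsto (fun k : ℕ => ∑' i, c i * (x i / x j) ^ (k + 1) * (1 + x i / x j)) atTop
      (𝓝 (∑' i, if i = j then 2 * c j else 0)) := by
    refine tendsto_tsum_of_dominated_convergence (bound := fun i => |x i| / |x j| * 2)
      ((hx.div_const _).mul_right _) (fun i => ?_) (Eventually.of_forall fun k i => ?_)
    · split_ifs with hij
      · subst hij
        rw [div_self (hx0 i)]
        simp only [one_pow, mul_one]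
        rw [show 2 * c i = c i * (1 + 1) by ring]
        exact tendsto_const_nhds
      · by_cases hci : c i = 0
        · simp [hci]
        rcases (hmax i hci).lt_or_eq with hlt | heq
        · have : |x i / x j| < 1 := by rwa [abs_div, div_lt_one hjj]
          have := ((tendsto_pow_atTop_nhds_zero_of_abs_lt_one this).comp (tendsto_add_atTop_nat 1)).const_mul (c i)
          simpa using this.mul_const (1 + x i / x j)
        · have : x i = -x j := (abs_eq_abs.mp heq).resolve_left fun h => hij (hinj h)
          rw [this, neg_div, div_self (hx0 j)]
          simp
    · by_cases hci : c i = 0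
      · rw [hci, zero_mul, zero_mul, norm_zero]
        positivity
      · have h1 : |x i / x j| ≤ 1 := by
          rw [abs_div, div_le_one hjj]
          exact hmax i hci
        rw [Real.norm_eq_abs, abs_mul, abs_mul, abs_pow, ← abs_div]
        have h2 : |c i| * |x i / x j| ^ (k + 1) ≤ 1 * |x i / x j| ^ 1 :=
          mul_le_mul (hc i) (pow_le_pow_of_le_one (abs_nonneg _) h1 (by omega)) (by positivity)
            zero_le_one
        rw [one_mul, pow_one] at h2
        refine mul_le_mul h2 ?_ (abs_nonneg _) (abs_nonneg _)
        refine (abs_add_le _ _).trans ?_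
        rw [abs_one]
        linarith
  rw [tsum_ite_eq] at hlim
  have hz : ∀ k : ℕ, ∑' i, c i * (x i / x j) ^ (k + 1) * (1 + x i / x j) = 0 := by
    intro k
    have e : ∀ i, c i * (x i / x j) ^ (k + 1) * (1 + x i / x j) =
        (x j ^ (k + 1))⁻¹ * (c i * x i ^ (k + 1)) +
          (x j ^ (k + 1 + 1))⁻¹ * (c i * x i ^ (k + 1 + 1)) := by
      intro i
      rw [div_pow, div_eq_mul_inv, div_eq_mul_inv, pow_succ _ (k + 1), pow_succ _ (k + 1), mul_inv]
      ring
    simp only [e]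
    rw [((hsum k).mul_left _).tsum_add ((hsum (k + 1)).mul_left _), tsum_mul_left, tsum_mul_left,
      h, h, mul_zero, mul_zero, add_zero]
  simp only [hz] at hlim
  have := tendsto_nhds_unique hlim tendsto_const_nhds
  exact hj (by linarith)

lemma abs_configSeq_le {q ζ : ℝ} {L R : ℤ} (X : Config q ζ L R) (n : ℕ) :
    |configSeq X n| ≤ |(gridPoint q ζ L R n : ℝ)| := by
  rw [configSeq]
  split_ifs
  · exact le_rfl
  · rw [abs_zero]
    exact abs_nonneg _

lemma continuous_configSeq {q ζ : ℝ} {L R : ℤ} (n : ℕ) :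
    Continuous fun X : Config q ζ L R => configSeq X n :=
  (continuous_of_discreteTopology (f := fun b : Bool =>
    if b = true then (gridPoint q ζ L R n : ℝ) else 0)).comp (continuous_apply _)

namespace RacahData

variable {q ζ : ℝ} {L R : ℤ} {K : ℕ} {s₀ s₁ s₂ s₃ : ℂ}
  (D : RacahData q K s₀ s₁ s₂ s₃ fun n => (gridPoint q ζ L R n : ℝ))

include D

lemma summable_abs_configSeq (X : Config q ζ L R) : Summable fun n => |configSeq X n| :=
  Summable.of_nonneg_of_le (fun _ => abs_nonneg _) (abs_configSeq_le X) D.summable_abs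

/-- Complete symmetric functions determine power sums, and these determine the indicator of a
configuration because the grid points are distinct and nonzero. -/
lemma config_ext {X Y : Config q ζ L R} (h : hSeries (configSeq X) = hSeries (configSeq Y)) :
    X = Y := by
  have hp := pSeries_eq_of_hSeries_eq (D.summable_abs_configSeq X) (D.summable_abs_configSeq Y) h
  let c : Config q ζ L R → ℕ → ℝ := fun X n => if X (gridPoint q ζ L R n) = true then 1 else 0
  have hc : ∀ X n k, configSeq X n ^ (k + 1) = c X n * (gridPoint q ζ L R n : ℝ) ^ (k + 1) := by
    intro X n k
    simp only [configSeq, c]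
    split_ifs <;> simp
  have hs : ∀ (X : Config q ζ L R) (k : ℕ), Summable fun n => configSeq X n ^ (k + 1) :=
    fun X k => Summable.of_abs (by
      simpa only [abs_pow] using summable_pow_of_summable_abs (D.summable_abs_configSeq X) k)
  have key := eq_zero_of_tsum_mul_pow (c := fun n => c X n - c Y n) D.summable_abs D.x_ne_zero
    D.x_injective (fun n => by simp only [c]; split_ifs <;> simp) (fun k => by
      simp only [sub_mul, ← hc]
      rw [(hs X k).tsum_sub (hs Y k), sub_eq_zero]
      have := congrArg (PowerSeries.coeff (k + 1)) hp
      simp only [pSeries, PowerSeries.coeff_mk, Nat.succ_ne_zero, if_false] at this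
      exact_mod_cast this)
  funext g
  obtain ⟨n, rfl⟩ := gridPoint_surjective q ζ L R g
  have := key n
  simp only [c] at this
  cases hX : X (gridPoint q ζ L R n) <;> cases hY : Y (gridPoint q ζ L R n) <;>
    simp [hX, hY] at this ⊢

lemma continuous_hVal_configSeq (n : ℕ) :
    Continuous fun X : Config q ζ L R => hVal (configSeq X) n :=
  continuous_hVal D.summable_abs abs_configSeq_le continuous_configSeq n

lemma im_PhiFun (lam : YoungDiagram) (X : Config q ζ L R) :
    (PhiFun q ζ L R s₀ s₁ s₂ s₃ lam X).im = 0 :=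
  Complex.conj_eq_iff_im.mp (D.conj_evalAt_Phi lam (D.summable_abs_configSeq X).of_abs)

lemma continuous_PhiFun (lam : YoungDiagram) : Continuous (PhiFun q ζ L R s₀ s₁ s₂ s₃ lam) := by
  unfold PhiFun
  simp only [fun X : Config q ζ L R => evalAt_Phi D.q_pos D.q_lt_one D.s₀_ne s₁ s₂ s₃
    (D.summable_abs_configSeq X).of_abs lam _ le_rfl, coeffZ_mul_eq_sum, hSeries,
    PowerSeries.coeff_mk]
  refine Continuous.matrix_det (continuous_matrix fun i j => ?_)
  simp only [Matrix.of_apply]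
  refine continuous_finsetSum _ fun k _ => ?_
  exact continuous_const.mul (D.continuous_hVal_configSeq k)

/-! ### Density in the continuous functions -/

/-- The real-valued continuous function on the space of configurations given by `Φ_lam`. -/
def phiMap (lam : YoungDiagram) : C(Config q ζ L R, ℝ) where
  toFun X := (PhiFun q ζ L R s₀ s₁ s₂ s₃ lam X).re
  continuous_toFun := Complex.continuous_re.comp (D.continuous_PhiFun lam)

/-- The real-valued continuous function on the space of configurations given by `h_n`. -/
def hMap (n : ℕ) : C(Config q ζ L R, ℝ) where
  toFun X := (hVal (configSeq X) n).re
  continuous_toFun := Complex.continuous_re.comp (D.continuous_hVal_configSeq n)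

lemma ofReal_hMap (n : ℕ) (X : Config q ζ L R) : ((D.hMap n X : ℝ) : ℂ) = hVal (configSeq X) n :=
  Complex.conj_eq_iff_re.mp (conj_hVal _ n)

lemma ofReal_phiMap (lam : YoungDiagram) (X : Config q ζ L R) :
    ((D.phiMap lam X : ℝ) : ℂ) = PhiFun q ζ L R s₀ s₁ s₂ s₃ lam X :=
  Complex.ext rfl (D.im_PhiFun lam X).symm

lemma list_prod_hMap_mem_span (l : List ℕ) :
    (l.map D.hMap).prod ∈ Submodule.span ℝ (Set.range D.phiMap) := by
  have h1 := prod_hVal_mem_span D.q_pos D.q_lt_one D.s₀_ne s₁ s₂ s₃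
    (fun X : Config q ζ L R => (D.summable_abs_configSeq X).of_abs) l.get
  have h2 := (re_im_mem_span D.im_PhiFun h1).1
  have h3 : (Submodule.span ℝ (Set.range fun lam X => (PhiFun q ζ L R s₀ s₁ s₂ s₃ lam X).re)) =
      (Submodule.span ℝ (Set.range D.phiMap)).map (ContinuousMap.coeFnLinearMap ℝ) := by
    rw [Submodule.map_span, ← Set.range_comp]
    rfl
  rw [h3] at h2
  obtain ⟨g, hg, he⟩ := h2
  refine (?_ : (l.map D.hMap).prod = g) ▸ hg
  ext X
  refine Eq.trans ?_ (congrFun he X).symm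
  have : ∀ l : List ℕ, (((l.map D.hMap).prod X : ℝ) : ℂ) = ∏ i, hVal (configSeq X) (l.get i) := by
    intro l
    induction l with
    | nil => simp
    | cons a l ih =>
      rw [List.map_cons, List.prod_cons, ContinuousMap.mul_apply, Complex.ofReal_mul, ih,
        D.ofReal_hMap]
      exact (Fin.prod_univ_succ fun i : Fin (l.length + 1) => hVal (configSeq X) ((a :: l).get i)).symm
  rw [← this, Complex.ofReal_re]

/-- The linear combinations of the functions `Φ_lam` are dense in the space of continuous functions
on the space of configurations. -/
theorem dense_span_phiMap :
    Dense (Submodule.span ℝ (Set.range D.phiMap) : Set C(Config q ζ L R, ℝ)) := by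
  have h1 : Subalgebra.SeparatesPoints (Algebra.adjoin ℝ (Set.range D.hMap)) := by
    intro X Y hXY
    by_contra! h
    refine hXY (D.config_ext (PowerSeries.ext fun n => ?_))
    rw [hSeries, hSeries, PowerSeries.coeff_mk, PowerSeries.coeff_mk, ← D.ofReal_hMap,
      ← D.ofReal_hMap]
    exact congrArg _ (h (D.hMap n) ⟨D.hMap n, Algebra.subset_adjoin ⟨n, rfl⟩, rfl⟩)
  have h2 := ContinuousMap.subalgebra_topologicalClosure_eq_top_of_separatesPoints _ h1
  -- The span of the Φ_λ contains every product of the h_n, hence the whole algebra to which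
  -- Stone-Weierstrass applies.
  have h3 : (Algebra.adjoin ℝ (Set.range D.hMap) : Set C(Config q ζ L R, ℝ)) ⊆
      Submodule.span ℝ (Set.range D.phiMap) := by
    rw [← Subalgebra.coe_toSubmodule, SetLike.coe_subset_coe, Algebra.adjoin_eq_span,
      Submodule.span_le]
    intro f hf
    obtain ⟨l, hl, rfl⟩ := Submonoid.exists_list_of_mem_closure hf
    obtain ⟨l', rfl⟩ : l ∈ Set.range (List.map D.hMap) := by rwa [Set.range_list_map]
    exact D.list_prod_hMap_mem_span l'
  have h4 : Dense (Algebra.adjoin ℝ (Set.range D.hMap) : Set C(Config q ζ L R, ℝ)) := by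
    rw [dense_iff_closure_eq, ← Subalgebra.topologicalClosure_coe, h2]
    rfl
  exact h4.mono h3

end RacahData

/-! ### The orthogonality measure -/

lemma countable_grid (q ζ : ℝ) (L R : ℤ) : Countable (grid q ζ L R) :=
  (gridPoint_surjective q ζ L R).countable

/-- The configuration obtained from the grid by removing the points with the given numbers. -/
def removePoints {q ζ : ℝ} {L R : ℤ} {K : ℕ} (y : Fin K → ℕ) : Config q ζ L R :=
  open Classical in fun g => decide (g ∉ Set.range fun k => gridPoint q ζ L R (y k))

namespace RacahData

variable {q ζ : ℝ} {L R : ℤ} {K : ℕ} {s₀ s₁ s₂ s₃ : ℂ}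
  (D : RacahData q K s₀ s₁ s₂ s₃ fun n => (gridPoint q ζ L R n : ℝ))

lemma configSeq_removePoints (hinj : Function.Injective (gridPoint q ζ L R)) (y : Fin K → ℕ) :
    configSeq (removePoints y : Config q ζ L R) =
      removeSeq (fun n => (gridPoint q ζ L R n : ℝ)) (Finset.univ.image y) := by
  funext n
  simp only [configSeq, removeSeq, removePoints, decide_eq_true_eq, Set.mem_range, hinj.eq_iff,
    Finset.mem_image, Finset.mem_univ, true_and]
  split_ifs <;> rfl

include D

lemma PhiFun_removePoints (lam : YoungDiagram) (y : Fin K → ℕ) :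
    PhiFun q ζ L R s₀ s₁ s₂ s₃ lam (removePoints y) = D.phiAt lam y := by
  rw [PhiFun, configSeq_removePoints fun a b h => D.x_injective (congrArg _ h)]
  rfl

/-- The distribution of the complement of the orthogonal polynomial ensemble in the grid. -/
def configMeasure : Measure (Config q ζ L R) := D.ensemble.map removePoints

instance : IsProbabilityMeasure D.configMeasure :=
  Measure.isProbabilityMeasure_map Measurable.of_discrete.aemeasurable

lemma integral_configMeasure {F : Config q ζ L R → ℂ} (hF : Continuous F) :
    ∫ X, F X ∂D.configMeasure = ∫ y, F (removePoints y) ∂D.ensemble := by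
  have := countable_grid q ζ L R
  rw [configMeasure, integral_map Measurable.of_discrete.aemeasurable
    hF.measurable.aestronglyMeasurable]

lemma integrable_PhiFun (lam : YoungDiagram) (M : Measure (Config q ζ L R)) [IsFiniteMeasure M] :
    Integrable (PhiFun q ζ L R s₀ s₁ s₂ s₃ lam) M := by
  have := countable_grid q ζ L R
  exact BoundedContinuousFunction.integrable M
    (BoundedContinuousFunction.mkOfCompact ⟨_, D.continuous_PhiFun lam⟩)

/-- The moment conditions are the orthogonality relations with Φ_∅ = 1. -/
lemma isOrthMeasure_configMeasure : IsOrthMeasure q ζ L R s₀ s₁ s₂ s₃ D.configMeasure := by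
  intro lam
  refine ⟨D.integrable_PhiFun lam _, ?_, fun h => ?_⟩
  · rintro rfl
    rw [D.integral_configMeasure (D.continuous_PhiFun _)]
    simp [D.PhiFun_removePoints, D.phiAt_bot]
  · have := D.integral_ensemble_phiAt_mul_phiAt h
    simp only [D.phiAt_bot, mul_one] at this
    rw [D.integral_configMeasure (D.continuous_PhiFun _)]
    simpa only [D.PhiFun_removePoints] using this

lemma integral_phiMap_eq {M M' : Measure (Config q ζ L R)}
    (h : IsOrthMeasure q ζ L R s₀ s₁ s₂ s₃ M) (h' : IsOrthMeasure q ζ L R s₀ s₁ s₂ s₃ M')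
    (lam : YoungDiagram) : ∫ X, D.phiMap lam X ∂M = ∫ X, D.phiMap lam X ∂M' := by
  have : ∫ X, PhiFun q ζ L R s₀ s₁ s₂ s₃ lam X ∂M = ∫ X, PhiFun q ζ L R s₀ s₁ s₂ s₃ lam X ∂M' := by
    by_cases hl : lam = ⊥
    · rw [(h lam).2.1 hl, (h' lam).2.1 hl]
    · rw [(h lam).2.2 hl, (h' lam).2.2 hl]
  simp only [← D.ofReal_phiMap, integral_complex_ofReal] at this
  exact_mod_cast this

/-- The integrals agree on a dense subspace of C(Ω), hence on all continuous functions, and these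
determine a finite measure. -/
lemma measure_ext {M M' : Measure (Config q ζ L R)} [IsProbabilityMeasure M]
    [IsProbabilityMeasure M'] (h : IsOrthMeasure q ζ L R s₀ s₁ s₂ s₃ M)
    (h' : IsOrthMeasure q ζ L R s₀ s₁ s₂ s₃ M') : M = M' := by
  have := countable_grid q ζ L R
  -- The grid is countable, so the product topology is metrizable.
  let _ := TopologicalSpace.pseudoMetrizableSpacePseudoMetric (Config q ζ L R)
  refine ext_of_forall_integral_eq_of_IsFiniteMeasure fun f => ?_
  have hint : ∀ (N : Measure (Config q ζ L R)) [IsProbabilityMeasure N] (g : C(Config q ζ L R, ℝ)),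
      Integrable g N := fun N _ g =>
    BoundedContinuousFunction.integrable N (BoundedContinuousFunction.mkOfCompact g)
  have hcont : ∀ (N : Measure (Config q ζ L R)) [IsProbabilityMeasure N],
      Continuous fun g : C(Config q ζ L R, ℝ) => ∫ X, g X ∂N := by
    intro N _
    refine (LipschitzWith.of_dist_le_mul (K := 1) fun g g' => ?_).continuous
    rw [Real.dist_eq, ← integral_sub (hint N g) (hint N g'), NNReal.coe_one, one_mul]
    have := norm_integral_le_of_norm_le_const (μ := N) (f := fun X => g X - g' X)
      (C := dist g g') (Eventually.of_forall fun X => by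
        rw [← dist_eq_norm]
        exact ContinuousMap.dist_apply_le_dist X)
    simpa using this
  have key : (fun g : C(Config q ζ L R, ℝ) => ∫ X, g X ∂M) = fun g => ∫ X, g X ∂M' := by
    refine (hcont M).ext_on D.dense_span_phiMap (hcont M') fun g hg => ?_
    induction hg using Submodule.span_induction with
    | mem g hg =>
      obtain ⟨lam, rfl⟩ := hg
      exact D.integral_phiMap_eq h h' lam
    | zero => simp
    | add g g' _ _ hg hg' =>
      simp only [ContinuousMap.add_apply] at hg hg' ⊢
      rw [integral_add (hint M g) (hint M g'), integral_add (hint M' g) (hint M' g'), hg, hg']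
    | smul a g _ hg =>
      simp only [ContinuousMap.smul_apply, integral_smul] at hg ⊢
      rw [hg]
  exact congrFun key f.toContinuousMap

/-! ### Orthogonality and completeness in L² -/

lemma memLp_phiMap (lam : YoungDiagram) (M : Measure (Config q ζ L R)) [IsFiniteMeasure M] :
    MemLp (fun X => (PhiFun q ζ L R s₀ s₁ s₂ s₃ lam X).re) 2 M := by
  have := countable_grid q ζ L R
  obtain ⟨C, hC⟩ := (isCompact_range (D.phiMap lam).continuous).isBounded.exists_norm_le
  exact MemLp.of_bound (D.phiMap lam).continuous.measurable.aestronglyMeasurable C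
    (Eventually.of_forall fun X => hC _ ⟨X, rfl⟩)

lemma inner_toLp (lam mu : YoungDiagram) :
    ((inner ℝ (D.memLp_phiMap lam D.configMeasure).toLp (D.memLp_phiMap mu D.configMeasure).toLp : ℝ)
      : ℂ) = ∫ y, D.phiAt lam y * D.phiAt mu y ∂D.ensemble := by
  have e := D.integral_configMeasure (F := fun X => PhiFun q ζ L R s₀ s₁ s₂ s₃ lam X *
    PhiFun q ζ L R s₀ s₁ s₂ s₃ mu X) ((D.continuous_PhiFun lam).mul (D.continuous_PhiFun mu))
  simp only [D.PhiFun_removePoints] at e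
  rw [← e, MeasureTheory.L2.inner_def, ← integral_complex_ofReal]
  refine integral_congr_ae ?_
  filter_upwards [(D.memLp_phiMap lam D.configMeasure).coeFn_toLp,
    (D.memLp_phiMap mu D.configMeasure).coeFn_toLp] with X h1 h2
  rw [h1, h2, ← D.ofReal_phiMap lam, ← D.ofReal_phiMap mu]
  change ((D.phiMap mu X * D.phiMap lam X : ℝ) : ℂ) = _
  push_cast
  ring

lemma toLp_eq_zero {lam : YoungDiagram} (h : K < lam.rowLen 0) :
    (D.memLp_phiMap lam D.configMeasure).toLp = 0 := by
  rw [← inner_self_eq_zero (𝕜 := ℝ)]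
  exact_mod_cast (D.inner_toLp lam lam).trans (D.integral_ensemble_phiAt_sq_eq_zero h)

/-- Density in the uniform norm passes to L², since continuous functions are dense there and the
inclusion is continuous. -/
lemma dense_span_toLp : Dense (Submodule.span ℝ (Set.range fun lam : YoungDiagram =>
    (D.memLp_phiMap lam D.configMeasure).toLp) : Set (Lp ℝ 2 D.configMeasure)) := by
  have := countable_grid q ζ L R
  have h1 : DenseRange (ContinuousMap.toLp 2 D.configMeasure ℝ : C(Config q ζ L R, ℝ) →L[ℝ] _) :=
    ContinuousMap.toLp_denseRange ℝ D.configMeasure ℝ (by simp)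
  have h2 := h1.dense_image (ContinuousMap.toLp 2 D.configMeasure ℝ).continuous D.dense_span_phiMap
  have h3 := Submodule.map_span (ContinuousMap.toLp 2 D.configMeasure ℝ :
    C(Config q ζ L R, ℝ) →L[ℝ] Lp ℝ 2 D.configMeasure).toLinearMap (Set.range D.phiMap)
  rw [← Set.range_comp] at h3
  convert h2 using 1
  exact (congrArg (fun V : Submodule ℝ (Lp ℝ 2 D.configMeasure) => (V : Set (Lp ℝ 2 D.configMeasure))) h3).symm

/-- Completeness survives the restriction to λ₁ ≤ K because the remaining functions are null vectors
and add nothing to the dense span. -/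
lemma isOrthogonalBasis : IsOrthogonalBasis fun lam : {lam : YoungDiagram // lam.rowLen 0 ≤ K} =>
    (D.memLp_phiMap lam D.configMeasure).toLp := by
  refine ⟨fun lam h0 => ?_, fun lam mu h => ?_, ?_⟩
  · have := D.inner_toLp lam lam
    beta_reduce at h0
    rw [h0, inner_zero_left, Complex.ofReal_zero] at this
    exact D.integral_ensemble_phiAt_sq_ne_zero lam.2 this.symm
  · exact_mod_cast (D.inner_toLp lam mu).trans
      (D.integral_ensemble_phiAt_mul_phiAt fun h' => h (Subtype.ext h'))
  · refine (Submodule.dense_iff_topologicalClosure_eq_top.mp (D.dense_span_toLp.mono ?_))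
    rw [SetLike.coe_subset_coe, Submodule.span_le]
    rintro _ ⟨lam, rfl⟩
    by_cases h : lam.rowLen 0 ≤ K
    · exact Submodule.subset_span ⟨⟨lam, h⟩, rfl⟩
    · simp only [D.toLp_eq_zero (not_le.mp h)]
      exact Submodule.zero_mem _

end RacahData

end QRacah

end

open QRacah in
theorem mainTheorem4 (q ζ : ℝ) (hq₀ : 0 < q) (hq₁ : q < 1) (hζ : 0 < ζ) (L R : ℤ)
    (s₀ s₁ s₂ s₃ : ℂ) (hs : Admissible q ζ L R s₀ s₁ s₂ s₃) :
    (∀ (lam : YoungDiagram) (X : Config q ζ L R),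
      (PhiFun q ζ L R s₀ s₁ s₂ s₃ lam X).im = 0) ∧
    ∃ M : MeasureTheory.Measure (Config q ζ L R),
      MeasureTheory.IsProbabilityMeasure M ∧
      IsOrthMeasure q ζ L R s₀ s₁ s₂ s₃ M ∧
      (∀ M' : MeasureTheory.Measure (Config q ζ L R), MeasureTheory.IsProbabilityMeasure M' →
        IsOrthMeasure q ζ L R s₀ s₁ s₂ s₃ M' → M' = M) ∧
      ∃ hΦ : ∀ lam : YoungDiagram,
        MeasureTheory.MemLp (fun X => (PhiFun q ζ L R s₀ s₁ s₂ s₃ lam X).re) 2 M,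
        IsOrthogonalBasis
          (fun lam : {lam : YoungDiagram // (lam.rowLen 0 : ℤ) ≤ L - R} => (hΦ lam).toLp) ∧
        ∀ lam : YoungDiagram, L - R < (lam.rowLen 0 : ℤ) → ‖(hΦ lam).toLp‖ = 0 := by
  have D := hs.racahData hq₀ hq₁ hζ
  have hRL := hs.1
  have hK : ∀ lam : YoungDiagram, (lam.rowLen 0 : ℤ) ≤ L - R ↔ lam.rowLen 0 ≤ (L - R).toNat :=
    fun lam => by omega
  refine ⟨D.im_PhiFun, D.configMeasure, inferInstance, D.isOrthMeasure_configMeasure,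
    fun M' _ h' => D.measure_ext h' D.isOrthMeasure_configMeasure,
    fun lam => D.memLp_phiMap lam _, ?_, fun lam h => ?_⟩
  · obtain ⟨h1, h2, h3⟩ := D.isOrthogonalBasis
    refine ⟨fun lam => h1 ⟨lam, (hK _).mp lam.2⟩, fun lam mu h =>
      h2 ⟨lam, (hK _).mp lam.2⟩ ⟨mu, (hK _).mp mu.2⟩ fun h' => h (Subtype.ext ?_), ?_⟩
    · exact congrArg (fun z : {lam : YoungDiagram // lam.rowLen 0 ≤ (L - R).toNat} => z.1) h'
    · refine Eq.trans (congrArg (fun S => (Submodule.span ℝ S).topologicalClosure) ?_) h3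
      exact Set.ext fun v => ⟨fun ⟨lam, hv⟩ => ⟨⟨lam, (hK _).mp lam.2⟩, hv⟩,
        fun ⟨lam, hv⟩ => ⟨⟨lam, (hK _).mpr lam.2⟩, hv⟩⟩
  · rw [D.toLp_eq_zero (by omega), norm_zero]
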